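/- Let $G \rightrightarrows M$ be a Lie groupoid (source $\alpha$, target $\beta$, identity map $\epsilon$, inversion $i$, left and right translations $l_g(k)=gk$, $r_g(k)=kg$) on smooth Hausdorff manifolds with $\dim M=n$, $\dim G=n+m$. Let $\tau: AG\to M$ be its Lie algebroid, $A_xG=\ker T_{\epsilon(x)}\alpha$. For $X\in\Gamma(\tau)$ put $$\overleftarrow{X}(g)=(T_{\epsilon(\beta(g))}l_g)(X(\beta(g))),\qquad \overrightarrow{X}(g)=-(T_{\epsilon(\alpha(g))}r_g)\big((T_{\epsilon(\alpha(g))}i)(X(\alpha(g)))\big).$$ Let $L_d:G\to\mathbb R$ be smooth. A pair $(g,h)$ with $\beta(g)=\alpha(h)$ is a *solution* of the discrete Euler–Lagrange equations if $\overleftarrow{X}(g)(L_d)-\overrightarrow{X}(h)(L_d)=0$ for all $X\in\Gamma(\tau)$. Let $P^\tau G=V\beta\oplus V\alpha\to G$ ($V\alpha=\ker T\alpha$, $V\beta=\ker T\beta$) be the Lie algebroid with anchor $(X,Y)\mapsto X+Y$ whose bracket is determined by the Leibniz rule and $[\![(\overrightarrow X,\overleftarrow Y),(\overrightarrow{X'},\overleftarrow{Y'})]\!]=([\overrightarrow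 X,\overrightarrow{X'}],[\overleftarrow Y,\overleftarrow{Y'}])$, and let $d$ be its differential. The Poincaré–Cartan 2-section is $\Omega_{L_d}=-d\Theta^-_{L_d}$, where $\Theta^-_{L_d}(g)(X_g,Y_g)=-X_g(L_d)$. The discrete Legendre transformation $\mathbb F^-L_d:G\to A^*G$ is given by $(\mathbb F^-L_d)(h)(v)=-v(L_d\circ r_h\circ i)$ for $v\in A_{\alpha(h)}G$. Let $x_0\in M$ and let $(x^i,u^\gamma)$ be local coordinates on an open set $U\subseteq G$ with $\epsilon(x_0)\in U$, adapted to $\alpha$ (if $g$ has coordinates $(x,u)$ then $\alpha(g)$ has coordinates $x$ in a chart of $M$) and such that the identities in $U$ have coordinates $(x,0)$. Let $W$ be a symmetric neighborhood associated to $U$ and $x_0$: $W\subseteq U$ is open, $\epsilon(x_0)\in W$, $\epsilon(\alpha(W))\subseteq W$, $\epsilon(\beta(W))\subseteq W$, $i(W)=W$, and $gh\in U$ whenever $g,h\in W$ and $\beta(g)=\alpha(h)$. In these coordinates let $\mathsf b(x,u)$ be the coordinates of $\beta$ of the element $(x,u)$ and let $\mathsf p$ be defined by $(x,u)\cdot(\mathsf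 b(x,u),v)=(x,\mathsf p(x,u,v))$. Put $\rho^i_\gamma(x)=\frac{\partial \mathsf b^i}{\partial u^\gamma}(x,0)$, $R^\gamma_\mu(x,v)=\frac{\partial\mathsf p^\gamma}{\partial u^\mu}(x,0,v)$ and $$(\mathbb FL_d)^\gamma_\mu(x,u)=\rho^i_\mu(x)\frac{\partial^2L_d}{\partial x^i\partial u^\gamma}(x,u)-\frac{\partial R^\nu_\mu}{\partial u^\gamma}(x,u)\frac{\partial L_d}{\partial u^\nu}(x,u)-R^\nu_\mu(x,u)\frac{\partial^2L_d}{\partial u^\nu\partial u^\gamma}(x,u).$$ Let $g_0,h_0\in W$ be such that $(g_0,h_0)$ is a solution of the discrete Euler–Lagrange equations, and let $(y_0,v_0)$ be the coordinates of $h_0$. Then the following statements are equivalent: 1. the matrix $\big((\mathbb FL_d)^\gamma_\mu(y_0,v_0)\big)$ is regular; 2. $\Omega_{L_d}$ is nondegenerate at $h_0$; 3. $\mathbb F^-L_d$ is a local diffeomorphism at $h_0$. Any of them implies the following: there exist open neighborhoods $X_0\subseteq W$ of $g_0$ and $Y_0\subseteq W$ of $h_0$ such that for every $g\in X_0$ there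 is a unique $\Psi(g)=h\in Y_0$ for which $(g,h)$ is a solution of the discrete Euler–Lagrange equations; and $\Psi:X_0\to Y_0$ is a local discrete Euler–Lagrange evolution operator, i.e. $\Psi$ is smooth and $(g,\Psi(g))$ is a solution for every $g\in X_0$. -/

import Mathlib

open Bundle Set Topology
open scoped Manifold ContDiff

noncomputable section

/-- `ℝⁿ × ℝᵐ`, the space of coordinates `(x, u)`. -/
abbrev CoordSpace (n m : ℕ) : Type := EuclideanSpace ℝ (Fin n) × EuclideanSpace ℝ (Fin m)

/-- A Lie groupoid `G ⇉ M`, with `dim M = n` and `dim G = n + m`.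
The multiplication `mul g h = gh` is meaningful only on the set
`G₂ = {(g, h) | β g = α h}` of composable pairs (its values elsewhere are irrelevant), and its
smoothness is smoothness on `G₂ ⊆ G × G`. -/
structure LieGroupoid (n m : ℕ) (M G : Type*)
    [TopologicalSpace M] [ChartedSpace (EuclideanSpace ℝ (Fin n)) M]
    [TopologicalSpace G] [ChartedSpace (CoordSpace n m) G] where
  /-- the source map -/
  α : G → M
  /-- the target map -/
  β : G → M
  /-- the identity map -/
  ε : M → G
  /-- the inversion map -/
  inv : G → G
  /-- the multiplication -/
  mul : G → G → G
  α_mul : ∀ g h, β g = α h → α (mul g h) = α g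
  β_mul : ∀ g h, β g = α h → β (mul g h) = β h
  mul_assoc : ∀ g h k, β g = α h → β h = α k → mul g (mul h k) = mul (mul g h) k
  α_ε : ∀ x, α (ε x) = x
  β_ε : ∀ x, β (ε x) = x
  ε_mul : ∀ g, mul (ε (α g)) g = g
  mul_ε : ∀ g, mul g (ε (β g)) = g
  α_inv : ∀ g, α (inv g) = β g
  β_inv : ∀ g, β (inv g) = α g
  inv_mul : ∀ g, mul (inv g) g = ε (β g)
  mul_inv : ∀ g, mul g (inv g) = ε (α g)
  contMDiff_α : ContMDiff 𝓘(ℝ, CoordSpace n m) 𝓘(ℝ, EuclideanSpace ℝ (Fin n)) ∞ α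
  contMDiff_β : ContMDiff 𝓘(ℝ, CoordSpace n m) 𝓘(ℝ, EuclideanSpace ℝ (Fin n)) ∞ β
  contMDiff_ε : ContMDiff 𝓘(ℝ, EuclideanSpace ℝ (Fin n)) 𝓘(ℝ, CoordSpace n m) ∞ ε
  contMDiff_inv : ContMDiff 𝓘(ℝ, CoordSpace n m) 𝓘(ℝ, CoordSpace n m) ∞ inv
  contMDiffOn_mul : ContMDiffOn (𝓘(ℝ, CoordSpace n m).prod 𝓘(ℝ, CoordSpace n m))
    𝓘(ℝ, CoordSpace n m) ∞ (fun p : G × G => mul p.1 p.2) {p | β p.1 = α p.2}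
  /-- `α` is a submersion -/
  submersion_α : ∀ g, Function.Surjective
    (mfderiv 𝓘(ℝ, CoordSpace n m) 𝓘(ℝ, EuclideanSpace ℝ (Fin n)) α g)
  /-- `β` is a submersion -/
  submersion_β : ∀ g, Function.Surjective
    (mfderiv 𝓘(ℝ, CoordSpace n m) 𝓘(ℝ, EuclideanSpace ℝ (Fin n)) β g)

namespace LieGroupoid

variable {n m : ℕ} {M G : Type*}
  [TopologicalSpace M] [ChartedSpace (EuclideanSpace ℝ (Fin n)) M]
  [TopologicalSpace G] [ChartedSpace (CoordSpace n m) G]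

/-! ### The vector bundle `AG → M` -/

/-- The subspace `ker T_{ε(x)} α` of `T_{ε(x)} G`. -/
abbrev kerTα (𝒢 : LieGroupoid n m M G) (x : M) :
    Submodule ℝ (TangentSpace 𝓘(ℝ, CoordSpace n m) (𝒢.ε x)) :=
  LinearMap.ker (mfderiv 𝓘(ℝ, CoordSpace n m) 𝓘(ℝ, EuclideanSpace ℝ (Fin n)) 𝒢.α
    (𝒢.ε x)).toLinearMap

/-- The fibre `A_x G = ker T_{ε(x)} α` of the Lie algebroid `τ : AG → M`. -/
def A (𝒢 : LieGroupoid n m M G) (x : M) : Type := 𝒢.kerTα x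

section fibreInstances

variable (𝒢 : LieGroupoid n m M G) (x : M)

instance : AddCommGroup (𝒢.A x) := inferInstanceAs (AddCommGroup (𝒢.kerTα x))
instance : Module ℝ (𝒢.A x) := inferInstanceAs (Module ℝ (𝒢.kerTα x))
instance : TopologicalSpace (𝒢.A x) := inferInstanceAs (TopologicalSpace (𝒢.kerTα x))
instance : IsTopologicalAddGroup (𝒢.A x) :=
  inferInstanceAs (IsTopologicalAddGroup (𝒢.kerTα x))
instance : ContinuousSMul ℝ (𝒢.A x) := inferInstanceAs (ContinuousSMul ℝ (𝒢.kerTα x))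

end fibreInstances

/-- The inclusion `A_x G ⊆ T_{ε(x)} G`. -/
def incl (𝒢 : LieGroupoid n m M G) (x : M) :
    𝒢.A x →L[ℝ] TangentSpace 𝓘(ℝ, CoordSpace n m) (𝒢.ε x) :=
  (𝒢.kerTα x).subtypeL

/-- A vector of `ker T_{ε(x)} α` as an element of `A_x G`. -/
def ofKer (𝒢 : LieGroupoid n m M G) {x : M} (v : TangentSpace 𝓘(ℝ, CoordSpace n m) (𝒢.ε x))
    (hv : mfderiv 𝓘(ℝ, CoordSpace n m) 𝓘(ℝ, EuclideanSpace ℝ (Fin n)) 𝒢.α (𝒢.ε x) v = 0) :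
    𝒢.A x :=
  (⟨v, hv⟩ : 𝒢.kerTα x)

lemma incl_ofKer (𝒢 : LieGroupoid n m M G) {x : M}
    (v : TangentSpace 𝓘(ℝ, CoordSpace n m) (𝒢.ε x))
    (hv : mfderiv 𝓘(ℝ, CoordSpace n m) 𝓘(ℝ, EuclideanSpace ℝ (Fin n)) 𝒢.α (𝒢.ε x) v = 0) :
    𝒢.incl x (𝒢.ofKer v hv) = v := rfl

lemma incl_injective (𝒢 : LieGroupoid n m M G) (x : M) : Function.Injective (𝒢.incl x) :=
  Subtype.val_injective

lemma mfderiv_α_incl (𝒢 : LieGroupoid n m M G) (x : M) (v : 𝒢.A x) :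
    mfderiv 𝓘(ℝ, CoordSpace n m) 𝓘(ℝ, EuclideanSpace ℝ (Fin n)) 𝒢.α (𝒢.ε x) (𝒢.incl x v) = 0 :=
  v.2

/-- Data for a local trivialization of `AG`: a chart `φ` of `G`, a chart `ψ` of `M` and a linear
map `κ : ℝⁿ × ℝᵐ → ℝᵐ`. Where `κ` is injective on the kernel of the derivative of `α` written in
the charts, `v ↦ κ (Tφ v)` identifies `A_x G` with `ℝᵐ`. -/
structure TrivData (n m : ℕ) (M G : Type*)
    [TopologicalSpace M] [ChartedSpace (EuclideanSpace ℝ (Fin n)) M]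
    [TopologicalSpace G] [ChartedSpace (CoordSpace n m) G] where
  φ : OpenPartialHomeomorph G (CoordSpace n m)
  ψ : OpenPartialHomeomorph M (EuclideanSpace ℝ (Fin n))
  κ : CoordSpace n m →L[ℝ] EuclideanSpace ℝ (Fin m)
  hφ : φ ∈ IsManifold.maximalAtlas 𝓘(ℝ, CoordSpace n m) ∞ G
  hψ : ψ ∈ IsManifold.maximalAtlas 𝓘(ℝ, EuclideanSpace ℝ (Fin n)) ∞ M

namespace TrivData

variable (d : TrivData n m M G) (𝒢 : LieGroupoid n m M G)

/-- `α` written in the charts. -/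
def αLoc : CoordSpace n m → EuclideanSpace ℝ (Fin n) := fun q => d.ψ (𝒢.α (d.φ.symm q))

/-- `(T(α written in charts), κ)` at `ε(x)`. -/
def D (x : M) : CoordSpace n m →L[ℝ] CoordSpace n m :=
  (fderiv ℝ (d.αLoc 𝒢) (d.φ (𝒢.ε x))).prod d.κ

/-- The domain of the trivialization. -/
def base : Set M := {x | x ∈ d.ψ.source ∧ 𝒢.ε x ∈ d.φ.source ∧ IsUnit (d.D 𝒢 x)}

/-- Points of `M` that are covered by the charts. -/
def dom : Set M := {x | x ∈ d.ψ.source ∧ 𝒢.ε x ∈ d.φ.source}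

/-- The derivative of the chart at `ε(x)`. -/
def Tφ (x : M) : TangentSpace 𝓘(ℝ, CoordSpace n m) (𝒢.ε x) →L[ℝ] CoordSpace n m :=
  mfderiv 𝓘(ℝ, CoordSpace n m) 𝓘(ℝ, CoordSpace n m) d.φ (𝒢.ε x)

/-- The derivative of the inverse of the chart at `ε(x)`. -/
def Tφinv (x : M) : CoordSpace n m →L[ℝ] TangentSpace 𝓘(ℝ, CoordSpace n m) (𝒢.ε x) :=
  mfderiv 𝓘(ℝ, CoordSpace n m) 𝓘(ℝ, CoordSpace n m) d.φ.symm (d.φ (𝒢.ε x))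

lemma mdiff : d.φ.MDifferentiable 𝓘(ℝ, CoordSpace n m) 𝓘(ℝ, CoordSpace n m) :=
  ⟨(contMDiffOn_of_mem_maximalAtlas d.hφ).mdifferentiableOn (by simp),
    (contMDiffOn_symm_of_mem_maximalAtlas d.hφ).mdifferentiableOn (by simp)⟩

lemma mdiffψ : d.ψ.MDifferentiable 𝓘(ℝ, EuclideanSpace ℝ (Fin n))
    𝓘(ℝ, EuclideanSpace ℝ (Fin n)) :=
  ⟨(contMDiffOn_of_mem_maximalAtlas d.hψ).mdifferentiableOn (by simp),
    (contMDiffOn_symm_of_mem_maximalAtlas d.hψ).mdifferentiableOn (by simp)⟩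

lemma isOpen_dom : IsOpen (d.dom 𝒢) :=
  d.ψ.open_source.inter (d.φ.open_source.preimage 𝒢.contMDiff_ε.continuous)

variable {d 𝒢}

lemma base_subset_dom : d.base 𝒢 ⊆ d.dom 𝒢 := fun _ h => ⟨h.1, h.2.1⟩

lemma Tφinv_Tφ {x : M} (hx : 𝒢.ε x ∈ d.φ.source)
    (v : TangentSpace 𝓘(ℝ, CoordSpace n m) (𝒢.ε x)) : d.Tφinv 𝒢 x (d.Tφ 𝒢 x v) = v :=
  DFunLike.congr_fun (d.mdiff.symm_comp_deriv hx) v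

lemma Tφ_Tφinv {x : M} (hx : 𝒢.ε x ∈ d.φ.source) (v : CoordSpace n m) :
    d.Tφ 𝒢 x (d.Tφinv 𝒢 x v) = v := by
  have h := DFunLike.congr_fun (d.mdiff.comp_symm_deriv (d.φ.map_source hx)) v
  rw [d.φ.left_inv hx] at h
  exact h

variable (d 𝒢) in
lemma contDiffOn_αLoc : ContDiffOn ℝ ∞ (d.αLoc 𝒢)
    (d.φ.target ∩ d.φ.symm ⁻¹' (𝒢.α ⁻¹' d.ψ.source)) := by
  rw [← contMDiffOn_iff_contDiffOn]
  have h1 : ContMDiffOn 𝓘(ℝ, CoordSpace n m) 𝓘(ℝ, EuclideanSpace ℝ (Fin n)) ∞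
      (fun q => 𝒢.α (d.φ.symm q)) d.φ.target :=
    𝒢.contMDiff_α.comp_contMDiffOn (contMDiffOn_symm_of_mem_maximalAtlas d.hφ)
  exact (contMDiffOn_of_mem_maximalAtlas d.hψ).comp' h1

variable (d 𝒢) in
lemma isOpen_αLocDom : IsOpen (d.φ.target ∩ d.φ.symm ⁻¹' (𝒢.α ⁻¹' d.ψ.source)) :=
  d.φ.symm.isOpen_inter_preimage (d.ψ.open_source.preimage 𝒢.contMDiff_α.continuous)

lemma mem_αLocDom {x : M} (hx : x ∈ d.dom 𝒢) :
    d.φ (𝒢.ε x) ∈ d.φ.target ∩ d.φ.symm ⁻¹' (𝒢.α ⁻¹' d.ψ.source) := by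
  refine ⟨d.φ.map_source hx.2, ?_⟩
  simp only [mem_preimage]
  rw [d.φ.left_inv hx.2, 𝒢.α_ε]
  exact hx.1

/-- The kernel of `T α` is the kernel of the derivative of `α` in charts. -/
lemma mem_ker_iff {x : M} (hx : x ∈ d.dom 𝒢)
    (v : TangentSpace 𝓘(ℝ, CoordSpace n m) (𝒢.ε x)) :
    mfderiv 𝓘(ℝ, CoordSpace n m) 𝓘(ℝ, EuclideanSpace ℝ (Fin n)) 𝒢.α (𝒢.ε x) v = 0 ↔
      fderiv ℝ (d.αLoc 𝒢) (d.φ (𝒢.ε x)) (d.Tφ 𝒢 x v) = 0 := by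
  have hα : MDifferentiableAt 𝓘(ℝ, CoordSpace n m) 𝓘(ℝ, EuclideanSpace ℝ (Fin n)) 𝒢.α (𝒢.ε x) :=
    𝒢.contMDiff_α.mdifferentiable (by simp) _
  have hs : 𝒢.α (𝒢.ε x) ∈ d.ψ.source := by rw [𝒢.α_ε]; exact hx.1
  have hψ := d.mdiffψ.mdifferentiableAt hs
  have hL : MDifferentiableAt 𝓘(ℝ, CoordSpace n m) 𝓘(ℝ, EuclideanSpace ℝ (Fin n)) (d.αLoc 𝒢)
      (d.φ (𝒢.ε x)) := by
    refine DifferentiableAt.mdifferentiableAt ?_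
    exact ((d.contDiffOn_αLoc 𝒢).contDiffAt
      ((d.isOpen_αLocDom 𝒢).mem_nhds (mem_αLocDom hx))).differentiableAt (by simp)
  have h1 := mfderiv_comp (𝒢.ε x) hψ hα
  have h2 := mfderiv_comp (𝒢.ε x) hL (d.mdiff.mdifferentiableAt hx.2)
  have hEq : (d.ψ ∘ 𝒢.α) =ᶠ[𝓝 (𝒢.ε x)] (d.αLoc 𝒢 ∘ d.φ) := by
    filter_upwards [d.φ.open_source.mem_nhds hx.2] with g hg
    simp [αLoc, d.φ.left_inv hg]
  rw [hEq.mfderiv_eq] at h1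
  have h3 := h2.symm.trans h1
  rw [mfderiv_eq_fderiv] at h3
  have h4 : fderiv ℝ (d.αLoc 𝒢) (d.φ (𝒢.ε x)) (d.Tφ 𝒢 x v) =
    mfderiv 𝓘(ℝ, EuclideanSpace ℝ (Fin n)) 𝓘(ℝ, EuclideanSpace ℝ (Fin n)) d.ψ (𝒢.α (𝒢.ε x))
      (mfderiv 𝓘(ℝ, CoordSpace n m) 𝓘(ℝ, EuclideanSpace ℝ (Fin n)) 𝒢.α (𝒢.ε x) v) :=
    DFunLike.congr_fun h3 v
  rw [h4]
  constructor
  · intro h; rw [h]; exact map_zero _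
  · intro h
    exact (d.mdiffψ.mfderiv_injective hs) (h.trans (map_zero _).symm)

variable (d 𝒢) in
lemma contMDiffOn_D : ContMDiffOn 𝓘(ℝ, EuclideanSpace ℝ (Fin n))
    𝓘(ℝ, CoordSpace n m →L[ℝ] CoordSpace n m) ∞ (d.D 𝒢) (d.dom 𝒢) := by
  have h1 : ContDiffOn ℝ ∞ (fderiv ℝ (d.αLoc 𝒢))
      (d.φ.target ∩ d.φ.symm ⁻¹' (𝒢.α ⁻¹' d.ψ.source)) :=
    (d.contDiffOn_αLoc 𝒢).fderiv_of_isOpen (d.isOpen_αLocDom 𝒢) (by simp)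
  have h2 : ContMDiffOn 𝓘(ℝ, EuclideanSpace ℝ (Fin n)) 𝓘(ℝ, CoordSpace n m) ∞
      (fun x => d.φ (𝒢.ε x)) (d.dom 𝒢) :=
    (contMDiffOn_of_mem_maximalAtlas d.hφ).comp 𝒢.contMDiff_ε.contMDiffOn (fun x hx => hx.2)
  have h3 := (contMDiffOn_iff_contDiffOn.2 h1).comp h2 (fun x hx => mem_αLocDom hx)
  have h4 : ContDiff ℝ ∞ (fun T : CoordSpace n m →L[ℝ] EuclideanSpace ℝ (Fin n) =>
      T.prod d.κ) := by
    have : (fun T : CoordSpace n m →L[ℝ] EuclideanSpace ℝ (Fin n) => T.prod d.κ) =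
        fun T => (ContinuousLinearMap.inl ℝ _ _).comp T +
          (ContinuousLinearMap.inr ℝ _ _).comp d.κ := by
      funext T; ext v <;> simp
    rw [this]
    exact (contDiff_const.clm_comp contDiff_id).add contDiff_const
  exact h4.contMDiff.comp_contMDiffOn h3

set_option synthInstance.maxHeartbeats 400000 in
instance : HasSummableGeomSeries (CoordSpace n m →L[ℝ] CoordSpace n m) :=
  haveI : CompleteSpace (CoordSpace n m →L[ℝ] CoordSpace n m) := inferInstance
  inferInstance

variable (d 𝒢) in
lemma isOpen_base : IsOpen (d.base 𝒢) := by
  have : d.base 𝒢 = d.dom 𝒢 ∩ d.D 𝒢 ⁻¹' {T | IsUnit T} := by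
    ext x; exact and_assoc.symm
  rw [this]
  exact (d.contMDiffOn_D 𝒢).continuousOn.isOpen_inter_preimage (d.isOpen_dom 𝒢) Units.isOpen

lemma D_inverse {x : M} (hx : x ∈ d.base 𝒢) (w : CoordSpace n m) :
    d.D 𝒢 x (Ring.inverse (d.D 𝒢 x) w) = w :=
  DFunLike.congr_fun (Ring.mul_inverse_cancel _ hx.2.2) w

lemma inverse_D {x : M} (hx : x ∈ d.base 𝒢) (w : CoordSpace n m) :
    Ring.inverse (d.D 𝒢 x) (d.D 𝒢 x w) = w :=
  DFunLike.congr_fun (Ring.inverse_mul_cancel _ hx.2.2) w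

lemma mem_ker_of {x : M} (hx : x ∈ d.base 𝒢) (w : EuclideanSpace ℝ (Fin m)) :
    mfderiv 𝓘(ℝ, CoordSpace n m) 𝓘(ℝ, EuclideanSpace ℝ (Fin n)) 𝒢.α (𝒢.ε x)
      (d.Tφinv 𝒢 x (Ring.inverse (d.D 𝒢 x) (0, w))) = 0 := by
  rw [mem_ker_iff (base_subset_dom hx), Tφ_Tφinv hx.2.1]
  exact congrArg Prod.fst (D_inverse hx (0, w))

open Classical in
variable (d 𝒢) in
/-- The inverse of the trivialization on the fibre over `x`. -/
def back (x : M) (w : EuclideanSpace ℝ (Fin m)) : 𝒢.A x :=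
  if hx : x ∈ d.base 𝒢 then
    𝒢.ofKer (d.Tφinv 𝒢 x (Ring.inverse (d.D 𝒢 x) (0, w))) (mem_ker_of hx w)
  else 0

lemma incl_back {x : M} (hx : x ∈ d.base 𝒢) (w : EuclideanSpace ℝ (Fin m)) :
    𝒢.incl x (d.back 𝒢 x w) = d.Tφinv 𝒢 x (Ring.inverse (d.D 𝒢 x) (0, w)) := by
  unfold back
  rw [dif_pos hx, incl_ofKer]

lemma back_apply {x : M} (hx : x ∈ d.base 𝒢) (v : 𝒢.A x) :
    d.Tφinv 𝒢 x (Ring.inverse (d.D 𝒢 x) (0, d.κ (d.Tφ 𝒢 x (𝒢.incl x v)))) = 𝒢.incl x v := by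
  have h0 : fderiv ℝ (d.αLoc 𝒢) (d.φ (𝒢.ε x)) (d.Tφ 𝒢 x (𝒢.incl x v)) = 0 :=
    (mem_ker_iff (base_subset_dom hx) _).1 (𝒢.mfderiv_α_incl x v)
  have h1 : ((0 : EuclideanSpace ℝ (Fin n)), d.κ (d.Tφ 𝒢 x (𝒢.incl x v))) =
      d.D 𝒢 x (d.Tφ 𝒢 x (𝒢.incl x v)) := Prod.ext h0.symm rfl
  rw [h1, inverse_D hx, Tφinv_Tφ hx.2.1]

variable (d 𝒢) in
/-- The local trivialization `(x, v) ↦ (x, κ (Tφ v))` of `AG`. -/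
def triv : Pretrivialization (EuclideanSpace ℝ (Fin m)) (π (EuclideanSpace ℝ (Fin m)) 𝒢.A) where
  toFun p := (p.1, d.κ (d.Tφ 𝒢 p.1 (𝒢.incl p.1 p.2)))
  invFun q := ⟨q.1, d.back 𝒢 q.1 q.2⟩
  source := TotalSpace.proj ⁻¹' d.base 𝒢
  target := d.base 𝒢 ×ˢ univ
  map_source' := fun p hp => ⟨hp, mem_univ _⟩
  map_target' := fun q hq => hq.1
  left_inv' := by
    rintro ⟨x, v⟩ hx
    refine congrArg (TotalSpace.mk x) (𝒢.incl_injective x ?_)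
    exact (incl_back hx _).trans (back_apply hx v)
  right_inv' := by
    rintro ⟨x, w⟩ ⟨hx, -⟩
    refine Prod.ext rfl ?_
    change d.κ (d.Tφ 𝒢 x (𝒢.incl x (d.back 𝒢 x w))) = w
    rw [incl_back hx, Tφ_Tφinv hx.2.1]
    exact congrArg Prod.snd (D_inverse hx (0, w))
  open_target := (d.isOpen_base 𝒢).prod isOpen_univ
  baseSet := d.base 𝒢
  open_baseSet := d.isOpen_base 𝒢
  source_eq := rfl
  target_eq := rfl
  proj_toFun := fun _ _ => rfl

lemma triv_symm {x : M} (hx : x ∈ d.base 𝒢) (w : EuclideanSpace ℝ (Fin m)) :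
    𝒢.incl x ((d.triv 𝒢).symm x w) = d.Tφinv 𝒢 x (Ring.inverse (d.D 𝒢 x) (0, w)) := by
  have h : (⟨x, (d.triv 𝒢).symm x w⟩ : TotalSpace (EuclideanSpace ℝ (Fin m)) 𝒢.A) =
      ⟨x, d.back 𝒢 x w⟩ := (d.triv 𝒢).mk_symm (b := x) hx w
  have h2 : (d.triv 𝒢).symm x w = d.back 𝒢 x w := eq_of_heq (TotalSpace.mk.inj h).2
  rw [h2, incl_back hx]

variable (d 𝒢) in
instance triv_linear : (d.triv 𝒢).IsLinear ℝ where
  linear x _ :=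
    { map_add := fun v w => by
        change d.κ (d.Tφ 𝒢 x (𝒢.incl x (v + w))) = d.κ (d.Tφ 𝒢 x (𝒢.incl x v)) +
          d.κ (d.Tφ 𝒢 x (𝒢.incl x w))
        simp only [map_add]
      map_smul := fun c v => by
        change d.κ (d.Tφ 𝒢 x (𝒢.incl x (c • v))) = c • d.κ (d.Tφ 𝒢 x (𝒢.incl x v))
        simp only [map_smul] }

/-- The transition functions. -/
lemma exists_coordChange (d d' : TrivData n m M G) (𝒢 : LieGroupoid n m M G) :
    ∃ f : M → EuclideanSpace ℝ (Fin m) →L[ℝ] EuclideanSpace ℝ (Fin m),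
      ContMDiffOn 𝓘(ℝ, EuclideanSpace ℝ (Fin n))
        𝓘(ℝ, EuclideanSpace ℝ (Fin m) →L[ℝ] EuclideanSpace ℝ (Fin m)) ∞ f
        ((d.triv 𝒢).baseSet ∩ (d'.triv 𝒢).baseSet) ∧
      ∀ b ∈ (d.triv 𝒢).baseSet ∩ (d'.triv 𝒢).baseSet, ∀ v,
        f b v = ((d'.triv 𝒢) ⟨b, (d.triv 𝒢).symm b v⟩).2 := by
  let c : CoordSpace n m → CoordSpace n m := fun q => d'.φ (d.φ.symm q)
  have hopen : IsOpen (d.φ.target ∩ d.φ.symm ⁻¹' d'.φ.source) :=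
    d.φ.symm.isOpen_inter_preimage d'.φ.open_source
  have hc : ContDiffOn ℝ ∞ c (d.φ.target ∩ d.φ.symm ⁻¹' d'.φ.source) := by
    rw [← contMDiffOn_iff_contDiffOn]
    exact (contMDiffOn_of_mem_maximalAtlas d'.hφ).comp'
      (contMDiffOn_symm_of_mem_maximalAtlas d.hφ)
  have hmem : ∀ x, 𝒢.ε x ∈ d.φ.source → 𝒢.ε x ∈ d'.φ.source →
      d.φ (𝒢.ε x) ∈ d.φ.target ∩ d.φ.symm ⁻¹' d'.φ.source := by
    intro x h h'
    refine ⟨d.φ.map_source h, ?_⟩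
    simp only [mem_preimage]
    rwa [d.φ.left_inv h]
  have hc' : ContMDiffOn 𝓘(ℝ, EuclideanSpace ℝ (Fin n))
      𝓘(ℝ, CoordSpace n m →L[ℝ] CoordSpace n m) ∞ (fun x => fderiv ℝ c (d.φ (𝒢.ε x)))
      (d.base 𝒢 ∩ d'.base 𝒢) := by
    have h1 := contMDiffOn_iff_contDiffOn.2 (hc.fderiv_of_isOpen hopen (m := ∞) (by simp))
    have h2 : ContMDiffOn 𝓘(ℝ, EuclideanSpace ℝ (Fin n)) 𝓘(ℝ, CoordSpace n m) ∞
        (fun x => d.φ (𝒢.ε x)) (d.base 𝒢 ∩ d'.base 𝒢) :=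
      (contMDiffOn_of_mem_maximalAtlas d.hφ).comp 𝒢.contMDiff_ε.contMDiffOn
        (fun x hx => hx.1.2.1)
    exact h1.comp h2 (fun x hx => hmem x hx.1.2.1 hx.2.2.1)
  have hinv : ContMDiffOn 𝓘(ℝ, EuclideanSpace ℝ (Fin n))
      𝓘(ℝ, CoordSpace n m →L[ℝ] CoordSpace n m) ∞ (fun x => Ring.inverse (d.D 𝒢 x))
      (d.base 𝒢 ∩ d'.base 𝒢) := by
    intro x hx
    obtain ⟨u, hu⟩ := hx.1.2.2
    have h1 : ContDiffAt ℝ ∞ Ring.inverse (d.D 𝒢 x) := by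
      rw [← hu]; exact contDiffAt_ringInverse ℝ u
    have h2 : ContMDiffWithinAt 𝓘(ℝ, EuclideanSpace ℝ (Fin n))
        𝓘(ℝ, CoordSpace n m →L[ℝ] CoordSpace n m) ∞ (d.D 𝒢) (d.base 𝒢 ∩ d'.base 𝒢) x :=
      (d.contMDiffOn_D 𝒢).mono (inter_subset_left.trans base_subset_dom) x hx
    exact h1.contMDiffAt.comp_contMDiffWithinAt x h2
  refine ⟨fun x => d'.κ.comp ((fderiv ℝ c (d.φ (𝒢.ε x))).comp
    ((Ring.inverse (d.D 𝒢 x)).comp (ContinuousLinearMap.inr ℝ _ _))), ?_, ?_⟩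
  · exact contMDiffOn_const.clm_comp (hc'.clm_comp (hinv.clm_comp contMDiffOn_const))
  · rintro x ⟨hx, hx'⟩ w
    change x ∈ d.base 𝒢 at hx
    change x ∈ d'.base 𝒢 at hx'
    change d'.κ (fderiv ℝ c (d.φ (𝒢.ε x)) (Ring.inverse (d.D 𝒢 x) (0, w))) =
      d'.κ (d'.Tφ 𝒢 x (𝒢.incl x ((d.triv 𝒢).symm x w)))
    rw [triv_symm hx]
    congr 1
    have hcd : fderiv ℝ c (d.φ (𝒢.ε x)) = (d'.Tφ 𝒢 x).comp (d.Tφinv 𝒢 x) := by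
      have h1 : MDifferentiableAt 𝓘(ℝ, CoordSpace n m) 𝓘(ℝ, CoordSpace n m) d'.φ
          (d.φ.symm (d.φ (𝒢.ε x))) := by
        rw [d.φ.left_inv hx.2.1]; exact d'.mdiff.mdifferentiableAt hx'.2.1
      have h2 := mfderiv_comp (d.φ (𝒢.ε x)) h1
        (d.mdiff.symm.mdifferentiableAt (d.φ.map_source hx.2.1))
      rw [mfderiv_eq_fderiv, d.φ.left_inv hx.2.1] at h2
      exact h2
    rw [hcd]; rfl

/-- Every point lies in the domain of some trivialization. -/
lemma exists_mem_base [IsManifold 𝓘(ℝ, EuclideanSpace ℝ (Fin n)) ∞ M]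
    [IsManifold 𝓘(ℝ, CoordSpace n m) ∞ G] (𝒢 : LieGroupoid n m M G) (x : M) :
    ∃ d : TrivData n m M G, x ∈ d.base 𝒢 := by
  let d₀ : TrivData n m M G :=
    { φ := chartAt _ (𝒢.ε x)
      ψ := chartAt _ x
      κ := 0
      hφ := IsManifold.chart_mem_maximalAtlas _
      hψ := IsManifold.chart_mem_maximalAtlas _ }
  have hx : x ∈ d₀.dom 𝒢 := ⟨mem_chart_source _ _, mem_chart_source _ _⟩
  let a : CoordSpace n m →L[ℝ] EuclideanSpace ℝ (Fin n) :=
    fderiv ℝ (d₀.αLoc 𝒢) (d₀.φ (𝒢.ε x))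
  let T : CoordSpace n m →ₗ[ℝ] EuclideanSpace ℝ (Fin n) :=
    (mfderiv 𝓘(ℝ, CoordSpace n m) 𝓘(ℝ, EuclideanSpace ℝ (Fin n)) 𝒢.α (𝒢.ε x)).toLinearMap
  let E : CoordSpace n m ≃ₗ[ℝ] CoordSpace n m :=
    LinearEquiv.ofLinearMap (d₀.Tφ 𝒢 x).toLinearMap (d₀.Tφinv 𝒢 x).toLinearMap
      (LinearMap.ext fun v => Tφ_Tφinv hx.2 v) (LinearMap.ext fun v => Tφinv_Tφ hx.2 v)
  have hker : ∀ v, T v = 0 ↔ a (E v) = 0 := fun v => mem_ker_iff hx v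
  have hT : Module.finrank ℝ (LinearMap.ker T) = m := by
    have h1 := LinearMap.finrank_range_add_finrank_ker T
    have h2 : LinearMap.range T = ⊤ := LinearMap.range_eq_top.2 (𝒢.submersion_α (𝒢.ε x))
    rw [h2, finrank_top] at h1
    simp [CoordSpace] at h1
    omega
  have hK : Module.finrank ℝ (LinearMap.ker a.toLinearMap) = m := by
    have hmap : LinearMap.ker a.toLinearMap = (LinearMap.ker T).map E.toLinearMap := by
      ext w
      constructor
      · intro hw
        refine ⟨E.symm w, ?_, E.apply_symm_apply w⟩
        change T (E.symm w) = 0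
        rw [hker, E.apply_symm_apply]
        exact hw
      · rintro ⟨v, hv, rfl⟩
        exact (hker v).1 hv
    rw [hmap, LinearEquiv.finrank_map_eq E, hT]
  let e : LinearMap.ker a.toLinearMap ≃ₗ[ℝ] EuclideanSpace ℝ (Fin m) :=
    LinearEquiv.ofFinrankEq _ _ (by rw [hK]; simp)
  obtain ⟨P, hP⟩ := (LinearMap.ker a.toLinearMap).subtype.exists_leftInverse_of_injective
    (Submodule.ker_subtype _)
  let κ : CoordSpace n m →L[ℝ] EuclideanSpace ℝ (Fin m) :=
    LinearMap.toContinuousLinearMap (e.toLinearMap ∘ₗ P)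
  refine ⟨{ d₀ with κ := κ }, hx.1, hx.2, ?_⟩
  change IsUnit (a.prod κ)
  have hinj : Function.Injective (a.prod κ) := by
    rw [injective_iff_map_eq_zero]
    intro v hv
    have h1 : a v = 0 := congrArg Prod.fst hv
    have h2 : e (P v) = 0 := congrArg Prod.snd hv
    have h3 : P v = 0 := by simpa using h2
    have h4 : P v = ⟨v, h1⟩ :=
      DFunLike.congr_fun hP (⟨v, h1⟩ : LinearMap.ker a.toLinearMap)
    rw [h3] at h4
    exact (congrArg Subtype.val h4).symm
  let Q : CoordSpace n m ≃ₗ[ℝ] CoordSpace n m :=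
    LinearEquiv.ofInjectiveEndo (a.prod κ).toLinearMap hinj
  let Q' := Q.toContinuousLinearEquiv
  refine ⟨ContinuousLinearEquiv.toUnit Q', ?_⟩
  ext v <;> rfl

end TrivData

variable [IsManifold 𝓘(ℝ, EuclideanSpace ℝ (Fin n)) ∞ M]
  [IsManifold 𝓘(ℝ, CoordSpace n m) ∞ G]

/-- The smooth vector bundle `AG → M`, given by its local trivializations. -/
def prebundle (𝒢 : LieGroupoid n m M G) :
    VectorPrebundle ℝ (EuclideanSpace ℝ (Fin m)) 𝒢.A where
  pretrivializationAtlas := range fun d : TrivData n m M G => d.triv 𝒢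
  pretrivialization_linear' := by
    rintro _ ⟨d, rfl⟩
    exact d.triv_linear 𝒢
  pretrivializationAt x := (TrivData.exists_mem_base 𝒢 x).choose.triv 𝒢
  mem_base_pretrivializationAt x := (TrivData.exists_mem_base 𝒢 x).choose_spec
  pretrivialization_mem_atlas x := ⟨_, rfl⟩
  exists_coordChange := by
    rintro _ ⟨d, rfl⟩ _ ⟨d', rfl⟩
    obtain ⟨f, hf, h⟩ := TrivData.exists_coordChange d d' 𝒢
    exact ⟨f, hf.continuousOn, h⟩
  totalSpaceMk_isInducing x := by
    obtain hx := (TrivData.exists_mem_base 𝒢 x).choose_spec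
    set d := (TrivData.exists_mem_base 𝒢 x).choose
    let ev : 𝒢.A x →L[ℝ] EuclideanSpace ℝ (Fin m) := d.κ.comp ((d.Tφ 𝒢 x).comp (𝒢.incl x))
    have hind : IsInducing ev := by
      have hincl : IsInducing (𝒢.incl x) := IsInducing.subtypeVal
      let back : EuclideanSpace ℝ (Fin m) →L[ℝ] TangentSpace 𝓘(ℝ, CoordSpace n m) (𝒢.ε x) :=
        (d.Tφinv 𝒢 x).comp ((Ring.inverse (d.D 𝒢 x)).comp (ContinuousLinearMap.inr ℝ _ _))
      have hb : back ∘ ev = 𝒢.incl x := by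
        funext v
        exact TrivData.back_apply hx v
      exact IsInducing.of_comp ev.continuous back.continuous (hb ▸ hincl)
    exact isInducing_const_prod.2 hind

section bundleInstances

variable (𝒢 : LieGroupoid n m M G)

instance : TopologicalSpace (TotalSpace (EuclideanSpace ℝ (Fin m)) 𝒢.A) :=
  𝒢.prebundle.totalSpaceTopology

instance : FiberBundle (EuclideanSpace ℝ (Fin m)) 𝒢.A := 𝒢.prebundle.toFiberBundle

instance : VectorBundle ℝ (EuclideanSpace ℝ (Fin m)) 𝒢.A := 𝒢.prebundle.toVectorBundle

instance : 𝒢.prebundle.IsContMDiff 𝓘(ℝ, EuclideanSpace ℝ (Fin n)) ∞ where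
  exists_contMDiffCoordChange := by
    rintro _ ⟨d, rfl⟩ _ ⟨d', rfl⟩
    exact TrivData.exists_coordChange d d' 𝒢

instance : ContMDiffVectorBundle ∞ (EuclideanSpace ℝ (Fin m)) 𝒢.A
    𝓘(ℝ, EuclideanSpace ℝ (Fin n)) :=
  𝒢.prebundle.contMDiffVectorBundle 𝓘(ℝ, EuclideanSpace ℝ (Fin n))

end bundleInstances

/-- The space `Γ(τ)` of smooth sections of `AG → M`. -/
abbrev Sections (𝒢 : LieGroupoid n m M G) :=
  Cₛ^∞⟮𝓘(ℝ, EuclideanSpace ℝ (Fin n)); EuclideanSpace ℝ (Fin m), 𝒢.A⟯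

/-- The total space of the dual bundle `A*G → M`. It carries Mathlib's smooth structure of the
bundle of continuous linear maps `AG → ℝ`. -/
abbrev DualTotal (𝒢 : LieGroupoid n m M G) :=
  TotalSpace (EuclideanSpace ℝ (Fin m) →L[ℝ] ℝ)
    (fun x : M => 𝒢.A x →L[ℝ] Bundle.Trivial M ℝ x)

/-! ### Translations, invariant vector fields, discrete Euler-Lagrange equations -/

/-- The tangent map at `k` of the left translation `l_g : α⁻¹(β g) → α⁻¹(α g)`, `l_g k = gk`.
It is meant for vectors tangent to the fibre `α⁻¹(β g)` at a point `k` of this fibre; on those,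
the derivative within the fibre is uniquely determined. -/
def TLeft (𝒢 : LieGroupoid n m M G) (g k : G) :
    TangentSpace 𝓘(ℝ, CoordSpace n m) k →L[ℝ] TangentSpace 𝓘(ℝ, CoordSpace n m) (𝒢.mul g k) :=
  mfderivWithin 𝓘(ℝ, CoordSpace n m) 𝓘(ℝ, CoordSpace n m) (fun h => 𝒢.mul g h)
    (𝒢.α ⁻¹' {𝒢.β g}) k

/-- The tangent map at `k` of the right translation `r_g : β⁻¹(α g) → β⁻¹(β g)`, `r_g k = kg`,
meant for vectors tangent to the fibre `β⁻¹(α g)` at a point `k` of this fibre. -/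
def TRight (𝒢 : LieGroupoid n m M G) (g k : G) :
    TangentSpace 𝓘(ℝ, CoordSpace n m) k →L[ℝ] TangentSpace 𝓘(ℝ, CoordSpace n m) (𝒢.mul k g) :=
  mfderivWithin 𝓘(ℝ, CoordSpace n m) 𝓘(ℝ, CoordSpace n m) (fun h => 𝒢.mul h g)
    (𝒢.β ⁻¹' {𝒢.α g}) k

/-- The left-invariant vector field of `X ∈ Γ(τ)`: `g ↦ (T_{ε(β g)} l_g)(X(β g))`. -/
def leftField (𝒢 : LieGroupoid n m M G) (X : 𝒢.Sections) (g : G) :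
    TangentSpace 𝓘(ℝ, CoordSpace n m) g :=
  (𝒢.TLeft g (𝒢.ε (𝒢.β g)) (𝒢.incl (𝒢.β g) (X (𝒢.β g))) : CoordSpace n m)

/-- The right-invariant vector field of `X ∈ Γ(τ)`:
`g ↦ -(T_{ε(α g)} r_g)((T_{ε(α g)} i)(X(α g)))`. -/
def rightField (𝒢 : LieGroupoid n m M G) (X : 𝒢.Sections) (g : G) :
    TangentSpace 𝓘(ℝ, CoordSpace n m) g :=
  (-𝒢.TRight g (𝒢.ε (𝒢.α g))
    (mfderiv 𝓘(ℝ, CoordSpace n m) 𝓘(ℝ, CoordSpace n m) 𝒢.inv (𝒢.ε (𝒢.α g))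
      (𝒢.incl (𝒢.α g) (X (𝒢.α g))) : CoordSpace n m) : CoordSpace n m)

/-- The derivative `v(f)` of a function `f` on `G` along a tangent vector `v ∈ T_g G`. -/
def dirDeriv (f : G → ℝ) (g : G) (v : TangentSpace 𝓘(ℝ, CoordSpace n m) g) : ℝ :=
  mfderiv 𝓘(ℝ, CoordSpace n m) 𝓘(ℝ, ℝ) f g v

/-- `(g, h) ∈ G₂` is a solution of the discrete Euler-Lagrange equations for `L`. -/
def IsSolution (𝒢 : LieGroupoid n m M G) (L : G → ℝ) (g h : G) : Prop :=
  𝒢.β g = 𝒢.α h ∧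
    ∀ X : 𝒢.Sections, dirDeriv L g (𝒢.leftField X g) - dirDeriv L h (𝒢.rightField X h) = 0

/-- `Ψ : X₀ → Y₀` is a local discrete Euler-Lagrange evolution operator for `L`: a smooth map whose
graph consists of solutions (in particular, of composable pairs). -/
def IsLocalEvolutionOperator (𝒢 : LieGroupoid n m M G) (L : G → ℝ) (X₀ Y₀ : Set G)
    (Ψ : G → G) : Prop :=
  MapsTo Ψ X₀ Y₀ ∧
    ContMDiffOn 𝓘(ℝ, CoordSpace n m) 𝓘(ℝ, CoordSpace n m) ∞ Ψ X₀ ∧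
    ∀ g ∈ X₀, 𝒢.IsSolution L g (Ψ g)

/-! ### The Legendre transformation `𝔽⁻L : G → A*G` -/

/-- `(𝔽⁻L)(h)(v) = -v(L ∘ r_h ∘ i)` for `v ∈ A_{α(h)} G`, where `L ∘ r_h ∘ i` is the function
`k ↦ L(k⁻¹h)` on the fibre `α⁻¹(α h)`. -/
def legendreFibre (𝒢 : LieGroupoid n m M G) (L : G → ℝ) (h : G) : 𝒢.A (𝒢.α h) →L[ℝ] ℝ :=
  -((mfderivWithin 𝓘(ℝ, CoordSpace n m) 𝓘(ℝ, ℝ) (fun k => L (𝒢.mul (𝒢.inv k) h))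
    (𝒢.α ⁻¹' {𝒢.α h}) (𝒢.ε (𝒢.α h)) :
      TangentSpace 𝓘(ℝ, CoordSpace n m) (𝒢.ε (𝒢.α h)) →L[ℝ] ℝ).comp (𝒢.incl (𝒢.α h)))

/-- The discrete Legendre transformation `𝔽⁻L : G → A*G`. -/
def legendreMinus (𝒢 : LieGroupoid n m M G) (L : G → ℝ) (h : G) : 𝒢.DualTotal :=
  ⟨𝒢.α h, 𝒢.legendreFibre L h⟩

/-- `𝔽⁻L` is a local diffeomorphism at `h`. -/
def LegendreIsLocalDiffeoAt (𝒢 : LieGroupoid n m M G) (L : G → ℝ) (h : G) : Prop :=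
  IsLocalDiffeomorphAt 𝓘(ℝ, CoordSpace n m)
    (𝓘(ℝ, EuclideanSpace ℝ (Fin n)).prod 𝓘(ℝ, EuclideanSpace ℝ (Fin m) →L[ℝ] ℝ)) ∞
    (𝒢.legendreMinus L) h

/-! ### The Lie algebroid `P^τ G = Vβ ⊕ Vα → G` and the Poincaré-Cartan 2-section -/

/-- A smooth section `(X, Y)` of `P^τ G = Vβ ⊕ Vα → G`: a smooth vector field `X` on `G` tangent to
the fibres of `β` and a smooth vector field `Y` tangent to the fibres of `α`. -/
structure PSection (𝒢 : LieGroupoid n m M G) where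
  X : ∀ g : G, TangentSpace 𝓘(ℝ, CoordSpace n m) g
  Y : ∀ g : G, TangentSpace 𝓘(ℝ, CoordSpace n m) g
  contMDiff_X : ContMDiff 𝓘(ℝ, CoordSpace n m) 𝓘(ℝ, CoordSpace n m).tangent ∞
    (fun g => (⟨g, X g⟩ : TangentBundle 𝓘(ℝ, CoordSpace n m) G))
  contMDiff_Y : ContMDiff 𝓘(ℝ, CoordSpace n m) 𝓘(ℝ, CoordSpace n m).tangent ∞
    (fun g => (⟨g, Y g⟩ : TangentBundle 𝓘(ℝ, CoordSpace n m) G))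
  X_vertical : ∀ g, mfderiv 𝓘(ℝ, CoordSpace n m) 𝓘(ℝ, EuclideanSpace ℝ (Fin n)) 𝒢.β g (X g) = 0
  Y_vertical : ∀ g, mfderiv 𝓘(ℝ, CoordSpace n m) 𝓘(ℝ, EuclideanSpace ℝ (Fin n)) 𝒢.α g (Y g) = 0

/-- The left translate `(T l_{g⁻¹})(Y g) ∈ A_{β(g)} G ⊆ T_{ε(β g)} G` of an `α`-vertical `Y`. -/
def leftTriv (𝒢 : LieGroupoid n m M G) (Y : ∀ g : G, TangentSpace 𝓘(ℝ, CoordSpace n m) g)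
    (g : G) : CoordSpace n m :=
  𝒢.TLeft (𝒢.inv g) g (Y g)

/-- The right translate `(T r_{g⁻¹})(X g) ∈ ker T_{ε(α g)} β ⊆ T_{ε(α g)} G` of a `β`-vertical
`X`. -/
def rightTriv (𝒢 : LieGroupoid n m M G) (X : ∀ g : G, TangentSpace 𝓘(ℝ, CoordSpace n m) g)
    (g : G) : CoordSpace n m :=
  𝒢.TRight (𝒢.inv g) g (X g)

/-- The derivative, at `g` in the direction `X g ∈ V_gβ`, of an `α`-vertical vector field `Y`.
On the fibre `β⁻¹(β g)`, the left translate of `Y` takes values in the fixed vector space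
`A_{β(g)} G`; it is differentiated there and the result is carried back to `V_gα`.
Left-invariant vector fields have zero derivative. -/
def nablaLeft (𝒢 : LieGroupoid n m M G) (X Y : ∀ g : G, TangentSpace 𝓘(ℝ, CoordSpace n m) g)
    (g : G) : TangentSpace 𝓘(ℝ, CoordSpace n m) g :=
  (𝒢.TLeft g (𝒢.ε (𝒢.β g))
    (mfderivWithin 𝓘(ℝ, CoordSpace n m) 𝓘(ℝ, CoordSpace n m) (𝒢.leftTriv Y) (𝒢.β ⁻¹' {𝒢.β g}) g
      (X g) : CoordSpace n m) : CoordSpace n m)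

/-- The derivative, at `g` in the direction `Y g ∈ V_gα`, of a `β`-vertical vector field `X`,
by means of right translations. Right-invariant vector fields have zero derivative. -/
def nablaRight (𝒢 : LieGroupoid n m M G) (Y X : ∀ g : G, TangentSpace 𝓘(ℝ, CoordSpace n m) g)
    (g : G) : TangentSpace 𝓘(ℝ, CoordSpace n m) g :=
  (𝒢.TRight g (𝒢.ε (𝒢.α g))
    (mfderivWithin 𝓘(ℝ, CoordSpace n m) 𝓘(ℝ, CoordSpace n m) (𝒢.rightTriv X) (𝒢.α ⁻¹' {𝒢.α g}) g
      (Y g) : CoordSpace n m) : CoordSpace n m)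

/-- The Lie bracket of `Γ(P^τ G)`. It satisfies the Leibniz rule for the anchor
`(X, Y) ↦ X + Y`, and on pairs of a right-invariant and a left-invariant vector field it is the
componentwise bracket of vector fields; this characterizes it. -/
def pBracket {𝒢 : LieGroupoid n m M G} (ξ η : 𝒢.PSection) (g : G) :
    TangentSpace 𝓘(ℝ, CoordSpace n m) g × TangentSpace 𝓘(ℝ, CoordSpace n m) g :=
  (VectorField.mlieBracket 𝓘(ℝ, CoordSpace n m) ξ.X η.X g
      + 𝒢.nablaRight ξ.Y η.X g - 𝒢.nablaRight η.Y ξ.X g,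
    VectorField.mlieBracket 𝓘(ℝ, CoordSpace n m) ξ.Y η.Y g
      + 𝒢.nablaLeft ξ.X η.Y g - 𝒢.nablaLeft η.X ξ.Y g)

/-- The Poincaré-Cartan 1-section `Θ⁻_L(g)(X_g, Y_g) = -X_g(L)`. -/
def thetaMinus (L : G → ℝ) (g : G)
    (v : TangentSpace 𝓘(ℝ, CoordSpace n m) g × TangentSpace 𝓘(ℝ, CoordSpace n m) g) : ℝ :=
  -dirDeriv L g v.1

/-- The differential `dΘ(ξ, η) = ρ(ξ)(Θ(η)) - ρ(η)(Θ(ξ)) - Θ(⟦ξ, η⟧)` of a 1-section `Θ` of the dual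
of `P^τ G`, where `ρ(X, Y) = X + Y` is the anchor. -/
def pDiff {𝒢 : LieGroupoid n m M G}
    (Θ : ∀ g : G, TangentSpace 𝓘(ℝ, CoordSpace n m) g × TangentSpace 𝓘(ℝ, CoordSpace n m) g → ℝ)
    (ξ η : 𝒢.PSection) (g : G) : ℝ :=
  dirDeriv (fun g' => Θ g' (η.X g', η.Y g')) g (ξ.X g + ξ.Y g)
    - dirDeriv (fun g' => Θ g' (ξ.X g', ξ.Y g')) g (η.X g + η.Y g)
    - Θ g (pBracket ξ η g)

/-- The Poincaré-Cartan 2-section `Ω_L = -dΘ⁻_L` (which is also `-dΘ⁺_L`, as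
`Θ⁺_L - Θ⁻_L = dL`). -/
def poincareCartan {𝒢 : LieGroupoid n m M G} (L : G → ℝ) (ξ η : 𝒢.PSection) (g : G) : ℝ :=
  -pDiff (thetaMinus L) ξ η g

/-- `Ω_L` is nondegenerate at `h`: a section that is `Ω_L(h)`-orthogonal to all
sections vanishes at `h`. -/
def PoincareCartanNondegenerateAt (𝒢 : LieGroupoid n m M G) (L : G → ℝ) (h : G) : Prop :=
  ∀ ξ : 𝒢.PSection, (∀ η : 𝒢.PSection, poincareCartan L ξ η h = 0) → ξ.X h = 0 ∧ ξ.Y h = 0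

/-! ### Symmetric neighborhoods and local coordinates -/

/-- `W` is a symmetric neighborhood associated to the open set `U ⊆ G` and the point `x₀ ∈ M`. -/
structure IsSymmetricNhd (𝒢 : LieGroupoid n m M G) (U : Set G) (x₀ : M) (W : Set G) : Prop where
  isOpen : IsOpen W
  subset : W ⊆ U
  mem : 𝒢.ε x₀ ∈ W
  ε_α : 𝒢.ε '' (𝒢.α '' W) ⊆ W
  ε_β : 𝒢.ε '' (𝒢.β '' W) ⊆ W
  inv_eq : 𝒢.inv '' W = W
  mul_mem : ∀ g ∈ W, ∀ h ∈ W, 𝒢.β g = 𝒢.α h → 𝒢.mul g h ∈ U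

/-- Local coordinates `(x, u)` on an open set `φ.source ⊆ G`, adapted to `α` (if `g` has coordinates
`(x, u)`, then `α(g)` has coordinates `x` in the chart `ψ` of `M`), in which the identities have
coordinates `(x, 0)`. -/
structure AdaptedCoords (𝒢 : LieGroupoid n m M G) where
  φ : OpenPartialHomeomorph G (CoordSpace n m)
  ψ : OpenPartialHomeomorph M (EuclideanSpace ℝ (Fin n))
  φ_mem : φ ∈ IsManifold.maximalAtlas 𝓘(ℝ, CoordSpace n m) ∞ G
  ψ_mem : ψ ∈ IsManifold.maximalAtlas 𝓘(ℝ, EuclideanSpace ℝ (Fin n)) ∞ M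
  α_mem : ∀ g ∈ φ.source, 𝒢.α g ∈ ψ.source
  fst_eq : ∀ g ∈ φ.source, (φ g).1 = ψ (𝒢.α g)
  snd_ε : ∀ x, 𝒢.ε x ∈ φ.source → (φ (𝒢.ε x)).2 = 0

/-- `∂f/∂xⁱ`. -/
def pdx (i : Fin n) (f : CoordSpace n m → ℝ) (q : CoordSpace n m) : ℝ :=
  fderiv ℝ f q (EuclideanSpace.single i 1, 0)

/-- `∂f/∂u^γ`. -/
def pdu (γ : Fin m) (f : CoordSpace n m → ℝ) (q : CoordSpace n m) : ℝ :=
  fderiv ℝ f q (0, EuclideanSpace.single γ 1)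

namespace AdaptedCoords

variable {𝒢 : LieGroupoid n m M G} (c : 𝒢.AdaptedCoords)

/-- `b(x, u)`: the coordinates of `β(g)`, if `g` has coordinates `(x, u)`. -/
def b (q : CoordSpace n m) : EuclideanSpace ℝ (Fin n) := c.ψ (𝒢.β (c.φ.symm q))

/-- `p(x, u, v)`: the product of the elements with coordinates `(x, u)` and `(b(x, u), v)` has
coordinates `(x, p(x, u, v))`. -/
def p (x : EuclideanSpace ℝ (Fin n)) (u v : EuclideanSpace ℝ (Fin m)) : EuclideanSpace ℝ (Fin m) :=
  (c.φ (𝒢.mul (c.φ.symm (x, u)) (c.φ.symm (c.b (x, u), v)))).2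

/-- `ρⁱ_γ(x) = ∂bⁱ/∂u^γ (x, 0)`. -/
def ρ (i : Fin n) (γ : Fin m) (x : EuclideanSpace ℝ (Fin n)) : ℝ :=
  pdu γ (fun q => c.b q i) (x, 0)

/-- `R^γ_μ(x, v) = ∂p^γ/∂u^μ (x, 0, v)`, as a function of the pair `(x, v)`. -/
def R (γ μ : Fin m) (q : CoordSpace n m) : ℝ :=
  pdu μ (fun r : CoordSpace n m => c.p r.1 r.2 q.2 γ) (q.1, 0)

/-- `L` written in the coordinates. -/
def lag (L : G → ℝ) (q : CoordSpace n m) : ℝ := L (c.φ.symm q)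

/-- The matrix `(𝔽L)^γ_μ = ρⁱ_μ ∂²L/∂xⁱ∂u^γ - (∂R^ν_μ/∂u^γ) ∂L/∂u^ν - R^ν_μ ∂²L/∂u^ν∂u^γ`. -/
def FL (L : G → ℝ) (q : CoordSpace n m) : Matrix (Fin m) (Fin m) ℝ :=
  Matrix.of fun γ μ =>
    (∑ i, c.ρ i μ q.1 * pdx i (pdu γ (c.lag L)) q)
      - (∑ ν, pdu γ (c.R ν μ) q * pdu ν (c.lag L) q)
      - ∑ ν, c.R ν μ q * pdu ν (pdu γ (c.lag L)) q

end AdaptedCoords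

end LieGroupoid

end

/-! Everything reduces to one map in the adapted coordinates. For `k` with coordinates `q = (x, u)`,
differentiate `w ↦ z⁻¹k` at `w = 0`, where `z` has coordinates `(x, w)`. This gives a linear map
`dInvMul q : ℝᵐ → ℝⁿ × ℝᵐ`, which up to sign is the right-invariant frame. Differentiating `z(z⁻¹k)
= k` shows that its components are `ρ` and `-R` (`dInvMul_fst`, `dInvMul_snd`). Hence the fibre part
`legMinus = -dL ∘ dInvMul` of `𝔽⁻L` has components `R ∂L/∂u - ρ ∂L/∂x`. Since `ρ` depends on `x`
alone, the derivative of `legMinus` in the `u`-directions is `-𝔽L` (`fderiv_legMinus_single`).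

Legendre transformation: in the charts of `G` and `A*G` it is `(x, u) ↦ (x, legMinus(x, u))`. Its
derivative is block triangular with an identity block, so it is invertible exactly when `𝔽L` is
regular; the inverse function theorem does the rest (`isUnit_FL_iff_legendreIsLocalDiffeoAt`).

Poincaré-Cartan section: near `q`, write the `β`-vertical part of a section as `dInvMul r (a r)`,
and its `α`-vertical part at `q` as `(0, w)`. In `-dΘ⁻` the derivatives along the `β`-vertical parts
cancel against the commutator, and the derivatives of `a` cancel against the correction terms of the
bracket. What remains is `Ω(ξ, η) = (D_{w'} legMinus)(a) - (D_w legMinus)(a')`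
(`poincareCartan_eq`). This form has only off-diagonal blocks, given by `𝔽L`, so it is nondegenerate
if and only if `𝔽L` is regular.

Evolution operator: with `legPlus = dL ∘ dLeftMul` for left translations, `(g, h)` is a solution if
and only if `(b, legPlus)` at `g` equals `(x, legMinus)` at `h` (`isSolution_iff`). A local inverse
of the right-hand map solves this for `h`, smoothly in `g`. -/

noncomputable section

/-- The chain rule for a map differentiable within a set `s`, along a map with values in `s`. -/
theorem MDifferentiableWithinAt.hasMFDerivAt_comp_of_eventually_mem
    {𝕜 : Type*} [NontriviallyNormedField 𝕜]
    {E : Type*} [NormedAddCommGroup E] [NormedSpace 𝕜 E] {H : Type*} [TopologicalSpace H]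
    {I : ModelWithCorners 𝕜 E H} {M : Type*} [TopologicalSpace M] [ChartedSpace H M]
    {E' : Type*} [NormedAddCommGroup E'] [NormedSpace 𝕜 E'] {H' : Type*} [TopologicalSpace H']
    {I' : ModelWithCorners 𝕜 E' H'} {M' : Type*} [TopologicalSpace M'] [ChartedSpace H' M']
    {E'' : Type*} [NormedAddCommGroup E''] [NormedSpace 𝕜 E''] {H'' : Type*}
    [TopologicalSpace H''] {I'' : ModelWithCorners 𝕜 E'' H''} {M'' : Type*}
    [TopologicalSpace M''] [ChartedSpace H'' M'']
    {f : M' → M''} {σ : M → M'} {s : Set M'} {x : M}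
    {σ' : TangentSpace I x →L[𝕜] TangentSpace I' (σ x)}
    (hf : MDifferentiableWithinAt I' I'' f s (σ x)) (hσ : HasMFDerivAt I I' σ x σ')
    (hs : ∀ᶠ y in 𝓝 x, σ y ∈ s) :
    HasMFDerivAt I I'' (f ∘ σ) x ((mfderivWithin I' I'' f s (σ x)).comp σ') :=
  (hf.hasMFDerivWithinAt.comp x (hσ.hasMFDerivWithinAt (s := σ ⁻¹' s)) subset_rfl).hasMFDerivAt hs

/-! ### Groupoid identities and the multiplication in adapted coordinates. -/

namespace LieGroupoid

variable {n m : ℕ} {M G : Type*}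
  [TopologicalSpace M] [ChartedSpace (EuclideanSpace ℝ (Fin n)) M]
  [TopologicalSpace G] [ChartedSpace (CoordSpace n m) G]

local notation "𝔼" => CoordSpace n m
local notation "𝕏" => EuclideanSpace ℝ (Fin n)
local notation "𝕍" => EuclideanSpace ℝ (Fin m)

lemma contMDiffOn_mul_comp (𝒢 : LieGroupoid n m M G)
    {F : Type*} [NormedAddCommGroup F] [NormedSpace ℝ F] {H : Type*} [TopologicalSpace H]
    {J : ModelWithCorners ℝ F H} {N : Type*} [TopologicalSpace N] [ChartedSpace H N]
    {f g : N → G} {s : Set N}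
    (hf : ContMDiffOn J 𝓘(ℝ, 𝔼) ∞ f s) (hg : ContMDiffOn J 𝓘(ℝ, 𝔼) ∞ g s)
    (h : ∀ x ∈ s, 𝒢.β (f x) = 𝒢.α (g x)) :
    ContMDiffOn J 𝓘(ℝ, 𝔼) ∞ (fun x => 𝒢.mul (f x) (g x)) s :=
  𝒢.contMDiffOn_mul.comp (hf.prodMk hg) h

lemma mul_inv_mul_cancel (𝒢 : LieGroupoid n m M G) {z k : G} (h : 𝒢.α z = 𝒢.α k) :
    𝒢.mul z (𝒢.mul (𝒢.inv z) k) = k := by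
  rw [𝒢.mul_assoc z (𝒢.inv z) k (𝒢.α_inv z).symm ((𝒢.β_inv z).trans h), 𝒢.mul_inv, h, 𝒢.ε_mul]

lemma inv_mul_mul_cancel (𝒢 : LieGroupoid n m M G) {z k : G} (h : 𝒢.β z = 𝒢.α k) :
    𝒢.mul (𝒢.inv z) (𝒢.mul z k) = k := by
  rw [𝒢.mul_assoc (𝒢.inv z) z k (𝒢.β_inv z) h, 𝒢.inv_mul, h, 𝒢.ε_mul]

lemma mul_mul_inv_cancel (𝒢 : LieGroupoid n m M G) {z k : G} (h : 𝒢.β z = 𝒢.α k) :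
    𝒢.mul (𝒢.mul z k) (𝒢.inv k) = z := by
  rw [← 𝒢.mul_assoc z k (𝒢.inv k) h (𝒢.α_inv k).symm, 𝒢.mul_inv, ← h, 𝒢.mul_ε]

lemma inv_eq_of_mul_eq (𝒢 : LieGroupoid n m M G) {z k : G} (h : 𝒢.β z = 𝒢.α k)
    (hzk : 𝒢.mul z k = 𝒢.ε (𝒢.α z)) : 𝒢.inv z = k := by
  have h1 := 𝒢.inv_mul_mul_cancel h
  rw [hzk, ← 𝒢.β_inv z, 𝒢.mul_ε] at h1
  exact h1

lemma inv_inv (𝒢 : LieGroupoid n m M G) (z : G) : 𝒢.inv (𝒢.inv z) = z :=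
  𝒢.inv_eq_of_mul_eq (𝒢.β_inv z) (by rw [𝒢.inv_mul, 𝒢.α_inv])

lemma inv_ε (𝒢 : LieGroupoid n m M G) (x : M) : 𝒢.inv (𝒢.ε x) = 𝒢.ε x := by
  refine 𝒢.inv_eq_of_mul_eq (by rw [𝒢.α_ε, 𝒢.β_ε]) ?_
  have h := 𝒢.ε_mul (𝒢.ε x)
  rw [𝒢.α_ε] at h ⊢
  exact h

lemma inv_mul_rev (𝒢 : LieGroupoid n m M G) {z k : G} (h : 𝒢.β z = 𝒢.α k) :
    𝒢.inv (𝒢.mul z k) = 𝒢.mul (𝒢.inv k) (𝒢.inv z) := by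
  have h1 : 𝒢.β (𝒢.inv k) = 𝒢.α (𝒢.inv z) := by rw [𝒢.β_inv, 𝒢.α_inv, h]
  refine 𝒢.inv_eq_of_mul_eq (by rw [𝒢.β_mul _ _ h, 𝒢.α_mul _ _ h1, 𝒢.α_inv]) ?_
  rw [𝒢.mul_assoc _ _ _ (by rw [𝒢.β_mul _ _ h, 𝒢.α_inv]) h1, 𝒢.mul_mul_inv_cancel h, 𝒢.mul_inv,
    𝒢.α_mul _ _ h]

namespace IsSymmetricNhd

variable {𝒢 : LieGroupoid n m M G} {U W : Set G} {x₀ : M} (hW : 𝒢.IsSymmetricNhd U x₀ W)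
include hW

lemma ε_α_mem {k : G} (hk : k ∈ W) : 𝒢.ε (𝒢.α k) ∈ W :=
  hW.ε_α (mem_image_of_mem _ (mem_image_of_mem _ hk))

lemma ε_β_mem {k : G} (hk : k ∈ W) : 𝒢.ε (𝒢.β k) ∈ W :=
  hW.ε_β (mem_image_of_mem _ (mem_image_of_mem _ hk))

lemma inv_mem {k : G} (hk : k ∈ W) : 𝒢.inv k ∈ W :=
  hW.inv_eq ▸ mem_image_of_mem _ hk

end IsSymmetricNhd

namespace AdaptedCoords

variable {𝒢 : LieGroupoid n m M G} (c : 𝒢.AdaptedCoords) {x₀ : M} {W : Set G}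

/-- The coordinates of the points of `W`. -/
def dom (W : Set G) : Set 𝔼 := c.φ.target ∩ c.φ.symm ⁻¹' W

/-- The left translation by the element with coordinates `q`, in coordinates. -/
def leftMul (q : 𝔼) (v : 𝕍) : 𝔼 := c.φ (𝒢.mul (c.φ.symm q) (c.φ.symm (c.b q, v)))

/-- The coordinates of `z⁻¹ k`, where `k` has coordinates `q` and `z` has coordinates
`(q.1, w)`. -/
def invMul (q : 𝔼) (w : 𝕍) : 𝔼 :=
  c.φ (𝒢.mul (𝒢.inv (c.φ.symm (q.1, w))) (c.φ.symm q))

lemma contMDiffOn_φ : ContMDiffOn 𝓘(ℝ, 𝔼) 𝓘(ℝ, 𝔼) ∞ c.φ c.φ.source :=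
  contMDiffOn_of_mem_maximalAtlas c.φ_mem

lemma contMDiffOn_φ_symm : ContMDiffOn 𝓘(ℝ, 𝔼) 𝓘(ℝ, 𝔼) ∞ c.φ.symm c.φ.target :=
  contMDiffOn_symm_of_mem_maximalAtlas c.φ_mem

lemma α_symm {q : 𝔼} (hq : q ∈ c.φ.target) : 𝒢.α (c.φ.symm q) = c.ψ.symm q.1 := by
  have h := c.fst_eq _ (c.φ.map_target hq)
  rw [c.φ.right_inv hq] at h
  rw [h, c.ψ.left_inv (c.α_mem _ (c.φ.map_target hq))]

lemma φ_ε {x : M} (hx : 𝒢.ε x ∈ c.φ.source) : c.φ (𝒢.ε x) = (c.ψ x, 0) :=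
  Prod.ext (by rw [c.fst_eq _ hx, 𝒢.α_ε]) (c.snd_ε x hx)

lemma symm_ε {x : M} (hx : 𝒢.ε x ∈ c.φ.source) : c.φ.symm (c.ψ x, 0) = 𝒢.ε x := by
  rw [← c.φ_ε hx, c.φ.left_inv hx]

lemma mem_source_of_ε {x : M} (hx : 𝒢.ε x ∈ c.φ.source) : x ∈ c.ψ.source := by
  have := c.α_mem _ hx
  rwa [𝒢.α_ε] at this

section

variable {c} (hW : 𝒢.IsSymmetricNhd c.φ.source x₀ W)
include hW

lemma isOpen_dom : IsOpen (c.dom W) := c.φ.symm.isOpen_inter_preimage hW.isOpen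

lemma φ_mem_dom {k : G} (hk : k ∈ W) : c.φ k ∈ c.dom W := by
  refine ⟨c.φ.map_source (hW.subset hk), ?_⟩
  rw [mem_preimage, c.φ.left_inv (hW.subset hk)]
  exact hk

lemma β_mem {k : G} (hk : k ∈ W) : 𝒢.β k ∈ c.ψ.source :=
  c.mem_source_of_ε (hW.subset (hW.ε_β_mem hk))

/-- A symmetric neighborhood contains `ε(α(k))` along with `k`, and this unit has coordinates `(x,
0)`. It is the base point at which `z ↦ z⁻¹k` is differentiated. -/
lemma zero_mem_dom {q : 𝔼} (hq : q ∈ c.dom W) : (q.1, (0 : 𝕍)) ∈ c.dom W := by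
  have h := φ_mem_dom hW (hW.ε_α_mem hq.2)
  rw [c.φ_ε (hW.subset (hW.ε_α_mem hq.2)), c.α_symm hq.1, c.ψ.right_inv] at h
  · exact h
  · have h1 := c.fst_eq _ (c.φ.map_target hq.1)
    rw [c.φ.right_inv hq.1] at h1
    rw [h1]
    exact c.ψ.map_source (c.α_mem _ (c.φ.map_target hq.1))

lemma symm_zero {q : 𝔼} (hq : q ∈ c.dom W) :
    c.φ.symm (q.1, (0 : 𝕍)) = 𝒢.ε (𝒢.α (c.φ.symm q)) := by
  have h : 𝒢.ε (𝒢.α (c.φ.symm q)) ∈ c.φ.source := hW.subset (hW.ε_α_mem hq.2)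
  have h1 := c.fst_eq _ (c.φ.map_target hq.1)
  rw [c.φ.right_inv hq.1] at h1
  rw [← c.symm_ε h, ← h1]

/-- The same for the unit `ε(β(k))`, the base point for left translation by `k`. -/
lemma b_zero_mem_dom {q : 𝔼} (hq : q ∈ c.dom W) : (c.b q, (0 : 𝕍)) ∈ c.dom W := by
  have h := φ_mem_dom hW (hW.ε_β_mem hq.2)
  rw [c.φ_ε (hW.subset (hW.ε_β_mem hq.2))] at h
  exact h

lemma symm_b_zero {q : 𝔼} (hq : q ∈ c.dom W) :
    c.φ.symm (c.b q, (0 : 𝕍)) = 𝒢.ε (𝒢.β (c.φ.symm q)) :=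
  c.symm_ε (hW.subset (hW.ε_β_mem hq.2))

lemma b_zero {q : 𝔼} (hq : q ∈ c.dom W) : c.b (q.1, (0 : 𝕍)) = q.1 := by
  unfold b
  rw [symm_zero hW hq, 𝒢.β_ε, ← c.fst_eq _ (c.φ.map_target hq.1), c.φ.right_inv hq.1]

lemma symm_b {q : 𝔼} (hq : q ∈ c.dom W) : c.ψ.symm (c.b q) = 𝒢.β (c.φ.symm q) :=
  c.ψ.left_inv (β_mem hW hq.2)

lemma composable {q : 𝔼} (hq : q ∈ c.dom W) {v : 𝕍} (hv : (c.b q, v) ∈ c.φ.target) :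
    𝒢.β (c.φ.symm q) = 𝒢.α (c.φ.symm (c.b q, v)) := by
  rw [c.α_symm hv, symm_b hW hq]

omit hW in
lemma composable_inv {q : 𝔼} (hq : q ∈ c.φ.target) {w : 𝕍} (hw : (q.1, w) ∈ c.φ.target) :
    𝒢.β (𝒢.inv (c.φ.symm (q.1, w))) = 𝒢.α (c.φ.symm q) := by
  rw [𝒢.β_inv, c.α_symm hw, c.α_symm hq]

lemma leftMul_mem {q : 𝔼} (hq : q ∈ c.dom W) {v : 𝕍} (hv : (c.b q, v) ∈ c.dom W) :
    𝒢.mul (c.φ.symm q) (c.φ.symm (c.b q, v)) ∈ c.φ.source :=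
  hW.mul_mem _ hq.2 _ hv.2 (composable hW hq hv.1)

lemma invMul_mem {q : 𝔼} (hq : q ∈ c.dom W) {w : 𝕍} (hw : (q.1, w) ∈ c.dom W) :
    𝒢.mul (𝒢.inv (c.φ.symm (q.1, w))) (c.φ.symm q) ∈ c.φ.source :=
  hW.mul_mem _ (hW.inv_mem hw.2) _ hq.2 (composable_inv hq.1 hw.1)

lemma contDiffOn_b : ContDiffOn ℝ ∞ c.b (c.dom W) := by
  rw [← contMDiffOn_iff_contDiffOn]
  exact (contMDiffOn_of_mem_maximalAtlas c.ψ_mem).comp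
    (𝒢.contMDiff_β.comp_contMDiffOn (c.contMDiffOn_φ_symm.mono inter_subset_left))
    (fun q hq => β_mem hW hq.2)

lemma isOpen_leftMul_dom : IsOpen {r : 𝔼 × 𝕍 | r.1 ∈ c.dom W ∧ (c.b r.1, r.2) ∈ c.dom W} := by
  have h : ContinuousOn (fun r : 𝔼 × 𝕍 => (c.b r.1, r.2)) (Prod.fst ⁻¹' c.dom W) :=
    ((contDiffOn_b hW).continuousOn.comp continuousOn_fst (fun _ h => h)).prodMk continuousOn_snd
  exact h.isOpen_inter_preimage ((isOpen_dom hW).preimage continuous_fst) (isOpen_dom hW)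

lemma isOpen_invMul_dom : IsOpen {r : 𝔼 × 𝕍 | r.1 ∈ c.dom W ∧ (r.1.1, r.2) ∈ c.dom W} :=
  ((isOpen_dom hW).preimage continuous_fst).inter
    ((isOpen_dom hW).preimage (by fun_prop : Continuous fun r : 𝔼 × 𝕍 => (r.1.1, r.2)))

lemma contDiffOn_leftMul : ContDiffOn ℝ ∞ (fun r : 𝔼 × 𝕍 => c.leftMul r.1 r.2)
    {r | r.1 ∈ c.dom W ∧ (c.b r.1, r.2) ∈ c.dom W} := by
  rw [← contMDiffOn_iff_contDiffOn]
  have h1 : ContMDiffOn 𝓘(ℝ, 𝔼 × 𝕍) 𝓘(ℝ, 𝔼) ∞ (fun r : 𝔼 × 𝕍 => c.φ.symm r.1)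
      {r | r.1 ∈ c.dom W ∧ (c.b r.1, r.2) ∈ c.dom W} :=
    c.contMDiffOn_φ_symm.comp contDiff_fst.contMDiff.contMDiffOn (fun r hr => hr.1.1)
  have h2 : ContMDiffOn 𝓘(ℝ, 𝔼 × 𝕍) 𝓘(ℝ, 𝔼) ∞ (fun r : 𝔼 × 𝕍 => c.φ.symm (c.b r.1, r.2))
      {r | r.1 ∈ c.dom W ∧ (c.b r.1, r.2) ∈ c.dom W} :=
    c.contMDiffOn_φ_symm.comp (contMDiffOn_iff_contDiffOn.2
      (((contDiffOn_b hW).comp contDiffOn_fst (fun r hr => hr.1)).prodMk contDiffOn_snd))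
      (fun r hr => hr.2.1)
  exact c.contMDiffOn_φ.comp (𝒢.contMDiffOn_mul_comp h1 h2
    (fun r hr => composable hW hr.1 hr.2.1)) (fun r hr => leftMul_mem hW hr.1 hr.2)

lemma contDiffOn_invMul : ContDiffOn ℝ ∞ (fun r : 𝔼 × 𝕍 => c.invMul r.1 r.2)
    {r | r.1 ∈ c.dom W ∧ (r.1.1, r.2) ∈ c.dom W} := by
  rw [← contMDiffOn_iff_contDiffOn]
  have h1 : ContMDiffOn 𝓘(ℝ, 𝔼 × 𝕍) 𝓘(ℝ, 𝔼) ∞ (fun r : 𝔼 × 𝕍 => c.φ.symm r.1)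
      {r | r.1 ∈ c.dom W ∧ (r.1.1, r.2) ∈ c.dom W} :=
    c.contMDiffOn_φ_symm.comp contDiff_fst.contMDiff.contMDiffOn (fun r hr => hr.1.1)
  have h2 : ContMDiffOn 𝓘(ℝ, 𝔼 × 𝕍) 𝓘(ℝ, 𝔼) ∞ (fun r : 𝔼 × 𝕍 => c.φ.symm (r.1.1, r.2))
      {r | r.1 ∈ c.dom W ∧ (r.1.1, r.2) ∈ c.dom W} :=
    c.contMDiffOn_φ_symm.comp (contMDiffOn_iff_contDiffOn.2
      (by fun_prop : ContDiff ℝ ∞ fun r : 𝔼 × 𝕍 => (r.1.1, r.2)).contDiffOn)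
      (fun r hr => hr.2.1)
  exact c.contMDiffOn_φ.comp (𝒢.contMDiffOn_mul_comp (𝒢.contMDiff_inv.comp_contMDiffOn h2) h1
    (fun r hr => composable_inv hr.1.1 hr.2.1)) (fun r hr => invMul_mem hW hr.1 hr.2)

lemma contDiffAt_leftMul {q : 𝔼} (hq : q ∈ c.dom W) {v : 𝕍} (hv : (c.b q, v) ∈ c.dom W) :
    ContDiffAt ℝ ∞ (fun r : 𝔼 × 𝕍 => c.leftMul r.1 r.2) (q, v) :=
  (contDiffOn_leftMul hW).contDiffAt ((isOpen_leftMul_dom hW).mem_nhds ⟨hq, hv⟩)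

lemma contDiffAt_invMul {q : 𝔼} (hq : q ∈ c.dom W) {w : 𝕍} (hw : (q.1, w) ∈ c.dom W) :
    ContDiffAt ℝ ∞ (fun r : 𝔼 × 𝕍 => c.invMul r.1 r.2) (q, w) :=
  (contDiffOn_invMul hW).contDiffAt ((isOpen_invMul_dom hW).mem_nhds ⟨hq, hw⟩)

lemma symm_leftMul {q : 𝔼} (hq : q ∈ c.dom W) {v : 𝕍} (hv : (c.b q, v) ∈ c.dom W) :
    c.φ.symm (c.leftMul q v) = 𝒢.mul (c.φ.symm q) (c.φ.symm (c.b q, v)) :=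
  c.φ.left_inv (leftMul_mem hW hq hv)

lemma symm_invMul {q : 𝔼} (hq : q ∈ c.dom W) {w : 𝕍} (hw : (q.1, w) ∈ c.dom W) :
    c.φ.symm (c.invMul q w) = 𝒢.mul (𝒢.inv (c.φ.symm (q.1, w))) (c.φ.symm q) :=
  c.φ.left_inv (invMul_mem hW hq hw)

lemma leftMul_fst {q : 𝔼} (hq : q ∈ c.dom W) {v : 𝕍} (hv : (c.b q, v) ∈ c.dom W) :
    (c.leftMul q v).1 = q.1 := by
  unfold leftMul
  rw [c.fst_eq _ (leftMul_mem hW hq hv), 𝒢.α_mul _ _ (composable hW hq hv.1),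
    ← c.fst_eq _ (c.φ.map_target hq.1), c.φ.right_inv hq.1]

lemma leftMul_zero {q : 𝔼} (hq : q ∈ c.dom W) : c.leftMul q 0 = q := by
  unfold leftMul
  rw [symm_b_zero hW hq, 𝒢.mul_ε, c.φ.right_inv hq.1]

lemma invMul_zero {q : 𝔼} (hq : q ∈ c.dom W) : c.invMul q 0 = q := by
  unfold invMul
  rw [symm_zero hW hq, 𝒢.inv_ε, 𝒢.ε_mul, c.φ.right_inv hq.1]

lemma invMul_fst {q : 𝔼} (hq : q ∈ c.dom W) {w : 𝕍} (hw : (q.1, w) ∈ c.dom W) :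
    (c.invMul q w).1 = c.b (q.1, w) := by
  unfold invMul
  rw [c.fst_eq _ (invMul_mem hW hq hw), 𝒢.α_mul _ _ (composable_inv hq.1 hw.1), 𝒢.α_inv]
  rfl

/-- This is `z(z⁻¹k) = k`. It determines `z⁻¹k` implicitly through `p`, which is how the derivatives
of `p` come to describe `dInvMul`. -/
lemma p_invMul {q : 𝔼} (hq : q ∈ c.dom W) {w : 𝕍} (hw : (q.1, w) ∈ c.dom W) :
    c.p q.1 w (c.invMul q w).2 = q.2 := by
  unfold p
  have h : (c.b (q.1, w), (c.invMul q w).2) = c.invMul q w :=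
    Prod.ext (invMul_fst hW hq hw).symm rfl
  rw [h, symm_invMul hW hq hw, 𝒢.mul_inv_mul_cancel, c.φ.right_inv hq.1]
  rw [c.α_symm hw.1, c.α_symm hq.1]

/-- The left unit law; it makes `∂p/∂v` the identity at `u = 0`. -/
lemma p_zero {q : 𝔼} (hq : q ∈ c.dom W) {v : 𝕍} (hv : (q.1, v) ∈ c.dom W) :
    c.p q.1 0 v = v := by
  unfold p
  have h : 𝒢.α (c.φ.symm q) = 𝒢.α (c.φ.symm (q.1, v)) := by
    rw [c.α_symm hq.1, c.α_symm hv.1]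
  rw [b_zero hW hq, symm_zero hW hq, h, 𝒢.ε_mul, c.φ.right_inv hv.1]

end

end AdaptedCoords

end LieGroupoid

/-! ### Partial derivatives, and `𝔽L` as a derivative of the Legendre transformation. -/

namespace LieGroupoid

variable {n m : ℕ} {M G : Type*}
  [TopologicalSpace M] [ChartedSpace (EuclideanSpace ℝ (Fin n)) M]
  [TopologicalSpace G] [ChartedSpace (CoordSpace n m) G]

local notation "𝔼" => CoordSpace n m
local notation "𝕏" => EuclideanSpace ℝ (Fin n)
local notation "𝕍" => EuclideanSpace ℝ (Fin m)

section pdu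

lemma pdu_mul {f g : 𝔼 → ℝ} {q : 𝔼} (γ : Fin m) (hf : DifferentiableAt ℝ f q)
    (hg : DifferentiableAt ℝ g q) :
    pdu γ (fun r => f r * g r) q = f q * pdu γ g q + pdu γ f q * g q := by
  unfold pdu
  rw [fderiv_fun_mul hf hg]
  simp [mul_comm]

lemma pdu_sum {ι : Type*} (s : Finset ι) {f : ι → 𝔼 → ℝ} {q : 𝔼} (γ : Fin m)
    (hf : ∀ i ∈ s, DifferentiableAt ℝ (f i) q) :
    pdu γ (fun r => ∑ i ∈ s, f i r) q = ∑ i ∈ s, pdu γ (f i) q := by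
  unfold pdu
  rw [fderiv_fun_sum hf]
  simp

lemma pdu_sub {f g : 𝔼 → ℝ} {q : 𝔼} (γ : Fin m) (hf : DifferentiableAt ℝ f q)
    (hg : DifferentiableAt ℝ g q) :
    pdu γ (fun r => f r - g r) q = pdu γ f q - pdu γ g q := by
  unfold pdu
  rw [fderiv_fun_sub hf hg]
  rfl

lemma pdu_comp_fst {f : 𝕏 → ℝ} {q : 𝔼} (γ : Fin m) (hf : DifferentiableAt ℝ f q.1) :
    pdu γ (fun r : 𝔼 => f r.1) q = 0 := by
  unfold pdu
  have h : HasFDerivAt (fun r : 𝔼 => f r.1) ((fderiv ℝ f q.1).comp (.fst ℝ 𝕏 𝕍)) q :=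
    hf.hasFDerivAt.comp q hasFDerivAt_fst
  rw [h.fderiv]
  simp

lemma fderiv_eq_sum_pd (f : 𝔼 → ℝ) (q z : 𝔼) :
    fderiv ℝ f q z = ∑ i, z.1 i * pdx i f q + ∑ ν, z.2 ν * pdu ν f q := by
  have h1 : z.1 = ∑ i, z.1 i • EuclideanSpace.single i (1 : ℝ) := by
    ext j
    simp [Finset.sum_apply, Pi.single_apply]
  have h2 : z.2 = ∑ i, z.2 i • EuclideanSpace.single i (1 : ℝ) := by
    ext j
    simp [Finset.sum_apply, Pi.single_apply]
  have h3 : z = ContinuousLinearMap.inl ℝ 𝕏 𝕍 z.1 + ContinuousLinearMap.inr ℝ 𝕏 𝕍 z.2 := by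
    ext <;> simp
  have h4 := congrArg (fderiv ℝ f q) h3
  rw [map_add] at h4
  rw [h4]
  congr 1
  · conv_lhs => rw [h1]
    simp only [map_sum, map_smul, smul_eq_mul]
    rfl
  · conv_lhs => rw [h2]
    simp only [map_sum, map_smul, smul_eq_mul]
    rfl

lemma contDiffAt_pdu {f : 𝔼 → ℝ} {q : 𝔼} (γ : Fin m) (hf : ContDiffAt ℝ ∞ f q) :
    ContDiffAt ℝ ∞ (pdu γ f) q :=
  (hf.fderiv_right (by simp)).clm_apply contDiffAt_const

lemma contDiffAt_pdx {f : 𝔼 → ℝ} {q : 𝔼} (i : Fin n) (hf : ContDiffAt ℝ ∞ f q) :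
    ContDiffAt ℝ ∞ (pdx i f) q :=
  (hf.fderiv_right (by simp)).clm_apply contDiffAt_const

/-- Symmetry of second derivatives. In `FL` the derivative `∂/∂u^γ` is taken first, whereas
differentiating `legMinus` produces it last. -/
lemma fderiv_fderiv_apply_comm {f : 𝔼 → ℝ} {q : 𝔼} (hf : ContDiffAt ℝ ∞ f q) (v w : 𝔼) :
    fderiv ℝ (fun r => fderiv ℝ f r v) q w = fderiv ℝ (fun r => fderiv ℝ f r w) q v := by
  have hd : DifferentiableAt ℝ (fderiv ℝ f) q :=
    (hf.fderiv_right (m := ∞) (by simp)).differentiableAt (by simp)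
  have h (z : 𝔼) : fderiv ℝ (fun r => fderiv ℝ f r z) q =
      (fderiv ℝ (fderiv ℝ f) q).flip z := by
    rw [fderiv_clm_apply hd (differentiableAt_const z)]
    refine ContinuousLinearMap.ext fun y => ?_
    simp
  rw [h, h]
  exact (hf.isSymmSndFDerivAt (by simp; norm_cast)) w v

end pdu

namespace AdaptedCoords

variable {𝒢 : LieGroupoid n m M G} (c : 𝒢.AdaptedCoords) {x₀ : M} {W : Set G}

/-- The derivative at the identity of `w ↦ z⁻¹ k`, in coordinates. -/
def dInvMul (q : 𝔼) : 𝕍 →L[ℝ] 𝔼 := fderiv ℝ (c.invMul q) 0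

/-- The derivative at the identity of the left translation, in coordinates. -/
def dLeftMul (q : 𝔼) : 𝕍 →L[ℝ] 𝔼 := fderiv ℝ (c.leftMul q) 0

/-- The fibre component of the discrete Legendre transformation `𝔽⁻L`, in coordinates. -/
def legMinus (L : G → ℝ) (q : 𝔼) : 𝕍 →L[ℝ] ℝ := -(fderiv ℝ (c.lag L) q).comp (c.dInvMul q)

/-- The fibre component of the discrete Legendre transformation `𝔽⁺L`, in coordinates. -/
def legPlus (L : G → ℝ) (q : 𝔼) : 𝕍 →L[ℝ] ℝ := (fderiv ℝ (c.lag L) q).comp (c.dLeftMul q)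

/-- The inversion in coordinates. -/
def invC (q : 𝔼) : 𝔼 := c.φ (𝒢.inv (c.φ.symm q))

section

variable {c} (hW : 𝒢.IsSymmetricNhd c.φ.source x₀ W)
include hW

lemma contDiffAt_b {q : 𝔼} (hq : q ∈ c.dom W) : ContDiffAt ℝ ∞ c.b q :=
  (contDiffOn_b hW).contDiffAt ((isOpen_dom hW).mem_nhds hq)

lemma contDiffAt_dInvMul {q : 𝔼} (hq : q ∈ c.dom W) : ContDiffAt ℝ ∞ c.dInvMul q :=
  ContDiffAt.fderiv (f := c.invMul) (g := fun _ => 0) (n := ∞)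
    (contDiffAt_invMul hW hq (zero_mem_dom hW hq)) contDiffAt_const (by simp)

lemma contDiffAt_dLeftMul {q : 𝔼} (hq : q ∈ c.dom W) : ContDiffAt ℝ ∞ c.dLeftMul q :=
  ContDiffAt.fderiv (f := c.leftMul) (g := fun _ => 0) (n := ∞)
    (contDiffAt_leftMul hW hq (b_zero_mem_dom hW hq)) contDiffAt_const (by simp)

lemma contDiffAt_lag {L : G → ℝ} (hL : ContMDiff 𝓘(ℝ, 𝔼) 𝓘(ℝ, ℝ) ∞ L) {q : 𝔼}
    (hq : q ∈ c.dom W) : ContDiffAt ℝ ∞ (c.lag L) q := by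
  have h : ContDiffOn ℝ ∞ (c.lag L) (c.dom W) := by
    rw [← contMDiffOn_iff_contDiffOn]
    exact hL.comp_contMDiffOn (c.contMDiffOn_φ_symm.mono inter_subset_left)
  exact h.contDiffAt ((isOpen_dom hW).mem_nhds hq)

lemma contDiffAt_legMinus {L : G → ℝ} (hL : ContMDiff 𝓘(ℝ, 𝔼) 𝓘(ℝ, ℝ) ∞ L) {q : 𝔼}
    (hq : q ∈ c.dom W) : ContDiffAt ℝ ∞ (c.legMinus L) q :=
  (((contDiffAt_lag hW hL hq).fderiv_right (by simp)).clm_comp (contDiffAt_dInvMul hW hq)).neg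

lemma contDiffAt_legPlus {L : G → ℝ} (hL : ContMDiff 𝓘(ℝ, 𝔼) 𝓘(ℝ, ℝ) ∞ L) {q : 𝔼}
    (hq : q ∈ c.dom W) : ContDiffAt ℝ ∞ (c.legPlus L) q :=
  ((contDiffAt_lag hW hL hq).fderiv_right (by simp)).clm_comp (contDiffAt_dLeftMul hW hq)

lemma hasFDerivAt_invMul {q : 𝔼} (hq : q ∈ c.dom W) :
    HasFDerivAt (c.invMul q) (c.dInvMul q) 0 := by
  refine DifferentiableAt.hasFDerivAt ?_
  exact ((contDiffAt_invMul hW hq (zero_mem_dom hW hq)).differentiableAt (by simp)).comp (0 : 𝕍)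
    ((differentiableAt_const q).prodMk differentiableAt_id)

lemma differentiableAt_leftMul {q : 𝔼} (hq : q ∈ c.dom W) {v : 𝕍} (hv : (c.b q, v) ∈ c.dom W) :
    DifferentiableAt ℝ (c.leftMul q) v :=
  ((contDiffAt_leftMul hW hq hv).differentiableAt (by simp)).comp v
    ((differentiableAt_const q).prodMk differentiableAt_id)

lemma hasFDerivAt_leftMul {q : 𝔼} (hq : q ∈ c.dom W) :
    HasFDerivAt (c.leftMul q) (c.dLeftMul q) 0 :=
  (differentiableAt_leftMul hW hq (b_zero_mem_dom hW hq)).hasFDerivAt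

lemma eventually_mem_dom {q : 𝔼} (hq : q ∈ c.dom W) : ∀ᶠ v in 𝓝 q.2, (q.1, v) ∈ c.dom W :=
  (by fun_prop : Continuous fun v : 𝕍 => (q.1, v)).continuousAt.eventually_mem
    ((isOpen_dom hW).mem_nhds hq)

/-- Left translates of `g` stay in the fibre `α⁻¹(α g)`, so their first coordinate is constant. -/
lemma dLeftMul_fst {q : 𝔼} (hq : q ∈ c.dom W) (w : 𝕍) : (c.dLeftMul q w).1 = 0 := by
  have h1 : HasFDerivAt (fun v => (c.leftMul q v).1) ((ContinuousLinearMap.fst ℝ 𝕏 𝕍).comp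
      (c.dLeftMul q)) 0 := hasFDerivAt_fst.comp (0 : 𝕍) (hasFDerivAt_leftMul hW hq)
  have h2 : (fun v => (c.leftMul q v).1) =ᶠ[𝓝 0] fun _ => q.1 := by
    filter_upwards [eventually_mem_dom hW (b_zero_mem_dom hW hq)] with v hv
    exact leftMul_fst hW hq hv
  have h3 := h1.unique ((hasFDerivAt_const q.1 (0 : 𝕍)).congr_of_eventuallyEq h2)
  exact DFunLike.congr_fun h3 w

/-- Because `α(z⁻¹k) = β(z)`. -/
lemma dInvMul_fst {q : 𝔼} (hq : q ∈ c.dom W) (w : 𝕍) :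
    (c.dInvMul q w).1 = fderiv ℝ c.b (q.1, 0) (0, w) := by
  have h1 : HasFDerivAt (fun v => (c.invMul q v).1) ((ContinuousLinearMap.fst ℝ 𝕏 𝕍).comp
      (c.dInvMul q)) 0 := hasFDerivAt_fst.comp (0 : 𝕍) (hasFDerivAt_invMul hW hq)
  have h2 : (fun v => (c.invMul q v).1) =ᶠ[𝓝 0] fun v => c.b (q.1, v) := by
    filter_upwards [eventually_mem_dom hW (zero_mem_dom hW hq)] with v hv
    exact invMul_fst hW hq hv
  have h4 : HasFDerivAt (fun v : 𝕍 => c.b (q.1, v)) ((fderiv ℝ c.b (q.1, 0)).comp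
      ((0 : 𝕍 →L[ℝ] 𝕏).prod (.id ℝ 𝕍))) 0 :=
    ((contDiffAt_b hW (zero_mem_dom hW hq)).differentiableAt (by simp)).hasFDerivAt.comp (0 : 𝕍)
      ((hasFDerivAt_const q.1 (0 : 𝕍)).prodMk (hasFDerivAt_id _))
  have h3 := h1.unique (h4.congr_of_eventuallyEq h2)
  exact DFunLike.congr_fun h3 w

/-- Differentiate `p(x, w, (z⁻¹k).2) = u` at `w = 0`. The derivative in the last argument is the
identity by `p_zero`, so the derivative of `p` in its middle argument and that of `(z⁻¹k).2` add up
to zero. -/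
lemma dInvMul_snd {q : 𝔼} (hq : q ∈ c.dom W) (w : 𝕍) :
    (c.dInvMul q w).2 = -(fderiv ℝ (fun r => (c.leftMul r q.2).2) (q.1, 0) (0, w)) := by
  have hq0 := zero_mem_dom hW hq
  have hb : (c.b (q.1, 0), q.2) ∈ c.dom W := by rw [b_zero hW hq]; exact hq
  have hF : HasFDerivAt (fun r : 𝔼 × 𝕍 => (c.leftMul r.1 r.2).2)
      ((ContinuousLinearMap.snd ℝ 𝕏 𝕍).comp
        (fderiv ℝ (fun r : 𝔼 × 𝕍 => c.leftMul r.1 r.2) ((q.1, 0), q.2))) ((q.1, 0), q.2) :=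
    hasFDerivAt_snd.comp _
      ((contDiffAt_leftMul hW hq0 hb).differentiableAt (by simp)).hasFDerivAt
  set F' := (ContinuousLinearMap.snd ℝ 𝕏 𝕍).comp
        (fderiv ℝ (fun r : 𝔼 × 𝕍 => c.leftMul r.1 r.2) ((q.1, 0), q.2)) with hF'
  have h1 : HasFDerivAt (fun r => (c.leftMul r q.2).2)
      (F'.comp ((ContinuousLinearMap.id ℝ 𝔼).prod 0)) (q.1, 0) :=
    HasFDerivAt.comp (f := fun r : 𝔼 => (r, q.2)) (q.1, (0 : 𝕍)) hF
      ((hasFDerivAt_id _).prodMk (hasFDerivAt_const q.2 _))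
  have h2 : HasFDerivAt (fun v => (c.leftMul (q.1, 0) v).2)
      (F'.comp ((0 : 𝕍 →L[ℝ] 𝔼).prod (.id ℝ 𝕍))) q.2 :=
    hF.comp q.2 ((hasFDerivAt_const (q.1, (0 : 𝕍)) _).prodMk (hasFDerivAt_id _))
  have h2' : (fun v => (c.leftMul (q.1, 0) v).2) =ᶠ[𝓝 q.2] id := by
    filter_upwards [eventually_mem_dom hW hq] with v hv
    exact p_zero hW hq hv
  have h2'' := h2.unique ((hasFDerivAt_id q.2).congr_of_eventuallyEq h2')
  have h3 : HasFDerivAt (fun w => c.p q.1 w (c.invMul q w).2)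
      (F'.comp (((0 : 𝕍 →L[ℝ] 𝕏).prod (.id ℝ 𝕍)).prod
        ((ContinuousLinearMap.snd ℝ 𝕏 𝕍).comp (c.dInvMul q)))) 0 := by
    -- The chain rule needs the base point of `hF` in the form of the value of the inner map at `0`.
    have h0 : (c.invMul q 0).2 = q.2 := by rw [invMul_zero hW hq]
    rw [← h0] at hF
    exact HasFDerivAt.comp (0 : 𝕍) hF
      (((hasFDerivAt_const q.1 (0 : 𝕍)).prodMk (hasFDerivAt_id _)).prodMk
        (hasFDerivAt_snd.comp (0 : 𝕍) (hasFDerivAt_invMul hW hq)))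
  have h3' : (fun w => c.p q.1 w (c.invMul q w).2) =ᶠ[𝓝 0] fun _ => q.2 := by
    filter_upwards [eventually_mem_dom hW hq0] with v hv
    exact p_invMul hW hq hv
  have h3'' := h3.unique ((hasFDerivAt_const q.2 (0 : 𝕍)).congr_of_eventuallyEq h3')
  have e3 := DFunLike.congr_fun h3'' w
  have e2 := DFunLike.congr_fun h2'' (c.dInvMul q w).2
  rw [h1.fderiv]
  have e : ((((0 : 𝕏), w) : 𝔼), (c.dInvMul q w).2) =
    ((((0 : 𝕏), w) : 𝔼), (0 : 𝕍)) + ((0 : 𝔼), (c.dInvMul q w).2) := by simp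
  change F' ((((0 : 𝕏), w) : 𝔼), (c.dInvMul q w).2) = 0 at e3
  rw [e, map_add] at e3
  change F' ((0 : 𝔼), (c.dInvMul q w).2) = (c.dInvMul q w).2 at e2
  rw [e2] at e3
  exact (neg_eq_of_add_eq_zero_right e3).symm

lemma ρ_eq {q : 𝔼} (hq : q ∈ c.dom W) (i : Fin n) (μ : Fin m) :
    c.ρ i μ q.1 = (c.dInvMul q (EuclideanSpace.single μ 1)).1 i := by
  rw [dInvMul_fst hW hq]
  have h : HasFDerivAt (fun r => c.b r i) ((EuclideanSpace.proj i : 𝕏 →L[ℝ] ℝ).comp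
      (fderiv ℝ c.b (q.1, 0))) (q.1, 0) :=
    (EuclideanSpace.proj i : 𝕏 →L[ℝ] ℝ).hasFDerivAt.comp _
      ((contDiffAt_b hW (zero_mem_dom hW hq)).differentiableAt (by simp)).hasFDerivAt
  unfold ρ pdu
  rw [h.fderiv]
  rfl

lemma contDiffAt_leftMul_left {q : 𝔼} (hq : q ∈ c.dom W) :
    ContDiffAt ℝ ∞ (fun r => (c.leftMul r q.2).2) (q.1, 0) := by
  have hb : (c.b (q.1, 0), q.2) ∈ c.dom W := by rw [b_zero hW hq]; exact hq
  exact contDiffAt_snd.comp _ (ContDiffAt.comp (f := fun r : 𝔼 => (r, q.2)) (q.1, (0 : 𝕍))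
    (contDiffAt_leftMul hW (zero_mem_dom hW hq) hb) (contDiffAt_id.prodMk contDiffAt_const))

/-- Together with `ρ_eq`, this identifies the coefficients in `FL` with the components of `dInvMul`.
The sign is the one in `dInvMul_snd`. -/
lemma R_eq {q : 𝔼} (hq : q ∈ c.dom W) (ν μ : Fin m) :
    c.R ν μ q = -(c.dInvMul q (EuclideanSpace.single μ 1)).2 ν := by
  rw [dInvMul_snd hW hq]
  have h : HasFDerivAt (fun r => (c.leftMul r q.2).2 ν) ((EuclideanSpace.proj ν : 𝕍 →L[ℝ] ℝ).comp
      (fderiv ℝ (fun r => (c.leftMul r q.2).2) (q.1, 0))) (q.1, 0) :=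
    (EuclideanSpace.proj ν : 𝕍 →L[ℝ] ℝ).hasFDerivAt.comp _
      ((contDiffAt_leftMul_left hW hq).differentiableAt (by simp)).hasFDerivAt
  change fderiv ℝ (fun r => (c.leftMul r q.2).2 ν) (q.1, 0) _ = _
  rw [h.fderiv]
  simp

lemma contDiffAt_ρ {q : 𝔼} (hq : q ∈ c.dom W) (i : Fin n) (μ : Fin m) :
    ContDiffAt ℝ ∞ (c.ρ i μ) q.1 := by
  have h : ContDiffAt ℝ ∞ (fun r => c.b r i) (q.1, 0) :=
    (EuclideanSpace.proj i : 𝕏 →L[ℝ] ℝ).contDiff.contDiffAt.comp _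
      (contDiffAt_b hW (zero_mem_dom hW hq))
  exact (contDiffAt_pdu μ h).comp q.1 (contDiffAt_id.prodMk contDiffAt_const)

lemma contDiffAt_R {q : 𝔼} (hq : q ∈ c.dom W) (ν μ : Fin m) : ContDiffAt ℝ ∞ (c.R ν μ) q := by
  have h : c.R ν μ =ᶠ[𝓝 q] fun r => -(c.dInvMul r (EuclideanSpace.single μ 1)).2 ν := by
    filter_upwards [(isOpen_dom hW).mem_nhds hq] with r hr
    exact R_eq hW hr ν μ
  refine ContDiffAt.congr_of_eventuallyEq (ContDiffAt.neg ?_) h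
  exact (EuclideanSpace.proj ν : 𝕍 →L[ℝ] ℝ).contDiff.contDiffAt.comp q
    (contDiffAt_snd.comp q ((contDiffAt_dInvMul hW hq).clm_apply contDiffAt_const))

/-- Expansion of `dL` in the coordinate basis. The formula holds on all of `dom W`, so it may be
differentiated. -/
lemma legMinus_single {L : G → ℝ} {q : 𝔼} (hq : q ∈ c.dom W) (μ : Fin m) :
    c.legMinus L q (EuclideanSpace.single μ 1) =
      ∑ ν, c.R ν μ q * pdu ν (c.lag L) q - ∑ i, c.ρ i μ q.1 * pdx i (c.lag L) q := by
  change -(fderiv ℝ (c.lag L) q (c.dInvMul q _)) = _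
  rw [fderiv_eq_sum_pd]
  simp only [ρ_eq hW hq, R_eq hW hq, neg_mul, Finset.sum_neg_distrib]
  ring

/-- The matrix `𝔽L` is, up to sign, the derivative of the Legendre transformation along the fibres
of `α`. -/
lemma fderiv_legMinus_single {L : G → ℝ} (hL : ContMDiff 𝓘(ℝ, 𝔼) 𝓘(ℝ, ℝ) ∞ L) {q : 𝔼}
    (hq : q ∈ c.dom W) (γ μ : Fin m) :
    fderiv ℝ (c.legMinus L) q (0, EuclideanSpace.single γ 1) (EuclideanSpace.single μ 1) =
      -c.FL L q γ μ := by
  have hlag := contDiffAt_lag hW hL hq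
  have hd : DifferentiableAt ℝ (c.legMinus L) q :=
    (contDiffAt_legMinus hW hL hq).differentiableAt (by simp)
  have h1 : fderiv ℝ (c.legMinus L) q (0, EuclideanSpace.single γ 1) (EuclideanSpace.single μ 1) =
      pdu γ (fun r => c.legMinus L r (EuclideanSpace.single μ 1)) q := by
    unfold pdu
    rw [fderiv_clm_apply hd (differentiableAt_const _)]
    simp
  have h2 : (fun r => c.legMinus L r (EuclideanSpace.single μ 1)) =ᶠ[𝓝 q] fun r =>
      ∑ ν, c.R ν μ r * pdu ν (c.lag L) r - ∑ i, c.ρ i μ r.1 * pdx i (c.lag L) r := by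
    filter_upwards [(isOpen_dom hW).mem_nhds hq] with r hr
    exact legMinus_single hW hr μ
  have dR (ν : Fin m) : DifferentiableAt ℝ (c.R ν μ) q :=
    (contDiffAt_R hW hq ν μ).differentiableAt (by simp)
  have dρ (i : Fin n) : DifferentiableAt ℝ (c.ρ i μ) q.1 :=
    (contDiffAt_ρ hW hq i μ).differentiableAt (by simp)
  have dρ' (i : Fin n) : DifferentiableAt ℝ (fun r : 𝔼 => c.ρ i μ r.1) q :=
    (dρ i).comp q differentiableAt_fst
  have du (ν : Fin m) : DifferentiableAt ℝ (pdu ν (c.lag L)) q :=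
    (contDiffAt_pdu ν hlag).differentiableAt (by simp)
  have dx (i : Fin n) : DifferentiableAt ℝ (pdx i (c.lag L)) q :=
    (contDiffAt_pdx i hlag).differentiableAt (by simp)
  have e1 (ν : Fin m) : pdu γ (pdu ν (c.lag L)) q = pdu ν (pdu γ (c.lag L)) q :=
    fderiv_fderiv_apply_comm hlag _ _
  have e2 (i : Fin n) : pdu γ (pdx i (c.lag L)) q = pdx i (pdu γ (c.lag L)) q :=
    fderiv_fderiv_apply_comm hlag _ _
  rw [h1]
  have h3 := congrArg (fun T : 𝔼 →L[ℝ] ℝ => T (0, EuclideanSpace.single γ 1)) h2.fderiv_eq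
  refine (show pdu γ _ q = pdu γ _ q from h3).trans ?_
  rw [pdu_sub γ (DifferentiableAt.fun_sum fun ν _ => (dR ν).fun_mul (du ν))
    (DifferentiableAt.fun_sum fun i _ => (dρ' i).fun_mul (dx i)),
    pdu_sum _ γ (fun ν _ => (dR ν).fun_mul (du ν)), pdu_sum _ γ (fun i _ => (dρ' i).fun_mul (dx i))]
  have t1 (ν : Fin m) := pdu_mul γ (dR ν) (du ν)
  have t2 (i : Fin n) := pdu_mul γ (dρ' i) (dx i)
  -- The product rule would also give a term `∂ρ/∂u`; it vanishes as `ρ` is a function of `x` only.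
  -- This is why `FL` contains a derivative of `R` but none of `ρ`.
  simp only [t1, t2, e1, e2, pdu_comp_fst γ (dρ _), Finset.sum_add_distrib, FL, Matrix.of_apply]
  simp
  ring

end

end AdaptedCoords

end LieGroupoid

/-! ### Inversion in coordinates and the frame of `ker Tβ`. -/

namespace LieGroupoid

variable {n m : ℕ} {M G : Type*}
  [TopologicalSpace M] [ChartedSpace (EuclideanSpace ℝ (Fin n)) M]
  [TopologicalSpace G] [ChartedSpace (CoordSpace n m) G]

local notation "𝔼" => CoordSpace n m
local notation "𝕏" => EuclideanSpace ℝ (Fin n)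
local notation "𝕍" => EuclideanSpace ℝ (Fin m)

namespace AdaptedCoords

variable {𝒢 : LieGroupoid n m M G} {c : 𝒢.AdaptedCoords} {x₀ : M} {W : Set G}
  (hW : 𝒢.IsSymmetricNhd c.φ.source x₀ W)
include hW

lemma symm_invC {q : 𝔼} (hq : q ∈ c.dom W) : c.φ.symm (c.invC q) = 𝒢.inv (c.φ.symm q) :=
  c.φ.left_inv (hW.subset (hW.inv_mem hq.2))

lemma invC_mem {q : 𝔼} (hq : q ∈ c.dom W) : c.invC q ∈ c.dom W :=
  φ_mem_dom hW (hW.inv_mem hq.2)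

lemma invC_invC {q : 𝔼} (hq : q ∈ c.dom W) : c.invC (c.invC q) = q := by
  rw [invC, symm_invC hW hq, 𝒢.inv_inv, c.φ.right_inv hq.1]

lemma invC_fst {q : 𝔼} (hq : q ∈ c.dom W) : (c.invC q).1 = c.b q := by
  rw [invC, c.fst_eq _ (hW.subset (hW.inv_mem hq.2)), 𝒢.α_inv]
  rfl

lemma b_invC {q : 𝔼} (hq : q ∈ c.dom W) : c.b (c.invC q) = q.1 := by
  rw [← invC_fst hW (invC_mem hW hq), invC_invC hW hq]

lemma contDiffAt_invC {q : 𝔼} (hq : q ∈ c.dom W) : ContDiffAt ℝ ∞ c.invC q := by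
  have h : ContDiffOn ℝ ∞ c.invC (c.dom W) := by
    rw [← contMDiffOn_iff_contDiffOn]
    exact c.contMDiffOn_φ.comp (𝒢.contMDiff_inv.comp_contMDiffOn
      (c.contMDiffOn_φ_symm.mono inter_subset_left))
      (fun q hq => hW.subset (hW.inv_mem hq.2))
  exact h.contDiffAt ((isOpen_dom hW).mem_nhds hq)

/-- This is `(k⁻¹z)⁻¹ = z⁻¹k`: inversion exchanges the two kinds of translation, so facts about
`dInvMul` follow from facts about `dLeftMul`. -/
lemma invC_leftMul_invC {q : 𝔼} (hq : q ∈ c.dom W) {w : 𝕍} (hw : (q.1, w) ∈ c.dom W) :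
    c.invC (c.leftMul (c.invC q) w) = c.invMul q w := by
  have hq' := invC_mem hW hq
  have hw' : (c.b (c.invC q), w) ∈ c.dom W := by rw [b_invC hW hq]; exact hw
  rw [invC, symm_leftMul hW hq' hw', 𝒢.inv_mul_rev (composable hW hq' hw'.1), symm_invC hW hq,
    𝒢.inv_inv, b_invC hW hq, invMul]

lemma dInvMul_eq {q : 𝔼} (hq : q ∈ c.dom W) :
    c.dInvMul q = (fderiv ℝ c.invC (c.invC q)).comp (c.dLeftMul (c.invC q)) := by
  have hq' := invC_mem hW hq
  have h1 : HasFDerivAt c.invC (fderiv ℝ c.invC (c.invC q)) (c.leftMul (c.invC q) 0) := by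
    rw [leftMul_zero hW hq']
    exact ((contDiffAt_invC hW hq').differentiableAt (by simp)).hasFDerivAt
  have h2 := h1.comp (0 : 𝕍) (hasFDerivAt_leftMul hW hq')
  have h3 : c.invMul q =ᶠ[𝓝 0] c.invC ∘ c.leftMul (c.invC q) := by
    filter_upwards [eventually_mem_dom hW (zero_mem_dom hW hq)] with w hw
    exact (invC_leftMul_invC hW hq hw).symm
  exact (hasFDerivAt_invMul hW hq).unique (h2.congr_of_eventuallyEq h3)

lemma fderiv_invC_invC {q : 𝔼} (hq : q ∈ c.dom W) (z : 𝔼) :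
    fderiv ℝ c.invC (c.invC q) (fderiv ℝ c.invC q z) = z := by
  have hq' := invC_mem hW hq
  have h1 := ((contDiffAt_invC hW hq').differentiableAt (by simp)).hasFDerivAt.comp q
    ((contDiffAt_invC hW hq).differentiableAt (by simp)).hasFDerivAt
  have h2 : c.invC ∘ c.invC =ᶠ[𝓝 q] id := by
    filter_upwards [(isOpen_dom hW).mem_nhds hq] with r hr
    exact invC_invC hW hr
  exact DFunLike.congr_fun (h1.unique ((hasFDerivAt_id q).congr_of_eventuallyEq h2)) z

lemma fderiv_invC_fst {q : 𝔼} (hq : q ∈ c.dom W) (z : 𝔼) :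
    (fderiv ℝ c.invC q z).1 = fderiv ℝ c.b q z := by
  have h1 : HasFDerivAt (fun r => (c.invC r).1)
      ((ContinuousLinearMap.fst ℝ 𝕏 𝕍).comp (fderiv ℝ c.invC q)) q :=
    hasFDerivAt_fst.comp q ((contDiffAt_invC hW hq).differentiableAt (by simp)).hasFDerivAt
  have h2 : (fun r => (c.invC r).1) =ᶠ[𝓝 q] c.b := by
    filter_upwards [(isOpen_dom hW).mem_nhds hq] with r hr
    exact invC_fst hW hr
  rw [← h2.fderiv_eq, h1.fderiv]
  rfl

/-- Left translation by `k⁻¹` undoes left translation by `k`, which supplies a left inverse of the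
derivative; in finite dimension a left inverse is two-sided. -/
lemma isUnit_dLeftMul_snd {q : 𝔼} (hq : q ∈ c.dom W) :
    IsUnit ((ContinuousLinearMap.snd ℝ 𝕏 𝕍).comp (c.dLeftMul q)) := by
  have hq' := invC_mem hW hq
  have hv : (c.b (c.invC q), q.2) ∈ c.dom W := by rw [b_invC hW hq]; exact hq
  have h1 : HasFDerivAt (fun v => (c.leftMul (c.invC q) v).2) ((ContinuousLinearMap.snd ℝ 𝕏 𝕍).comp
      (fderiv ℝ (c.leftMul (c.invC q)) q.2)) (c.leftMul q 0).2 := by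
    rw [leftMul_zero hW hq]
    exact hasFDerivAt_snd.comp _ (differentiableAt_leftMul hW hq' hv).hasFDerivAt
  set A := (ContinuousLinearMap.snd ℝ 𝕏 𝕍).comp (fderiv ℝ (c.leftMul (c.invC q)) q.2)
  set N := (ContinuousLinearMap.snd ℝ 𝕏 𝕍).comp (c.dLeftMul q)
  have h2 : HasFDerivAt (fun v => (c.leftMul (c.invC q) (c.leftMul q v).2).2) (A.comp N) 0 :=
    HasFDerivAt.comp (f := fun v => (c.leftMul q v).2) (0 : 𝕍) h1 (hasFDerivAt_snd.comp (0 : 𝕍) (hasFDerivAt_leftMul hW hq))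
  have h3 : (fun v => (c.leftMul (c.invC q) (c.leftMul q v).2).2) =ᶠ[𝓝 0] id := by
    filter_upwards [eventually_mem_dom hW (b_zero_mem_dom hW hq)] with v hv
    have e : (c.b (c.invC q), (c.leftMul q v).2) = c.leftMul q v :=
      Prod.ext (by rw [b_invC hW hq, leftMul_fst hW hq hv]) rfl
    rw [leftMul, e, symm_leftMul hW hq hv, symm_invC hW hq,
      𝒢.inv_mul_mul_cancel (composable hW hq hv.1), c.φ.right_inv hv.1]
    rfl
  have h4 : A * N = 1 := h2.unique ((hasFDerivAt_id _).congr_of_eventuallyEq h3)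
  -- The commutation of one-sided inverses is applied to plain linear endomorphisms, then carried
  -- back to continuous ones.
  have h5 : (A : 𝕍 →ₗ[ℝ] 𝕍) * (N : 𝕍 →ₗ[ℝ] 𝕍) = 1 :=
    LinearMap.ext fun v => DFunLike.congr_fun h4 v
  have h6 := mul_eq_one_comm.1 h5
  exact ⟨⟨N, A, ContinuousLinearMap.ext fun v => DFunLike.congr_fun h6 v, h4⟩, rfl⟩

/-- Smooth right-trivialization, in coordinates, of the vectors tangent to the fibres of `β`. -/
lemma exists_dInvMul_section : ∃ B : 𝔼 → 𝔼 →L[ℝ] 𝕍, (∀ q ∈ c.dom W, ContDiffAt ℝ ∞ B q) ∧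
    ∀ q ∈ c.dom W, ∀ z, fderiv ℝ c.b q z = 0 → c.dInvMul q (B q z) = z := by
  let N : 𝔼 → 𝕍 →L[ℝ] 𝕍 := fun q => (ContinuousLinearMap.snd ℝ 𝕏 𝕍).comp (c.dLeftMul q)
  -- Inversion sends a `β`-vertical vector to one of the form `(0, y)`, and `y` is then solved for
  -- by the inverse of the left-translation block `N`. `Ring.inverse` is smooth at units, so the
  -- result is smooth in `q`.
  refine ⟨fun q => (Ring.inverse (N (c.invC q))).comp
    ((ContinuousLinearMap.snd ℝ 𝕏 𝕍).comp (fderiv ℝ c.invC q)), fun q hq => ?_, fun q hq z hz => ?_⟩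
  · have hq' := invC_mem hW hq
    obtain ⟨u, hu⟩ := isUnit_dLeftMul_snd hW hq'
    have h1 : ContDiffAt ℝ ∞ Ring.inverse (N (c.invC q)) := by
      change ContDiffAt ℝ ∞ Ring.inverse
        ((ContinuousLinearMap.snd ℝ 𝕏 𝕍).comp (c.dLeftMul (c.invC q)))
      rw [← hu]
      exact contDiffAt_ringInverse ℝ u
    have h2 : ContDiffAt ℝ ∞ (fun q => N (c.invC q)) q :=
      contDiffAt_const.clm_comp ((contDiffAt_dLeftMul hW hq').comp q (contDiffAt_invC hW hq))
    exact (h1.comp q h2).clm_comp (contDiffAt_const.clm_comp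
      ((contDiffAt_invC hW hq).fderiv_right (by simp)))
  · have hq' := invC_mem hW hq
    have h1 : fderiv ℝ c.invC q z = (0, (fderiv ℝ c.invC q z).2) :=
      Prod.ext ((fderiv_invC_fst hW hq z).trans hz) rfl
    set y := (fderiv ℝ c.invC q z).2
    have h2 : N (c.invC q) (Ring.inverse (N (c.invC q)) y) = y :=
      DFunLike.congr_fun (Ring.mul_inverse_cancel _ (isUnit_dLeftMul_snd hW hq')) y
    have h3 : c.dLeftMul (c.invC q) (Ring.inverse (N (c.invC q)) y) = (0, y) :=
      Prod.ext (dLeftMul_fst hW hq' _) h2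
    rw [dInvMul_eq hW hq]
    change fderiv ℝ c.invC (c.invC q) (c.dLeftMul (c.invC q) (Ring.inverse (N (c.invC q)) y)) = z
    rw [h3, ← h1, fderiv_invC_invC hW hq]

/-- Inversion turns `b` into the first coordinate and `dInvMul` into a left translate, whose first
coordinate is zero. -/
lemma fderiv_b_dInvMul {q : 𝔼} (hq : q ∈ c.dom W) (w : 𝕍) :
    fderiv ℝ c.b q (c.dInvMul q w) = 0 := by
  have hq' := invC_mem hW hq
  rw [dInvMul_eq hW hq, ← fderiv_invC_fst hW hq]
  have h := fderiv_invC_invC hW hq' (c.dLeftMul (c.invC q) w)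
  rw [invC_invC hW hq] at h
  change (fderiv ℝ c.invC q (fderiv ℝ c.invC (c.invC q) (c.dLeftMul (c.invC q) w))).1 = 0
  rw [h, dLeftMul_fst hW hq']

end AdaptedCoords

end LieGroupoid

/-! ### Global extension of local sections. -/

section bump

variable {E : Type*} [NormedAddCommGroup E] [NormedSpace ℝ E] [FiniteDimensional ℝ E]
  {H : Type*} [TopologicalSpace H] {I : ModelWithCorners ℝ E H}
  {B : Type*} [TopologicalSpace B] [T2Space B] [ChartedSpace H B] [IsManifold I ∞ B]
  {F : Type*} [NormedAddCommGroup F] [NormedSpace ℝ F]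
  {V : B → Type*} [∀ x, AddCommGroup (V x)] [∀ x, Module ℝ (V x)] [∀ x, TopologicalSpace (V x)]
  [TopologicalSpace (TotalSpace F V)] [FiberBundle F V] [VectorBundle ℝ F V]

/-- A smooth local section agrees near a point with a smooth global section. -/
theorem exists_bump_smul_section {s : ∀ x, V x} {u : Set B} {x : B} (hu : IsOpen u) (hx : x ∈ u)
    (hs : ContMDiffOn I (I.prod 𝓘(ℝ, F)) ∞ (fun y => TotalSpace.mk' F y (s y)) u) :
    ∃ ψ : B → ℝ, ψ =ᶠ[𝓝 x] 1 ∧ (∀ y ∉ u, ψ y = 0) ∧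
      ContMDiff I (I.prod 𝓘(ℝ, F)) ∞ (fun y => TotalSpace.mk' F y ((ψ • s) y)) := by
  obtain ⟨f, -, hf⟩ := (SmoothBumpFunction.nhds_basis_tsupport (I := I) x).mem_iff.1
    (hu.mem_nhds hx)
  refine ⟨f, f.eventuallyEq_one, fun y hy => ?_, ?_⟩
  · by_contra h
    exact hy (hf (subset_tsupport _ h))
  · exact ContMDiffOn.smul_section_of_tsupport f.contMDiff.contMDiffOn hu hf hs

/-- Extend `v` as a constant in a local trivialization and cut off. Thereby equations tested on
global sections become equations on the whole fibre. -/
theorem exists_contMDiffSection_apply_eq [ContMDiffVectorBundle ∞ F V I] (x : B) (v : V x) :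
    ∃ s : ContMDiffSection I F ∞ V, s x = v := by
  have hx := FiberBundle.mem_baseSet_trivializationAt' (F := F) (E := V) x
  let e := trivializationAt F V x
  have hs : ContMDiffOn I (I.prod 𝓘(ℝ, F)) ∞
      (fun y => TotalSpace.mk' F y (e.symm y (e ⟨x, v⟩).2)) e.baseSet := by
    rw [e.contMDiffOn_section_baseSet_iff]
    refine contMDiffOn_const (c := (e ⟨x, v⟩).2) |>.congr fun y hy => ?_
    rw [e.apply_mk_symm hy]
  obtain ⟨ψ, h1, -, h3⟩ := exists_bump_smul_section e.open_baseSet hx hs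
  refine ⟨⟨_, h3⟩, ?_⟩
  change ψ x • e.symm x (e ⟨x, v⟩).2 = v
  rw [h1.eq_of_nhds]
  simp [e.symm_apply_apply_mk hx]

end bump

/-! ### Tangent vectors and the fibres of `AG` in adapted coordinates. -/

namespace LieGroupoid

variable {n m : ℕ} {M G : Type*}
  [TopologicalSpace M] [ChartedSpace (EuclideanSpace ℝ (Fin n)) M]
  [TopologicalSpace G] [ChartedSpace (CoordSpace n m) G]

local notation "𝔼" => CoordSpace n m
local notation "𝕏" => EuclideanSpace ℝ (Fin n)
local notation "𝕍" => EuclideanSpace ℝ (Fin m)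

namespace AdaptedCoords

variable {𝒢 : LieGroupoid n m M G} (c : 𝒢.AdaptedCoords) {x₀ : M} {W : Set G}

/-- The trivialization data of `AG` given by adapted coordinates. -/
def trivData : TrivData n m M G where
  φ := c.φ
  ψ := c.ψ
  κ := .snd ℝ 𝕏 𝕍
  hφ := c.φ_mem
  hψ := c.ψ_mem

/-- The tangent vector at `c.φ.symm q` with coordinates `z`. -/
def push (q : 𝔼) : 𝔼 →L[ℝ] 𝔼 := mfderiv 𝓘(ℝ, 𝔼) 𝓘(ℝ, 𝔼) c.φ.symm q

/-- The coordinates of tangent vectors at `k`. -/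
def pull (k : G) : 𝔼 →L[ℝ] 𝔼 := mfderiv 𝓘(ℝ, 𝔼) 𝓘(ℝ, 𝔼) c.φ k

/-- The coordinates of an element of `A_x G`. -/
def coordA (x : M) : 𝒢.A x →L[ℝ] 𝕍 :=
  (ContinuousLinearMap.snd ℝ 𝕏 𝕍).comp ((c.pull (𝒢.ε x)).comp (𝒢.incl x))

variable {c}

lemma hasMFDerivAt_symm {q : 𝔼} (hq : q ∈ c.φ.target) :
    HasMFDerivAt 𝓘(ℝ, 𝔼) 𝓘(ℝ, 𝔼) c.φ.symm q (c.push q) :=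
  (c.trivData.mdiff.symm.mdifferentiableAt hq).hasMFDerivAt

lemma hasMFDerivAt_φ {k : G} (hk : k ∈ c.φ.source) :
    HasMFDerivAt 𝓘(ℝ, 𝔼) 𝓘(ℝ, 𝔼) c.φ k (c.pull k) :=
  (c.trivData.mdiff.mdifferentiableAt hk).hasMFDerivAt

lemma push_pull {k : G} (hk : k ∈ c.φ.source) (v : 𝔼) : c.push (c.φ k) (c.pull k v) = v :=
  DFunLike.congr_fun (c.trivData.mdiff.symm_comp_deriv hk) v

lemma pull_push {k : G} (hk : k ∈ c.φ.source) (v : 𝔼) : c.pull k (c.push (c.φ k) v) = v := by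
  have h := DFunLike.congr_fun (c.trivData.mdiff.comp_symm_deriv (c.φ.map_source hk)) v
  change mfderiv 𝓘(ℝ, 𝔼) 𝓘(ℝ, 𝔼) c.φ (c.φ.symm (c.φ k)) _ = v at h
  rw [c.φ.left_inv hk] at h
  exact h

lemma αLoc_eq {q : 𝔼} (hq : q ∈ c.φ.target) : c.trivData.αLoc 𝒢 q = q.1 := by
  change c.ψ (𝒢.α (c.φ.symm q)) = q.1
  rw [← c.fst_eq _ (c.φ.map_target hq), c.φ.right_inv hq]

lemma fderiv_αLoc {q : 𝔼} (hq : q ∈ c.φ.target) :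
    fderiv ℝ (c.trivData.αLoc 𝒢) q = .fst ℝ 𝕏 𝕍 := by
  have h : c.trivData.αLoc 𝒢 =ᶠ[𝓝 q] Prod.fst := by
    filter_upwards [c.φ.open_target.mem_nhds hq] with r hr
    exact αLoc_eq hr
  rw [h.fderiv_eq]
  exact hasFDerivAt_fst.fderiv

/-- In adapted coordinates `α` is the first projection, and `κ` was chosen to be the second. So the
trivialization is defined at every `x` whose unit lies in the chart, and it reads off the
`u`-component. -/
lemma D_eq {x : M} (hx : 𝒢.ε x ∈ c.φ.source) : c.trivData.D 𝒢 x = 1 := by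
  change (fderiv ℝ (c.trivData.αLoc 𝒢) (c.φ (𝒢.ε x))).prod (.snd ℝ 𝕏 𝕍) = 1
  rw [fderiv_αLoc (c.φ.map_source hx)]
  rfl

lemma mem_base {x : M} (hx : 𝒢.ε x ∈ c.φ.source) : x ∈ c.trivData.base 𝒢 :=
  ⟨c.mem_source_of_ε hx, hx, by rw [D_eq hx]; exact isUnit_one⟩

lemma incl_eq_push {x : M} (hx : 𝒢.ε x ∈ c.φ.source) (v : 𝒢.A x) :
    (𝒢.incl x v : 𝔼) = c.push (c.ψ x, 0) (0, c.coordA x v) := by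
  have h := TrivData.back_apply (mem_base hx) v
  rw [D_eq hx, Ring.inverse_one] at h
  rw [← c.φ_ε hx]
  exact h.symm

lemma incl_triv_symm {x : M} (hx : 𝒢.ε x ∈ c.φ.source) (w : 𝕍) :
    (𝒢.incl x ((c.trivData.triv 𝒢).symm x w) : 𝔼) = c.push (c.φ (𝒢.ε x)) (0, w) := by
  have h := TrivData.triv_symm (mem_base hx) w
  rw [D_eq hx, Ring.inverse_one] at h
  exact h

lemma coordA_triv_symm {x : M} (hx : 𝒢.ε x ∈ c.φ.source) (w : 𝕍) :
    c.coordA x ((c.trivData.triv 𝒢).symm x w) = w := by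
  change (c.pull (𝒢.ε x) (𝒢.incl x _ : 𝔼)).2 = w
  rw [incl_triv_symm hx, pull_push hx]

lemma coordA_surjective {x : M} (hx : 𝒢.ε x ∈ c.φ.source) : Function.Surjective (c.coordA x) :=
  fun w => ⟨_, coordA_triv_symm hx w⟩

lemma dirDeriv_push {f : G → ℝ} {q : 𝔼} (hq : q ∈ c.φ.target)
    (hf : MDifferentiableAt 𝓘(ℝ, 𝔼) 𝓘(ℝ, ℝ) f (c.φ.symm q)) (z : 𝔼) :
    dirDeriv f (c.φ.symm q) (c.push q z) = fderiv ℝ (f ∘ c.φ.symm) q z := by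
  have h := hf.hasMFDerivAt.comp q (hasMFDerivAt_symm hq)
  rw [← mfderiv_eq_fderiv, h.mfderiv]
  rfl

/-- Derivatives within a fibre of `α` are evaluated by composing with such slices: the composite is
an ordinary map on `ℝᵐ`, whose derivative is unique. -/
lemma hasMFDerivAt_slice {x : 𝕏} {u : 𝕍} (hq : (x, u) ∈ c.φ.target) :
    HasMFDerivAt 𝓘(ℝ, 𝕍) 𝓘(ℝ, 𝔼) (fun w => c.φ.symm (x, w)) u
      ((c.push (x, u)).comp (.inr ℝ 𝕏 𝕍)) := by
  have h : HasFDerivAt (fun w : 𝕍 => (x, w)) (ContinuousLinearMap.inr ℝ 𝕏 𝕍) u :=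
    hasFDerivAt_prodMk_right _ _
  exact (hasMFDerivAt_symm hq).comp u h.hasMFDerivAt

lemma hasMFDerivAt_symm_comp {f : 𝕍 → 𝔼} {f' : 𝕍 →L[ℝ] 𝔼} {v : 𝕍} {q : 𝔼} (hv : f v = q)
    (hq : q ∈ c.φ.target) (hf : HasFDerivAt f f' v) :
    HasMFDerivAt 𝓘(ℝ, 𝕍) 𝓘(ℝ, 𝔼) (fun w => c.φ.symm (f w)) v ((c.push q).comp f') := by
  subst hv
  exact (hasMFDerivAt_symm hq).comp v hf.hasMFDerivAt

end AdaptedCoords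

end LieGroupoid

/-- The chain rule for a map differentiable within a set `s`, along a map from a normed space with
values in `s`. -/
theorem MDifferentiableWithinAt.hasMFDerivAt_comp_of_eq
    {F : Type*} [NormedAddCommGroup F] [NormedSpace ℝ F]
    {E' : Type*} [NormedAddCommGroup E'] [NormedSpace ℝ E']
    {M' : Type*} [TopologicalSpace M'] [ChartedSpace E' M']
    {E'' : Type*} [NormedAddCommGroup E''] [NormedSpace ℝ E'']
    {M'' : Type*} [TopologicalSpace M''] [ChartedSpace E'' M'']
    {f : M' → M''} {σ : F → M'} {s : Set M'} {x : F} {k : M'} {σ' : F →L[ℝ] E'}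
    (hf : MDifferentiableWithinAt 𝓘(ℝ, E') 𝓘(ℝ, E'') f s k)
    (hσ : HasMFDerivAt 𝓘(ℝ, F) 𝓘(ℝ, E') σ x σ') (hk : σ x = k) (hs : ∀ᶠ y in 𝓝 x, σ y ∈ s) :
    HasMFDerivAt 𝓘(ℝ, F) 𝓘(ℝ, E'') (f ∘ σ) x
      ((mfderivWithin 𝓘(ℝ, E') 𝓘(ℝ, E'') f s k : E' →L[ℝ] E'').comp σ') := by
  subst hk
  exact hf.hasMFDerivAt_comp_of_eventually_mem hσ hs

/-! ### Invariant vector fields, `𝔽⁻L` and the discrete Euler-Lagrange equations in coordinates. -/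

namespace LieGroupoid

variable {n m : ℕ} {M G : Type*}
  [TopologicalSpace M] [ChartedSpace (EuclideanSpace ℝ (Fin n)) M]
  [TopologicalSpace G] [ChartedSpace (CoordSpace n m) G]

local notation "𝔼" => CoordSpace n m
local notation "𝕏" => EuclideanSpace ℝ (Fin n)
local notation "𝕍" => EuclideanSpace ℝ (Fin m)

lemma mdifferentiableWithinAt_mul_left (𝒢 : LieGroupoid n m M G) {g k : G} (h : 𝒢.β g = 𝒢.α k) :
    MDifferentiableWithinAt 𝓘(ℝ, 𝔼) 𝓘(ℝ, 𝔼) (fun z => 𝒢.mul g z) (𝒢.α ⁻¹' {𝒢.β g}) k :=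
  (𝒢.contMDiffOn_mul_comp contMDiffOn_const contMDiffOn_id (s := 𝒢.α ⁻¹' {𝒢.β g})
    (fun _ hz => hz.symm)).mdifferentiableOn (by simp) k h.symm

lemma mdifferentiableWithinAt_mul_right (𝒢 : LieGroupoid n m M G) {g k : G}
    (h : 𝒢.β k = 𝒢.α g) :
    MDifferentiableWithinAt 𝓘(ℝ, 𝔼) 𝓘(ℝ, 𝔼) (fun z => 𝒢.mul z g) (𝒢.β ⁻¹' {𝒢.α g}) k :=
  (𝒢.contMDiffOn_mul_comp contMDiffOn_id contMDiffOn_const (s := 𝒢.β ⁻¹' {𝒢.α g})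
    (fun _ hz => hz)).mdifferentiableOn (by simp) k h

lemma mdifferentiableWithinAt_inv_mul (𝒢 : LieGroupoid n m M G) {L : G → ℝ}
    (hL : ContMDiff 𝓘(ℝ, 𝔼) 𝓘(ℝ, ℝ) ∞ L) {h k : G} (hk : 𝒢.α k = 𝒢.α h) :
    MDifferentiableWithinAt 𝓘(ℝ, 𝔼) 𝓘(ℝ, ℝ) (fun z => L (𝒢.mul (𝒢.inv z) h))
      (𝒢.α ⁻¹' {𝒢.α h}) k :=
  (hL.comp_contMDiffOn (𝒢.contMDiffOn_mul_comp 𝒢.contMDiff_inv.contMDiffOn contMDiffOn_const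
    (s := 𝒢.α ⁻¹' {𝒢.α h}) (fun z hz => (𝒢.β_inv z).trans hz))).mdifferentiableOn (by simp) k hk

namespace AdaptedCoords

variable {𝒢 : LieGroupoid n m M G} {c : 𝒢.AdaptedCoords} {x₀ : M} {W : Set G}

lemma eventually_α_slice {q : 𝔼} (hq : q ∈ c.φ.target) :
    ∀ᶠ w in 𝓝 q.2, 𝒢.α (c.φ.symm (q.1, w)) = 𝒢.α (c.φ.symm q) := by
  have h : ∀ᶠ w in 𝓝 q.2, (q.1, w) ∈ c.φ.target :=
    (by fun_prop : Continuous fun v : 𝕍 => (q.1, v)).continuousAt.eventually_mem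
      (c.φ.open_target.mem_nhds hq)
  filter_upwards [h] with w hw
  rw [c.α_symm hw, c.α_symm hq]

variable (hW : 𝒢.IsSymmetricNhd c.φ.source x₀ W)
include hW

/-- Along the slice through `ε(β g)`, the translation `l_g` is `leftMul` read in the chart; two
computations of the derivative of the same map on `ℝᵐ` are compared. -/
lemma leftField_eq_push (w : 𝕍) {g : G} (hg : g ∈ W) :
    (𝒢.TLeft g (𝒢.ε (𝒢.β g)) (c.push (c.ψ (𝒢.β g), 0) (0, w) : 𝔼) : 𝔼) =
      c.push (c.φ g) (c.dLeftMul (c.φ g) w) := by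
  have hq := φ_mem_dom hW hg
  have hε := hW.subset (hW.ε_β_mem hg)
  have hk : c.φ.symm (c.ψ (𝒢.β g), (0 : 𝕍)) = 𝒢.ε (𝒢.β g) := c.symm_ε hε
  have ht : (c.ψ (𝒢.β g), (0 : 𝕍)) ∈ c.φ.target := by
    rw [← c.φ_ε hε]; exact c.φ.map_source hε
  have hb : c.b (c.φ g) = c.ψ (𝒢.β g) := by rw [b, c.φ.left_inv (hW.subset hg)]
  have hs : ∀ᶠ v in 𝓝 (0 : 𝕍), c.φ.symm (c.ψ (𝒢.β g), v) ∈ 𝒢.α ⁻¹' {𝒢.β g} := by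
    filter_upwards [eventually_α_slice ht] with v hv
    rw [mem_preimage, hv, hk, 𝒢.α_ε, mem_singleton_iff]
  have h1 := (𝒢.mdifferentiableWithinAt_mul_left (𝒢.α_ε (𝒢.β g)).symm).hasMFDerivAt_comp_of_eq
    (hasMFDerivAt_slice ht) hk hs
  have h2 := hasMFDerivAt_symm_comp (leftMul_zero hW hq) hq.1 (hasFDerivAt_leftMul hW hq)
  have h3 : (fun z => 𝒢.mul g z) ∘ (fun v => c.φ.symm (c.ψ (𝒢.β g), v)) =ᶠ[𝓝 (0 : 𝕍)]
      fun v => c.φ.symm (c.leftMul (c.φ g) v) := by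
    filter_upwards [eventually_mem_dom hW (b_zero_mem_dom hW hq)] with v hv
    rw [symm_leftMul hW hq hv, c.φ.left_inv (hW.subset hg), hb]
    rfl
  exact DFunLike.congr_fun (hasMFDerivAt_unique h1 (h2.congr_of_eventuallyEq h3)) w

lemma hasMFDerivAt_inv_slice {q : 𝔼} (hq : q ∈ c.dom W) :
    HasMFDerivAt 𝓘(ℝ, 𝕍) 𝓘(ℝ, 𝔼) (fun w => 𝒢.inv (c.φ.symm (q.1, w))) 0
      ((mfderiv 𝓘(ℝ, 𝔼) 𝓘(ℝ, 𝔼) 𝒢.inv (𝒢.ε (𝒢.α (c.φ.symm q))) : 𝔼 →L[ℝ] 𝔼).comp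
        ((c.push (q.1, 0)).comp (.inr ℝ 𝕏 𝕍))) := by
  -- Taking `s = univ` lets the chain rule with a propositional base-point equality serve for a full
  -- derivative as well.
  have h := (𝒢.contMDiff_inv.mdifferentiable (by simp)
    (𝒢.ε (𝒢.α (c.φ.symm q)))).mdifferentiableWithinAt (s := univ)
  have h1 := h.hasMFDerivAt_comp_of_eq
    (hasMFDerivAt_slice (zero_mem_dom hW hq).1) (symm_zero hW hq) (by simp)
  simp only [mfderivWithin_univ] at h1
  exact h1

/-- The composite `r_h ∘ i` along the slice through `ε(α h)` is `z ↦ z⁻¹h`, that is, `invMul` in the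
chart. -/
lemma rightField_eq_push (w : 𝕍) {h : G} (hh : h ∈ W) :
    (𝒢.TRight h (𝒢.ε (𝒢.α h)) (mfderiv 𝓘(ℝ, 𝔼) 𝓘(ℝ, 𝔼) 𝒢.inv (𝒢.ε (𝒢.α h))
      (c.push (c.ψ (𝒢.α h), 0) (0, w) : 𝔼) : 𝔼) : 𝔼) =
      c.push (c.φ h) (c.dInvMul (c.φ h) w) := by
  have hq := φ_mem_dom hW hh
  have hφ := c.φ.left_inv (hW.subset hh)
  have hf := c.fst_eq h (hW.subset hh)
  have hk : 𝒢.inv (c.φ.symm ((c.φ h).1, (0 : 𝕍))) = 𝒢.ε (𝒢.α h) := by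
    rw [symm_zero hW hq, hφ, 𝒢.inv_ε]
  have hs : ∀ᶠ v in 𝓝 (0 : 𝕍), 𝒢.inv (c.φ.symm ((c.φ h).1, v)) ∈ 𝒢.β ⁻¹' {𝒢.α h} := by
    filter_upwards [eventually_α_slice (zero_mem_dom hW hq).1] with v hv
    rw [mem_preimage, 𝒢.β_inv, hv, symm_zero hW hq, 𝒢.α_ε, hφ, mem_singleton_iff]
  have h1 := (𝒢.mdifferentiableWithinAt_mul_right (𝒢.β_ε (𝒢.α h))).hasMFDerivAt_comp_of_eq
    (hasMFDerivAt_inv_slice hW hq) hk hs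
  have h2 := hasMFDerivAt_symm_comp (invMul_zero hW hq) hq.1 (hasFDerivAt_invMul hW hq)
  have h3 : (fun z => 𝒢.mul z h) ∘ (fun v => 𝒢.inv (c.φ.symm ((c.φ h).1, v))) =ᶠ[𝓝 (0 : 𝕍)]
      fun v => c.φ.symm (c.invMul (c.φ h) v) := by
    filter_upwards [eventually_mem_dom hW (zero_mem_dom hW hq)] with v hv
    rw [symm_invMul hW hq hv, hφ]
    rfl
  have h4 := DFunLike.congr_fun (hasMFDerivAt_unique h1 (h2.congr_of_eventuallyEq h3)) w
  rw [hφ, hf] at h4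
  exact h4

lemma dirDeriv_push_lag {L : G → ℝ} (hL : ContMDiff 𝓘(ℝ, 𝔼) 𝓘(ℝ, ℝ) ∞ L) {g : G} (hg : g ∈ W)
    (z : 𝔼) : dirDeriv L g (c.push (c.φ g) z) = fderiv ℝ (c.lag L) (c.φ g) z := by
  have h := dirDeriv_push (f := L) (c := c) (φ_mem_dom hW hg).1
    (hL.mdifferentiable (by simp) _) z
  rw [c.φ.left_inv (hW.subset hg)] at h
  exact h

/-- Along the slice through `ε(α h)`, the function `z ↦ L(z⁻¹h)` is `lag L ∘ invMul`. -/
lemma legendreFibre_eq {L : G → ℝ} (hL : ContMDiff 𝓘(ℝ, 𝔼) 𝓘(ℝ, ℝ) ∞ L) {h : G} (hh : h ∈ W)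
    (v : 𝒢.A (𝒢.α h)) :
    𝒢.legendreFibre L h v = c.legMinus L (c.φ h) (c.coordA (𝒢.α h) v) := by
  have hq := φ_mem_dom hW hh
  have hφ := c.φ.left_inv (hW.subset hh)
  have hf := c.fst_eq h (hW.subset hh)
  have hε := hW.subset (hW.ε_α_mem hh)
  have ht : ((c.φ h).1, (0 : 𝕍)) ∈ c.φ.target := (zero_mem_dom hW hq).1
  have hk : c.φ.symm ((c.φ h).1, (0 : 𝕍)) = 𝒢.ε (𝒢.α h) := by rw [symm_zero hW hq, hφ]
  have hs : ∀ᶠ v in 𝓝 (0 : 𝕍), c.φ.symm ((c.φ h).1, v) ∈ 𝒢.α ⁻¹' {𝒢.α h} := by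
    filter_upwards [eventually_α_slice ht] with v hv
    rw [mem_preimage, hv, hk, 𝒢.α_ε, mem_singleton_iff]
  have h1 := (𝒢.mdifferentiableWithinAt_inv_mul hL (𝒢.α_ε (𝒢.α h))).hasMFDerivAt_comp_of_eq
    (hasMFDerivAt_slice ht) hk hs
  have hl : HasFDerivAt (c.lag L) (fderiv ℝ (c.lag L) (c.φ h)) (c.invMul (c.φ h) 0) := by
    rw [invMul_zero hW hq]
    exact ((contDiffAt_lag hW hL hq).differentiableAt (by simp)).hasFDerivAt
  have h2 := (hl.comp (0 : 𝕍) (hasFDerivAt_invMul hW hq)).hasMFDerivAt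
  have h3 : (fun z => L (𝒢.mul (𝒢.inv z) h)) ∘ (fun v => c.φ.symm ((c.φ h).1, v)) =ᶠ[𝓝 (0 : 𝕍)]
      c.lag L ∘ c.invMul (c.φ h) := by
    filter_upwards [eventually_mem_dom hW (zero_mem_dom hW hq)] with v hv
    simp only [Function.comp_apply, lag]
    rw [symm_invMul hW hq hv, hφ]
  have h4 := DFunLike.congr_fun (hasMFDerivAt_unique h1 (h2.congr_of_eventuallyEq h3))
    (c.coordA (𝒢.α h) v)
  have h5 : (𝒢.incl (𝒢.α h) v : 𝔼) = c.push ((c.φ h).1, 0) (0, c.coordA (𝒢.α h) v) := by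
    rw [incl_eq_push hε, hf]
  refine congrArg Neg.neg ?_
  refine Eq.trans ?_ h4
  exact congrArg (mfderivWithin 𝓘(ℝ, 𝔼) 𝓘(ℝ, ℝ)
    (fun k => L (𝒢.mul (𝒢.inv k) h)) (𝒢.α ⁻¹' {𝒢.α h}) (𝒢.ε (𝒢.α h)) : 𝔼 →L[ℝ] ℝ) h5

end AdaptedCoords

variable [IsManifold 𝓘(ℝ, EuclideanSpace ℝ (Fin n)) ∞ M]
  [IsManifold 𝓘(ℝ, CoordSpace n m) ∞ G]

namespace AdaptedCoords

variable {𝒢 : LieGroupoid n m M G} {c : 𝒢.AdaptedCoords} {x₀ : M} {W : Set G}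
  (hW : 𝒢.IsSymmetricNhd c.φ.source x₀ W)
include hW

lemma dirDeriv_leftField {L : G → ℝ} (hL : ContMDiff 𝓘(ℝ, 𝔼) 𝓘(ℝ, ℝ) ∞ L) (X : 𝒢.Sections)
    {g : G} (hg : g ∈ W) :
    dirDeriv L g (𝒢.leftField X g) = c.legPlus L (c.φ g) (c.coordA (𝒢.β g) (X (𝒢.β g))) := by
  have h : 𝒢.leftField X g =
      c.push (c.φ g) (c.dLeftMul (c.φ g) (c.coordA (𝒢.β g) (X (𝒢.β g)))) := by
    rw [← leftField_eq_push hW _ hg, ← incl_eq_push (hW.subset (hW.ε_β_mem hg))]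
    rfl
  rw [h, dirDeriv_push_lag hW hL hg]
  rfl

/-- The sign in the definition of the right-invariant field is exactly the sign in `legMinus`. -/
lemma dirDeriv_rightField {L : G → ℝ} (hL : ContMDiff 𝓘(ℝ, 𝔼) 𝓘(ℝ, ℝ) ∞ L) (X : 𝒢.Sections)
    {h : G} (hh : h ∈ W) :
    dirDeriv L h (𝒢.rightField X h) =
      c.legMinus L (c.φ h) (c.coordA (𝒢.α h) (X (𝒢.α h))) := by
  have e : 𝒢.rightField X h =
      c.push (c.φ h) (-c.dInvMul (c.φ h) (c.coordA (𝒢.α h) (X (𝒢.α h)))) := by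
    rw [map_neg, ← rightField_eq_push hW _ hh, ← incl_eq_push (hW.subset (hW.ε_α_mem hh))]
    rfl
  rw [e, dirDeriv_push_lag hW hL hh, map_neg]
  rfl

/-- The discrete Euler-Lagrange equations in coordinates. -/
lemma isSolution_iff [T2Space M] {L : G → ℝ} (hL : ContMDiff 𝓘(ℝ, 𝔼) 𝓘(ℝ, ℝ) ∞ L) {g h : G}
    (hg : g ∈ W) (hh : h ∈ W) :
    𝒢.IsSolution L g h ↔
      c.b (c.φ g) = (c.φ h).1 ∧ c.legPlus L (c.φ g) = c.legMinus L (c.φ h) := by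
  have hb : c.b (c.φ g) = c.ψ (𝒢.β g) := by rw [b, c.φ.left_inv (hW.subset hg)]
  have hcomp : 𝒢.β g = 𝒢.α h ↔ c.b (c.φ g) = (c.φ h).1 := by
    rw [hb, c.fst_eq h (hW.subset hh)]
    exact (c.ψ.injOn.eq_iff (β_mem hW hg) (c.α_mem _ (hW.subset hh))).symm
  unfold IsSolution
  rw [← hcomp]
  refine and_congr_right fun hgh => ?_
  simp only [dirDeriv_leftField hW hL _ hg, dirDeriv_rightField hW hL _ hh, sub_eq_zero]
  rw [hgh]
  constructor
  · intro H
    ext w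
    -- Every `w` is the coordinate of some fibre vector at `α h`, and that vector is the value of a
    -- global section.
    obtain ⟨v, rfl⟩ := coordA_surjective (hW.subset (hW.ε_α_mem hh)) w
    obtain ⟨X, rfl⟩ := exists_contMDiffSection_apply_eq (I := 𝓘(ℝ, 𝕏)) (F := 𝕍) (V := 𝒢.A)
      (𝒢.α h) v
    exact H X
  · intro H X
    rw [H]

end AdaptedCoords

end LieGroupoid

/-! ### Inverse function theorem and local diffeomorphisms. -/

/-- The inverse function theorem for maps smooth on an open set. -/
theorem exists_openPartialHomeomorph_contDiffOn_symm
    {E : Type*} [NormedAddCommGroup E] [NormedSpace ℝ E] [CompleteSpace E]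
    {F : Type*} [NormedAddCommGroup F] [NormedSpace ℝ F] [CompleteSpace F]
    {f : E → F} {s : Set E} (hs : IsOpen s) (hf : ContDiffOn ℝ ∞ f s) {a : E} (ha : a ∈ s)
    {f' : E ≃L[ℝ] F} (hf' : HasFDerivAt f (f' : E →L[ℝ] F) a) :
    ∃ e : OpenPartialHomeomorph E F, ⇑e = f ∧ a ∈ e.source ∧ e.source ⊆ s ∧
      ContDiffOn ℝ ∞ e.symm e.target := by
  have hfa := hf.contDiffAt (hs.mem_nhds ha)
  let e₀ := hfa.toOpenPartialHomeomorph f hf' (by simp)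
  -- Restricting to the open set where the derivative is invertible makes the inverse smooth on the
  -- whole target, not only at `f a`.
  let t : Set E := s ∩ fderiv ℝ f ⁻¹' range ((↑) : (E ≃L[ℝ] F) → E →L[ℝ] F)
  have ht : IsOpen t := (hf.continuousOn_fderiv_of_isOpen hs (by simp)).isOpen_inter_preimage hs
    ContinuousLinearEquiv.isOpen
  have hat : a ∈ t := ⟨ha, f', hf'.fderiv.symm⟩
  let e := e₀.restrOpen t ht
  have hsrc : e.source = e₀.source ∩ t := e₀.restrOpen_source t ht
  have he : ⇑e = f := rfl
  refine ⟨e, he, ?_, ?_, ?_⟩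
  · rw [hsrc]
    exact ⟨hfa.mem_toOpenPartialHomeomorph_source hf' (by simp), hat⟩
  · rw [hsrc]
    exact inter_subset_right.trans inter_subset_left
  · intro y hy
    have hy' : e.symm y ∈ t := (hsrc ▸ e.map_target hy : _ ∈ e₀.source ∩ t).2
    obtain ⟨hys, g, hg⟩ := hy'
    have hfy := hf.contDiffAt (hs.mem_nhds hys)
    have h1 : HasFDerivAt e (g : E →L[ℝ] F) (e.symm y) := by
      rw [hg, he]
      exact (hfy.differentiableAt (by simp)).hasFDerivAt
    exact (e.contDiffAt_symm hy h1 (he ▸ hfy)).contDiffWithinAt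

section

variable {𝕜 : Type*} [NontriviallyNormedField 𝕜]
  {E : Type*} [NormedAddCommGroup E] [NormedSpace 𝕜 E] {H : Type*} [TopologicalSpace H]
  {I : ModelWithCorners 𝕜 E H} {M : Type*} [TopologicalSpace M] [ChartedSpace H M]
  {E' : Type*} [NormedAddCommGroup E'] [NormedSpace 𝕜 E'] {H' : Type*} [TopologicalSpace H']
  {J : ModelWithCorners 𝕜 E' H'} {N : Type*} [TopologicalSpace N] [ChartedSpace H' N]

theorem IsLocalDiffeomorphAt.congr_of_eventuallyEq {n : ℕ∞ω} {f g : M → N} {x : M}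
    (hf : IsLocalDiffeomorphAt I J n f x) (h : g =ᶠ[𝓝 x] f) :
    IsLocalDiffeomorphAt I J n g x := by
  obtain ⟨Φ, hx, hΦ⟩ := hf
  obtain ⟨u, hu, huo, hxu⟩ := mem_nhds_iff.1 h
  let e := Φ.toOpenPartialHomeomorph.restrOpen u huo
  have hsrc : e.source = Φ.source ∩ u := Φ.toOpenPartialHomeomorph.restrOpen_source u huo
  have htgt : e.target ⊆ Φ.target := fun y hy => by
    have h1 := e.map_target hy
    rw [hsrc] at h1
    have h2 := Φ.map_source h1.1
    have h3 : Φ (e.symm y) = y := e.right_inv hy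
    exact h3 ▸ h2
  refine ⟨{ toPartialEquiv := e.toPartialEquiv
            open_source := e.open_source
            open_target := e.open_target
            contMDiffOn_toFun := Φ.contMDiffOn_toFun.mono (hsrc ▸ inter_subset_left)
            contMDiffOn_invFun := Φ.contMDiffOn_invFun.mono htgt }, ?_, ?_⟩
  · change x ∈ e.source
    rw [hsrc]
    exact ⟨hx, hxu⟩
  · intro y hy
    change y ∈ e.source at hy
    rw [hsrc] at hy
    exact (hu hy.2).trans (hΦ hy.1)

theorem OpenPartialHomeomorph.isLocalDiffeomorphAt {n : ℕ∞ω} (e : OpenPartialHomeomorph M N)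
    (h : ContMDiffOn I J n e e.source) (h' : ContMDiffOn J I n e.symm e.target) {x : M}
    (hx : x ∈ e.source) : IsLocalDiffeomorphAt I J n e x :=
  ⟨{ toPartialEquiv := e.toPartialEquiv
     open_source := e.open_source
     open_target := e.open_target
     contMDiffOn_toFun := h
     contMDiffOn_invFun := h' }, hx, fun _ _ => rfl⟩

end

/-! ### Regularity of `𝔽L` and evolution operators. -/

namespace LieGroupoid

variable {n m : ℕ} {M G : Type*}
  [TopologicalSpace M] [ChartedSpace (EuclideanSpace ℝ (Fin n)) M]
  [TopologicalSpace G] [ChartedSpace (CoordSpace n m) G]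

local notation "𝔼" => CoordSpace n m
local notation "𝕏" => EuclideanSpace ℝ (Fin n)
local notation "𝕍" => EuclideanSpace ℝ (Fin m)

namespace AdaptedCoords

variable {𝒢 : LieGroupoid n m M G} {c : 𝒢.AdaptedCoords} {x₀ : M} {W : Set G}

variable (c) in
/-- The discrete Legendre transformation `𝔽⁻L` in coordinates. -/
def legendreC (L : G → ℝ) (q : 𝔼) : 𝕏 × (𝕍 →L[ℝ] ℝ) := (q.1, c.legMinus L q)

variable (hW : 𝒢.IsSymmetricNhd c.φ.source x₀ W)
include hW

lemma fderiv_legMinus_apply {L : G → ℝ} (hL : ContMDiff 𝓘(ℝ, 𝔼) 𝓘(ℝ, ℝ) ∞ L) {q : 𝔼}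
    (hq : q ∈ c.dom W) (w a : 𝕍) :
    fderiv ℝ (c.legMinus L) q (0, w) a = -(w.ofLp ⬝ᵥ Matrix.mulVec (c.FL L q) a.ofLp) := by
  have hsum (v : 𝕍) : v = ∑ i, v i • EuclideanSpace.single i (1 : ℝ) := by
    ext j
    simp [Finset.sum_apply, Pi.single_apply]
  have h1 : fderiv ℝ (c.legMinus L) q (0, w) =
      ∑ γ, w γ • fderiv ℝ (c.legMinus L) q (0, EuclideanSpace.single γ 1) := by
    change fderiv ℝ (c.legMinus L) q (ContinuousLinearMap.inr ℝ 𝕏 𝕍 w) = _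
    conv_lhs => rw [hsum w]
    simp only [map_sum, map_smul]
    rfl
  rw [h1]
  conv_lhs => rw [hsum a]
  simp only [sum_apply, smul_apply, map_sum, map_smul,
    fderiv_legMinus_single hW hL hq, dotProduct, Matrix.mulVec, smul_eq_mul, mul_neg,
    Finset.sum_neg_distrib, Finset.mul_sum]
  rw [Finset.sum_comm]
  refine congrArg Neg.neg (Finset.sum_congr rfl fun γ _ => Finset.sum_congr rfl fun μ _ => ?_)
  ring

/-- The direction `w` of differentiation multiplies `𝔽L` from the left, so this is triviality of the
left kernel of a square matrix. -/
lemma isUnit_FL_iff {L : G → ℝ} (hL : ContMDiff 𝓘(ℝ, 𝔼) 𝓘(ℝ, ℝ) ∞ L) {q : 𝔼}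
    (hq : q ∈ c.dom W) :
    IsUnit (c.FL L q) ↔ ∀ w : 𝕍, fderiv ℝ (c.legMinus L) q (0, w) = 0 → w = 0 := by
  rw [← Matrix.vecMul_injective_iff_isUnit]
  have key (w : 𝕍) : fderiv ℝ (c.legMinus L) q (0, w) = 0 ↔
      Matrix.vecMul w.ofLp (c.FL L q) = 0 := by
    constructor
    · intro h
      refine dotProduct_eq_zero _ fun a => ?_
      have h1 := fderiv_legMinus_apply hW hL hq w (WithLp.toLp 2 a)
      rw [h, Matrix.dotProduct_mulVec] at h1
      simpa using h1.symm
    · intro h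
      ext a
      rw [fderiv_legMinus_apply hW hL hq, Matrix.dotProduct_mulVec, h]
      simp
  constructor
  · intro h w hw
    have h1 : w.ofLp = 0 := h (((key w).1 hw).trans (Matrix.zero_vecMul _).symm)
    ext i
    exact congrFun h1 i
  · intro h u v huv
    have h1 : WithLp.toLp 2 (u - v) = (0 : 𝕍) := by
      refine h _ ((key _).2 ?_)
      simp only at huv
      simp [Matrix.sub_vecMul, huv]
    have h2 := congrArg WithLp.ofLp h1
    exact sub_eq_zero.1 h2

/-- The counterpart for the right kernel. Nondegeneracy of the Poincaré-Cartan section uses both. -/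
lemma eq_zero_of_isUnit_FL {L : G → ℝ} (hL : ContMDiff 𝓘(ℝ, 𝔼) 𝓘(ℝ, ℝ) ∞ L) {q : 𝔼}
    (hq : q ∈ c.dom W) (hu : IsUnit (c.FL L q)) {a : 𝕍}
    (ha : ∀ w : 𝕍, fderiv ℝ (c.legMinus L) q (0, w) a = 0) : a = 0 := by
  have h1 : Matrix.mulVec (c.FL L q) a.ofLp = 0 := by
    refine dotProduct_eq_zero _ fun w => ?_
    have h := ha (WithLp.toLp 2 w)
    rw [fderiv_legMinus_apply hW hL hq, neg_eq_zero] at h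
    rw [dotProduct_comm]
    exact h
  have h2 : a.ofLp = 0 :=
    (Matrix.mulVec_injective_iff_isUnit.2 hu) (h1.trans (Matrix.mulVec_zero _).symm)
  ext i
  exact congrFun h2 i

lemma contDiffOn_legendreC {L : G → ℝ} (hL : ContMDiff 𝓘(ℝ, 𝔼) 𝓘(ℝ, ℝ) ∞ L) :
    ContDiffOn ℝ ∞ (c.legendreC L) (c.dom W) := fun _ hq =>
  (contDiffAt_fst.prodMk (contDiffAt_legMinus hW hL hq)).contDiffWithinAt

lemma hasFDerivAt_legendreC {L : G → ℝ} (hL : ContMDiff 𝓘(ℝ, 𝔼) 𝓘(ℝ, ℝ) ∞ L) {q : 𝔼}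
    (hq : q ∈ c.dom W) :
    HasFDerivAt (c.legendreC L) ((ContinuousLinearMap.fst ℝ 𝕏 𝕍).prod
      (fderiv ℝ (c.legMinus L) q)) q :=
  hasFDerivAt_fst.prodMk ((contDiffAt_legMinus hW hL hq).differentiableAt (by simp)).hasFDerivAt

/-- The derivative is block triangular with the identity in the `x`-block, hence injective if and
only if its `u`-block is; source and target both have dimension `n + m`. -/
lemma isUnit_FL_iff_exists_equiv {L : G → ℝ} (hL : ContMDiff 𝓘(ℝ, 𝔼) 𝓘(ℝ, ℝ) ∞ L) {q : 𝔼}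
    (hq : q ∈ c.dom W) :
    IsUnit (c.FL L q) ↔ ∃ f' : 𝔼 ≃L[ℝ] 𝕏 × (𝕍 →L[ℝ] ℝ),
      HasFDerivAt (c.legendreC L) (f' : 𝔼 →L[ℝ] 𝕏 × (𝕍 →L[ℝ] ℝ)) q := by
  have hd := hasFDerivAt_legendreC hW hL hq
  rw [isUnit_FL_iff hW hL hq]
  constructor
  · intro h
    set T := (ContinuousLinearMap.fst ℝ 𝕏 𝕍).prod (fderiv ℝ (c.legMinus L) q) with hT
    have hinj : Function.Injective (T : 𝔼 →ₗ[ℝ] 𝕏 × (𝕍 →L[ℝ] ℝ)) := by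
      rw [injective_iff_map_eq_zero]
      rintro ⟨x, w⟩ hz
      have h1 : x = 0 := congrArg Prod.fst hz
      subst h1
      have h2 : fderiv ℝ (c.legMinus L) q (0, w) = 0 := congrArg Prod.snd hz
      rw [h w h2]
      rfl
    have hfin : Module.finrank ℝ 𝔼 = Module.finrank ℝ (𝕏 × (𝕍 →L[ℝ] ℝ)) := by
      have : Module.finrank ℝ (𝕍 →L[ℝ] ℝ) = m := by
        rw [← (LinearMap.toContinuousLinearMap : (𝕍 →ₗ[ℝ] ℝ) ≃ₗ[ℝ] 𝕍 →L[ℝ] ℝ).finrank_eq,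
          Module.finrank_linearMap]
        simp
      rw [Module.finrank_prod, Module.finrank_prod, this]
      simp
    exact ⟨(LinearEquiv.ofInjectiveOfFinrankEq (T : 𝔼 →ₗ[ℝ] 𝕏 × (𝕍 →L[ℝ] ℝ)) hinj
      hfin).toContinuousLinearEquiv, hd⟩
  · rintro ⟨f', hf'⟩ w hw
    have h1 : f' (0, w) = 0 := by
      have h2 := DFunLike.congr_fun (hf'.unique hd) ((0 : 𝕏), w)
      exact h2.trans (Prod.ext rfl hw)
    exact congrArg Prod.snd ((map_eq_zero_iff f' f'.injective).1 h1)

end AdaptedCoords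

variable [IsManifold 𝓘(ℝ, EuclideanSpace ℝ (Fin n)) ∞ M]
  [IsManifold 𝓘(ℝ, CoordSpace n m) ∞ G]

namespace AdaptedCoords

variable {𝒢 : LieGroupoid n m M G} {c : 𝒢.AdaptedCoords} {x₀ : M} {W : Set G}
  (hW : 𝒢.IsSymmetricNhd c.φ.source x₀ W)
include hW

/-- Existence of local discrete Euler-Lagrange evolution operators. -/
theorem exists_evolutionOperator [T2Space M] {L : G → ℝ}
    (hL : ContMDiff 𝓘(ℝ, 𝔼) 𝓘(ℝ, ℝ) ∞ L) {g₀ h₀ : G} (hg₀ : g₀ ∈ W) (hh₀ : h₀ ∈ W)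
    (hsol : 𝒢.IsSolution L g₀ h₀) (hu : IsUnit (c.FL L (c.φ h₀))) :
    ∃ (X₀ Y₀ : Set G) (Ψ : G → G),
        IsOpen X₀ ∧ X₀ ⊆ W ∧ g₀ ∈ X₀ ∧ IsOpen Y₀ ∧ Y₀ ⊆ W ∧ h₀ ∈ Y₀ ∧
        (∀ g ∈ X₀, ∀ h ∈ Y₀, 𝒢.IsSolution L g h ↔ h = Ψ g) ∧
        𝒢.IsLocalEvolutionOperator L X₀ Y₀ Ψ := by
  have hq₀ := φ_mem_dom hW hh₀
  obtain ⟨f', hf'⟩ := (isUnit_FL_iff_exists_equiv hW hL hq₀).1 hu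
  obtain ⟨e, he, hqe, hes, hesymm⟩ := exists_openPartialHomeomorph_contDiffOn_symm
    (isOpen_dom hW) (contDiffOn_legendreC hW hL) hq₀ hf'
  -- The coordinate form of `𝔽⁺L`. Solutions are the pairs with `𝔽⁺L(g) = 𝔽⁻L(h)`, so inverting
  -- `𝔽⁻L` near `h₀` yields `h` in terms of `g`.
  let η : 𝔼 → 𝕏 × (𝕍 →L[ℝ] ℝ) := fun q => (c.b q, c.legPlus L q)
  have hη : ContDiffOn ℝ ∞ η (c.dom W) := fun q hq =>
    ((contDiffAt_b hW hq).prodMk (contDiffAt_legPlus hW hL hq)).contDiffWithinAt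
  have hsolη {g h : G} (hg : g ∈ W) (hh : h ∈ W) :
      𝒢.IsSolution L g h ↔ η (c.φ g) = e (c.φ h) := by
    rw [isSolution_iff hW hL hg hh, he]
    exact (Prod.ext_iff (x := η (c.φ g)) (y := c.legendreC L (c.φ h))).symm
  let X₀ : Set G := W ∩ (fun g => η (c.φ g)) ⁻¹' e.target
  -- Injectivity of `e` on its source gives uniqueness in `Y₀`; `X₀` collects the `g` for which a
  -- preimage under `e` exists.
  let Y₀ : Set G := c.φ.source ∩ c.φ ⁻¹' e.source
  let Ψ : G → G := fun g => c.φ.symm (e.symm (η (c.φ g)))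
  have hφW : ContMDiffOn 𝓘(ℝ, 𝔼) 𝓘(ℝ, 𝔼) ∞ c.φ W := c.contMDiffOn_φ.mono hW.subset
  have hηφ : ContMDiffOn 𝓘(ℝ, 𝔼) 𝓘(ℝ, 𝕏 × (𝕍 →L[ℝ] ℝ)) ∞ (fun g => η (c.φ g)) W :=
    (contMDiffOn_iff_contDiffOn.2 hη).comp hφW (fun g hg => φ_mem_dom hW hg)
  have hY₀ : Y₀ ⊆ W := by
    rintro h ⟨h1, h2⟩
    have h3 := (hes h2).2
    rwa [mem_preimage, c.φ.left_inv h1] at h3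
  have hΨ : MapsTo Ψ X₀ Y₀ := by
    rintro g ⟨hg, hge⟩
    have h1 := e.map_target hge
    have h2 := (hes h1).1
    refine ⟨c.φ.map_target h2, ?_⟩
    rw [mem_preimage, c.φ.right_inv h2]
    exact h1
  have hiff : ∀ g ∈ X₀, ∀ h ∈ Y₀, 𝒢.IsSolution L g h ↔ h = Ψ g := by
    rintro g ⟨hg, hge⟩ h hh
    rw [hsolη hg (hY₀ hh)]
    constructor
    · intro H
      change h = c.φ.symm (e.symm (η (c.φ g)))
      rw [H, e.left_inv hh.2, c.φ.left_inv hh.1]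
    · rintro rfl
      have h1 := (hes (e.map_target hge)).1
      change η (c.φ g) = e (c.φ (c.φ.symm (e.symm (η (c.φ g)))))
      rw [c.φ.right_inv h1, e.right_inv hge]
  refine ⟨X₀, Y₀, Ψ, hηφ.continuousOn.isOpen_inter_preimage hW.isOpen e.open_target,
    inter_subset_left, ⟨hg₀, ?_⟩, c.φ.isOpen_inter_preimage e.open_source, hY₀,
    ⟨hW.subset hh₀, hqe⟩, hiff, hΨ, ?_, fun g hg => (hiff g hg _ (hΨ hg)).2 rfl⟩
  · change η (c.φ g₀) ∈ e.target
    rw [(hsolη hg₀ hh₀).1 hsol]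
    exact e.map_source hqe
  · refine c.contMDiffOn_φ_symm.comp ((contMDiffOn_iff_contDiffOn.2 hesymm).comp
      (hηφ.mono inter_subset_left) (fun g hg => hg.2)) (fun g hg => ?_)
    exact (hes (e.map_target hg.2)).1

end AdaptedCoords

end LieGroupoid

/-! ### Charts of `A*G` and the Legendre transformation as a local diffeomorphism. -/

namespace LieGroupoid

variable {n m : ℕ} {M G : Type*}
  [TopologicalSpace M] [ChartedSpace (EuclideanSpace ℝ (Fin n)) M]
  [TopologicalSpace G] [ChartedSpace (CoordSpace n m) G]
  [IsManifold 𝓘(ℝ, EuclideanSpace ℝ (Fin n)) ∞ M]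
  [IsManifold 𝓘(ℝ, CoordSpace n m) ∞ G]

local notation "𝔼" => CoordSpace n m
local notation "𝕏" => EuclideanSpace ℝ (Fin n)
local notation "𝕍" => EuclideanSpace ℝ (Fin m)

namespace AdaptedCoords

variable {𝒢 : LieGroupoid n m M G} (c : 𝒢.AdaptedCoords) {x₀ : M} {W : Set G}

/-- The trivialization of `AG` given by adapted coordinates. -/
def trivA : Trivialization 𝕍 (π 𝕍 𝒢.A) :=
  𝒢.prebundle.trivializationOfMemPretrivializationAtlas (mem_range_self c.trivData)

instance : MemTrivializationAtlas c.trivA :=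
  ⟨⟨_, mem_range_self c.trivData, rfl⟩⟩

instance memTrivializationAtlas_trivial :
    MemTrivializationAtlas (Bundle.Trivial.trivialization M ℝ) := ⟨rfl⟩

/-- The trivialization of `A*G` given by adapted coordinates. -/
def trivDual : Trivialization (𝕍 →L[ℝ] ℝ)
    (π (𝕍 →L[ℝ] ℝ) (fun x : M => 𝒢.A x →L[ℝ] Bundle.Trivial M ℝ x)) :=
  c.trivA.continuousLinearMap (RingHom.id ℝ) (Bundle.Trivial.trivialization M ℝ)

instance : MemTrivializationAtlas c.trivDual :=
  inferInstanceAs (MemTrivializationAtlas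
    (c.trivA.continuousLinearMap (RingHom.id ℝ) (Bundle.Trivial.trivialization M ℝ)))

variable {c}

lemma mem_trivDual_baseSet {x : M} (hx : 𝒢.ε x ∈ c.φ.source) : x ∈ c.trivDual.baseSet :=
  ⟨mem_base hx, mem_univ x⟩

/-- The dual trivialization composes a functional with the inverse of the trivialization of `AG`,
and `coordA` is that trivialization on fibres. -/
lemma trivDual_apply {x : M} (hx : 𝒢.ε x ∈ c.φ.source) (ℓ : 𝒢.A x →L[ℝ] ℝ) (ℓ' : 𝕍 →L[ℝ] ℝ)
    (h : ∀ v, ℓ v = ℓ' (c.coordA x v)) :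
    c.trivDual ⟨x, ℓ⟩ = (x, ℓ') := by
  refine Prod.ext rfl ?_
  ext w
  change (Bundle.Trivial.trivialization M ℝ).continuousLinearMapAt ℝ x
    (ℓ (c.trivA.symmL ℝ x w)) = ℓ' w
  rw [Bundle.Trivial.continuousLinearMapAt_trivialization, c.trivA.symmL_apply (mem_base hx)]
  change ℓ (c.trivA.symm x w) = ℓ' w
  rw [h]
  congr 1
  have h1 := c.trivA.apply_mk_symm (b := x) (mem_base hx) w
  exact congrArg Prod.snd h1

section

variable (c) in
/-- The coordinates of `A*G`. -/
def dualCoords : OpenPartialHomeomorph 𝒢.DualTotal (𝕏 × (𝕍 →L[ℝ] ℝ)) :=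
  c.trivDual.toOpenPartialHomeomorph.trans (c.ψ.prod (.refl _))

lemma dualCoords_source_mem {p : 𝒢.DualTotal} (hp : 𝒢.ε p.1 ∈ c.φ.source) :
    p ∈ c.dualCoords.source := by
  have h1 : p ∈ c.trivDual.source := c.trivDual.mem_source.2 (mem_trivDual_baseSet hp)
  refine ⟨h1, ?_, mem_univ _⟩
  change (c.trivDual p).1 ∈ c.ψ.source
  rw [c.trivDual.coe_fst h1]
  exact c.mem_source_of_ε hp

lemma contMDiffOn_dualCoords :
    ContMDiffOn (𝓘(ℝ, 𝕏).prod 𝓘(ℝ, 𝕍 →L[ℝ] ℝ)) (𝓘(ℝ, 𝕏).prod 𝓘(ℝ, 𝕍 →L[ℝ] ℝ)) ∞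
      c.dualCoords c.dualCoords.source := by
  have h1 : ContMDiffOn (𝓘(ℝ, 𝕏).prod 𝓘(ℝ, 𝕍 →L[ℝ] ℝ)) (𝓘(ℝ, 𝕏).prod 𝓘(ℝ, 𝕍 →L[ℝ] ℝ)) ∞
      c.trivDual c.trivDual.source := c.trivDual.contMDiffOn
  have h2 : ContMDiffOn (𝓘(ℝ, 𝕏).prod 𝓘(ℝ, 𝕍 →L[ℝ] ℝ)) (𝓘(ℝ, 𝕏).prod 𝓘(ℝ, 𝕍 →L[ℝ] ℝ)) ∞
      (Prod.map c.ψ (id : (𝕍 →L[ℝ] ℝ) → 𝕍 →L[ℝ] ℝ)) (c.ψ.source ×ˢ univ) :=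
    (contMDiffOn_of_mem_maximalAtlas c.ψ_mem).prodMap contMDiff_id.contMDiffOn
  exact h2.comp (h1.mono inter_subset_left) inter_subset_right

lemma contMDiffOn_dualCoords_symm :
    ContMDiffOn (𝓘(ℝ, 𝕏).prod 𝓘(ℝ, 𝕍 →L[ℝ] ℝ)) (𝓘(ℝ, 𝕏).prod 𝓘(ℝ, 𝕍 →L[ℝ] ℝ)) ∞
      c.dualCoords.symm c.dualCoords.target := by
  have h1 : ContMDiffOn (𝓘(ℝ, 𝕏).prod 𝓘(ℝ, 𝕍 →L[ℝ] ℝ)) (𝓘(ℝ, 𝕏).prod 𝓘(ℝ, 𝕍 →L[ℝ] ℝ)) ∞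
      c.trivDual.toOpenPartialHomeomorph.symm c.trivDual.target := c.trivDual.contMDiffOn_symm
  have h2 : ContMDiffOn (𝓘(ℝ, 𝕏).prod 𝓘(ℝ, 𝕍 →L[ℝ] ℝ)) (𝓘(ℝ, 𝕏).prod 𝓘(ℝ, 𝕍 →L[ℝ] ℝ)) ∞
      (Prod.map c.ψ.symm (id : (𝕍 →L[ℝ] ℝ) → 𝕍 →L[ℝ] ℝ)) (c.ψ.target ×ˢ univ) :=
    (contMDiffOn_symm_of_mem_maximalAtlas c.ψ_mem).prodMap contMDiff_id.contMDiffOn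
  exact h1.comp (h2.mono inter_subset_left) inter_subset_right

end

variable (hW : 𝒢.IsSymmetricNhd c.φ.source x₀ W)
include hW

lemma dualCoords_legendreMinus {L : G → ℝ} (hL : ContMDiff 𝓘(ℝ, 𝔼) 𝓘(ℝ, ℝ) ∞ L) {h : G}
    (hh : h ∈ W) : c.dualCoords (𝒢.legendreMinus L h) = c.legendreC L (c.φ h) := by
  have h1 : c.trivDual (𝒢.legendreMinus L h) = (𝒢.α h, c.legMinus L (c.φ h)) :=
    trivDual_apply (hW.subset (hW.ε_α_mem hh)) _ _ (legendreFibre_eq hW hL hh)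
  change Prod.map c.ψ id (c.trivDual (𝒢.legendreMinus L h)) = _
  rw [h1, legendreC, c.fst_eq h (hW.subset hh)]
  rfl

lemma legendreMinus_mem {L : G → ℝ} {h : G} (hh : h ∈ W) :
    𝒢.legendreMinus L h ∈ c.dualCoords.source :=
  dualCoords_source_mem (hW.subset (hW.ε_α_mem hh))

/-- Compose on both sides with the charts of `G` and `A*G`, which are themselves local
diffeomorphisms. -/
lemma legendreIsLocalDiffeoAt_iff {L : G → ℝ} (hL : ContMDiff 𝓘(ℝ, 𝔼) 𝓘(ℝ, ℝ) ∞ L) {h : G}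
    (hh : h ∈ W) : 𝒢.LegendreIsLocalDiffeoAt L h ↔
      IsLocalDiffeomorphAt 𝓘(ℝ, 𝔼) (𝓘(ℝ, 𝕏).prod 𝓘(ℝ, 𝕍 →L[ℝ] ℝ)) ∞ (c.legendreC L)
        (c.φ h) := by
  have hs := hW.subset hh
  have hq := φ_mem_dom hW hh
  constructor
  · intro H
    have h1 : IsLocalDiffeomorphAt 𝓘(ℝ, 𝔼) 𝓘(ℝ, 𝔼) ∞ c.φ.symm (c.φ h) :=
      c.φ.symm.isLocalDiffeomorphAt c.contMDiffOn_φ_symm c.contMDiffOn_φ hq.1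
    have h2 := c.dualCoords.isLocalDiffeomorphAt contMDiffOn_dualCoords
      contMDiffOn_dualCoords_symm (legendreMinus_mem hW (L := L) hh)
    rw [LegendreIsLocalDiffeoAt, ← c.φ.left_inv hs] at H
    rw [← c.φ.left_inv hs] at h2
    refine ((h1.comp _ _ H).comp _ _ h2).congr_of_eventuallyEq ?_
    filter_upwards [(isOpen_dom hW).mem_nhds hq] with q hq
    have h3 := dualCoords_legendreMinus hW hL hq.2
    rw [c.φ.right_inv hq.1] at h3
    exact h3.symm
  · intro H
    have h1 : IsLocalDiffeomorphAt 𝓘(ℝ, 𝔼) 𝓘(ℝ, 𝔼) ∞ c.φ h :=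
      c.φ.isLocalDiffeomorphAt c.contMDiffOn_φ c.contMDiffOn_φ_symm hs
    have h2 := c.dualCoords.symm.isLocalDiffeomorphAt contMDiffOn_dualCoords_symm
      contMDiffOn_dualCoords (c.dualCoords.map_source (legendreMinus_mem hW (L := L) hh))
    rw [dualCoords_legendreMinus hW hL hh] at h2
    refine ((h1.comp _ _ H).comp _ _ h2).congr_of_eventuallyEq ?_
    filter_upwards [hW.isOpen.mem_nhds hh] with k hk
    change _ = c.dualCoords.symm (c.legendreC L (c.φ k))
    rw [← dualCoords_legendreMinus hW hL hk, c.dualCoords.left_inv (legendreMinus_mem hW hk)]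

theorem isUnit_FL_iff_legendreIsLocalDiffeoAt {L : G → ℝ}
    (hL : ContMDiff 𝓘(ℝ, 𝔼) 𝓘(ℝ, ℝ) ∞ L) {h : G} (hh : h ∈ W) :
    IsUnit (c.FL L (c.φ h)) ↔ 𝒢.LegendreIsLocalDiffeoAt L h := by
  have hq := φ_mem_dom hW hh
  rw [legendreIsLocalDiffeoAt_iff hW hL hh, isUnit_FL_iff_exists_equiv hW hL hq]
  have hd := hasFDerivAt_legendreC hW hL hq
  constructor
  · rintro ⟨f', hf'⟩
    obtain ⟨e, he, hqe, hes, hesymm⟩ := exists_openPartialHomeomorph_contDiffOn_symm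
      (isOpen_dom hW) (contDiffOn_legendreC hW hL) hq hf'
    have h1 := contMDiffOn_iff_contDiffOn.2 ((contDiffOn_legendreC hW hL).mono hes)
    have h2 := contMDiffOn_iff_contDiffOn.2 hesymm
    -- The smoothness facts use the model of the product vector space, while `A*G` is modelled on a
    -- product of models; the two are identified here.
    rw [modelWithCornersSelf_prod (E := 𝕏) (F := 𝕍 →L[ℝ] ℝ),
      ← chartedSpaceSelf_prod (H := 𝕏) (H' := 𝕍 →L[ℝ] ℝ)] at h1 h2
    rw [← he] at h1 ⊢
    refine OpenPartialHomeomorph.isLocalDiffeomorphAt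
      (J := 𝓘(ℝ, 𝕏).prod 𝓘(ℝ, 𝕍 →L[ℝ] ℝ)) e ?_ ?_ hqe
    exacts [h1, h2]
  · intro H
    let f' : 𝔼 ≃L[ℝ] 𝕏 × (𝕍 →L[ℝ] ℝ) := H.mfderivToContinuousLinearEquiv (by simp)
    refine ⟨f', ?_⟩
    have h1 := (H.mdifferentiableAt (by simp)).hasMFDerivAt
    have h2 : HasMFDerivAt 𝓘(ℝ, 𝔼) (𝓘(ℝ, 𝕏).prod 𝓘(ℝ, 𝕍 →L[ℝ] ℝ)) (c.legendreC L) (c.φ h)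
        ((ContinuousLinearMap.fst ℝ 𝕏 𝕍).prod (fderiv ℝ (c.legMinus L) (c.φ h))) :=
      hasFDerivAt_fst.hasMFDerivAt.prodMk
        ((contDiffAt_legMinus hW hL hq).differentiableAt (by simp)).hasFDerivAt.hasMFDerivAt
    have h3 : (f' : 𝔼 →L[ℝ] 𝕏 × (𝕍 →L[ℝ] ℝ)) =
        (ContinuousLinearMap.fst ℝ 𝕏 𝕍).prod (fderiv ℝ (c.legMinus L) (c.φ h)) :=
      hasMFDerivAt_unique h1 h2
    rw [h3]
    exact hd

end AdaptedCoords

end LieGroupoid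

theorem VectorField.mlieBracket_eq_lieBracket_of_normedSpace {E : Type*} [NormedAddCommGroup E]
    [NormedSpace ℝ E] (V W : ∀ x : E, TangentSpace 𝓘(ℝ, E) x) (x : E) :
    mlieBracket 𝓘(ℝ, E) V W x = lieBracket ℝ V W x := by
  rw [← mlieBracketWithin_univ, mlieBracketWithin_eq_lieBracketWithin]
  exact congrFun (lieBracketWithin_univ (𝕜 := ℝ) (V := V) (W := W)) x

/-! ### Vector fields and their brackets in coordinates. -/

namespace LieGroupoid

variable {n m : ℕ} {M G : Type*}
  [TopologicalSpace M] [ChartedSpace (EuclideanSpace ℝ (Fin n)) M]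
  [TopologicalSpace G] [ChartedSpace (CoordSpace n m) G]

local notation "𝔼" => CoordSpace n m
local notation "𝕏" => EuclideanSpace ℝ (Fin n)
local notation "𝕍" => EuclideanSpace ℝ (Fin m)

/-- The commutator of two vector fields acts on functions by the commutator of derivatives. -/
lemma fderiv_lieBracket {f : 𝔼 → ℝ} {V V' : 𝔼 → 𝔼} {q : 𝔼} (hf : ContDiffAt ℝ ∞ f q)
    (hV : DifferentiableAt ℝ V q) (hV' : DifferentiableAt ℝ V' q) :
    fderiv ℝ f q (VectorField.lieBracket ℝ V V' q) =
      fderiv ℝ (fun r => fderiv ℝ f r (V' r)) q (V q) -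
        fderiv ℝ (fun r => fderiv ℝ f r (V r)) q (V' q) := by
  have hd : DifferentiableAt ℝ (fderiv ℝ f) q :=
    (hf.fderiv_right (m := ∞) (by simp)).differentiableAt (by simp)
  rw [fderiv_clm_apply hd hV', fderiv_clm_apply hd hV]
  have h := (hf.isSymmSndFDerivAt (by simpa using ENat.LEInfty.out)).eq (V q) (V' q)
  simp [VectorField.lieBracket, h]

namespace AdaptedCoords

variable {𝒢 : LieGroupoid n m M G} {c : 𝒢.AdaptedCoords} {x₀ : M} {W : Set G}

lemma dirDeriv_push_of_eventuallyEq {f : G → ℝ} {F : 𝔼 → ℝ} {q : 𝔼} (hq : q ∈ c.φ.target)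
    (hF : DifferentiableAt ℝ F q) (hf : f =ᶠ[𝓝 (c.φ.symm q)] F ∘ c.φ) (z : 𝔼) :
    dirDeriv f (c.φ.symm q) (c.push q z) = fderiv ℝ F q z := by
  have hF' : MDifferentiableAt 𝓘(ℝ, 𝔼) 𝓘(ℝ, ℝ) F (c.φ (c.φ.symm q)) := by
    rw [c.φ.right_inv hq]; exact hF.mdifferentiableAt
  have hm : MDifferentiableAt 𝓘(ℝ, 𝔼) 𝓘(ℝ, ℝ) (F ∘ c.φ) (c.φ.symm q) :=
    hF'.comp _ (hasMFDerivAt_φ (c.φ.map_target hq)).mdifferentiableAt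
  rw [dirDeriv_push hq (hm.congr_of_eventuallyEq hf)]
  have h : f ∘ c.φ.symm =ᶠ[𝓝 q] F := by
    filter_upwards [(c.φ.continuousAt_symm hq).eventually hf,
      c.φ.open_target.mem_nhds hq] with r hr hrt
    rw [Function.comp_apply, hr, Function.comp_apply, c.φ.right_inv hrt]
  rw [h.fderiv_eq]

lemma push_pull_symm {q : 𝔼} (hq : q ∈ c.φ.target) (v : 𝔼) :
    c.push q (c.pull (c.φ.symm q) v) = v := by
  have h := push_pull (c.φ.map_target hq) v
  rwa [c.φ.right_inv hq] at h

lemma pull_push_symm {q : 𝔼} (hq : q ∈ c.φ.target) (v : 𝔼) :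
    c.pull (c.φ.symm q) (c.push q v) = v := by
  have h := pull_push (c.φ.map_target hq) v
  rwa [c.φ.right_inv hq] at h

lemma push_injective {q : 𝔼} (hq : q ∈ c.φ.target) : Function.Injective (c.push q) :=
  Function.LeftInverse.injective (pull_push_symm hq)

/-- `push q` as a linear isomorphism. -/
def pushEquiv {q : 𝔼} (hq : q ∈ c.φ.target) : 𝔼 ≃L[ℝ] 𝔼 :=
  .equivOfInverse (c.push q) (c.pull (c.φ.symm q)) (pull_push_symm hq) (push_pull_symm hq)

lemma isInvertible_push {q : 𝔼} (hq : q ∈ c.φ.target) : (c.push q).IsInvertible :=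
  ⟨pushEquiv hq, rfl⟩

variable (c) in
/-- The vector field `V` in coordinates. -/
def coordField (V : ∀ g : G, TangentSpace 𝓘(ℝ, 𝔼) g) (q : 𝔼) : 𝔼 :=
  VectorField.mpullback 𝓘(ℝ, 𝔼) 𝓘(ℝ, 𝔼) c.φ.symm V q

/-- `coordField` is a pullback along the inverse chart so that naturality of the Lie bracket applies
to it; this evaluates the pullback by the chart derivative. -/
lemma coordField_eq {q : 𝔼} (hq : q ∈ c.φ.target) (V : ∀ g : G, TangentSpace 𝓘(ℝ, 𝔼) g) :
    c.coordField V q = c.pull (c.φ.symm q) (V (c.φ.symm q) : 𝔼) := by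
  have h : (c.push q).inverse = c.pull (c.φ.symm q) :=
    ContinuousLinearMap.inverse_equiv (pushEquiv hq)
  exact DFunLike.congr_fun h (V (c.φ.symm q) : 𝔼)

lemma push_coordField {q : 𝔼} (hq : q ∈ c.φ.target) (V : ∀ g : G, TangentSpace 𝓘(ℝ, 𝔼) g) :
    c.push q (c.coordField V q) = (V (c.φ.symm q) : 𝔼) := by
  rw [coordField_eq hq]
  exact push_pull_symm hq _

lemma contMDiffAt_symm {q : 𝔼} (hq : q ∈ c.φ.target) :
    ContMDiffAt 𝓘(ℝ, 𝔼) 𝓘(ℝ, 𝔼) ∞ c.φ.symm q :=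
  c.contMDiffOn_φ_symm.contMDiffAt (c.φ.open_target.mem_nhds hq)

section vectorFields

variable [IsManifold 𝓘(ℝ, CoordSpace n m) ∞ G]

lemma contDiffAt_coordField {V : ∀ g : G, TangentSpace 𝓘(ℝ, 𝔼) g} {q : 𝔼}
    (hq : q ∈ c.φ.target)
    (hV : ContMDiff 𝓘(ℝ, 𝔼) 𝓘(ℝ, 𝔼).tangent ∞
      (fun g => (⟨g, V g⟩ : TangentBundle 𝓘(ℝ, 𝔼) G))) :
    ContDiffAt ℝ ∞ (c.coordField V) q := by
  have h := ContMDiffAt.mpullback_vectorField_preimage (m := ∞) (n := ∞) (hV (c.φ.symm q))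
    (contMDiffAt_symm hq) (isInvertible_push hq) (by simp)
  exact contMDiffAt_vectorSpace_iff_contDiffAt.1 h

lemma push_lieBracket {V V' : ∀ g : G, TangentSpace 𝓘(ℝ, 𝔼) g} {q : 𝔼}
    (hq : q ∈ c.φ.target)
    (hV : ContMDiff 𝓘(ℝ, 𝔼) 𝓘(ℝ, 𝔼).tangent ∞
      (fun g => (⟨g, V g⟩ : TangentBundle 𝓘(ℝ, 𝔼) G)))
    (hV' : ContMDiff 𝓘(ℝ, 𝔼) 𝓘(ℝ, 𝔼).tangent ∞
      (fun g => (⟨g, V' g⟩ : TangentBundle 𝓘(ℝ, 𝔼) G))) :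
    c.push q (VectorField.lieBracket ℝ (c.coordField V) (c.coordField V') q) =
      (VectorField.mlieBracket 𝓘(ℝ, 𝔼) V V' (c.φ.symm q) : 𝔼) := by
  have : IsManifold 𝓘(ℝ, 𝔼) (minSmoothness ℝ 2) G :=
    .of_le (n := ∞) (by simpa using ENat.LEInfty.out)
  have h := VectorField.mpullback_mlieBracket (n := ∞) (hV.mdifferentiable (by simp) _)
    (hV'.mdifferentiable (by simp) _) (contMDiffAt_symm hq) (by simpa using ENat.LEInfty.out)
  have e : VectorField.mlieBracket 𝓘(ℝ, 𝔼) (c.coordField V) (c.coordField V') q =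
      VectorField.lieBracket ℝ (c.coordField V) (c.coordField V') q :=
    VectorField.mlieBracket_eq_lieBracket_of_normedSpace ..
  rw [← push_coordField hq (VectorField.mlieBracket 𝓘(ℝ, 𝔼) V V')]
  exact congrArg (c.push q) (e.symm.trans h.symm)

end vectorFields

/-- The kernel of the derivative of a map `G → M`, in charts. -/
lemma mfderiv_push_eq_zero_iff {F : G → M} (hF : ContMDiff 𝓘(ℝ, 𝔼) 𝓘(ℝ, 𝕏) ∞ F) {q : 𝔼}
    (hq : q ∈ c.φ.target) (hs : F (c.φ.symm q) ∈ c.ψ.source) (z : 𝔼) :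
    mfderiv 𝓘(ℝ, 𝔼) 𝓘(ℝ, 𝕏) F (c.φ.symm q) (c.push q z) = 0 ↔
      fderiv ℝ (fun r => c.ψ (F (c.φ.symm r))) q z = 0 := by
  have h1 := (hF.mdifferentiable (by simp) (c.φ.symm q)).hasMFDerivAt.comp q (hasMFDerivAt_symm hq)
  have h2 := (c.trivData.mdiffψ.mdifferentiableAt hs).hasMFDerivAt.comp q h1
  have h3 : fderiv ℝ (fun r => c.ψ (F (c.φ.symm r))) q z =
      mfderiv 𝓘(ℝ, 𝕏) 𝓘(ℝ, 𝕏) c.ψ (F (c.φ.symm q))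
        (mfderiv 𝓘(ℝ, 𝔼) 𝓘(ℝ, 𝕏) F (c.φ.symm q) (c.push q z)) := by
    rw [← mfderiv_eq_fderiv]
    exact DFunLike.congr_fun h2.mfderiv z
  rw [h3]
  exact ⟨fun h => by rw [h]; exact map_zero _,
    fun h => (c.trivData.mdiffψ.mfderiv_injective hs) (h.trans (map_zero _).symm)⟩

lemma mfderiv_α_push_eq_zero_iff {q : 𝔼} (hq : q ∈ c.φ.target) (z : 𝔼) :
    mfderiv 𝓘(ℝ, 𝔼) 𝓘(ℝ, 𝕏) 𝒢.α (c.φ.symm q) (c.push q z) = 0 ↔ z.1 = 0 := by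
  rw [mfderiv_push_eq_zero_iff 𝒢.contMDiff_α hq (c.α_mem _ (c.φ.map_target hq))]
  exact iff_of_eq (congrArg (· = (0 : 𝕏)) (DFunLike.congr_fun (fderiv_αLoc hq) z))

variable (hW : 𝒢.IsSymmetricNhd c.φ.source x₀ W)
include hW

lemma mfderiv_β_push_eq_zero_iff {q : 𝔼} (hq : q ∈ c.dom W) (z : 𝔼) :
    mfderiv 𝓘(ℝ, 𝔼) 𝓘(ℝ, 𝕏) 𝒢.β (c.φ.symm q) (c.push q z) = 0 ↔ fderiv ℝ c.b q z = 0 :=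
  mfderiv_push_eq_zero_iff 𝒢.contMDiff_β hq.1 (β_mem hW hq.2) z

end AdaptedCoords

end LieGroupoid

/-! ### The Poincaré-Cartan section in coordinates. -/

namespace LieGroupoid

variable {n m : ℕ} {M G : Type*}
  [TopologicalSpace M] [ChartedSpace (EuclideanSpace ℝ (Fin n)) M]
  [TopologicalSpace G] [ChartedSpace (CoordSpace n m) G]

local notation "𝔼" => CoordSpace n m
local notation "𝕏" => EuclideanSpace ℝ (Fin n)
local notation "𝕍" => EuclideanSpace ℝ (Fin m)

namespace AdaptedCoords

variable {𝒢 : LieGroupoid n m M G} {c : 𝒢.AdaptedCoords} {x₀ : M} {W : Set G}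

variable (hW : 𝒢.IsSymmetricNhd c.φ.source x₀ W)
include hW

/-- Because `(z⁻¹k)k⁻¹ = z⁻¹`. The result depends on `k` only through `α(k)`: the frame `dInvMul` is
right-invariant. -/
lemma TRight_inv_push {k : G} (hk : k ∈ W) (w : 𝕍) :
    (𝒢.TRight (𝒢.inv k) k (c.push (c.φ k) (c.dInvMul (c.φ k) w) : 𝔼) : 𝔼) =
      (mfderiv 𝓘(ℝ, 𝔼) 𝓘(ℝ, 𝔼) 𝒢.inv (𝒢.ε (𝒢.α k)) (c.push (c.ψ (𝒢.α k), 0) (0, w) : 𝔼) :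
        𝔼) := by
  have hq := φ_mem_dom hW hk
  have hφ := c.φ.left_inv (hW.subset hk)
  have hσ : c.φ.symm (c.invMul (c.φ k) 0) = k := by rw [invMul_zero hW hq, hφ]
  have hev := eventually_mem_dom hW (zero_mem_dom hW hq)
  have hs : ∀ᶠ v in 𝓝 (0 : 𝕍), c.φ.symm (c.invMul (c.φ k) v) ∈ 𝒢.β ⁻¹' {𝒢.α (𝒢.inv k)} := by
    filter_upwards [hev] with v hv
    rw [mem_preimage, symm_invMul hW hq hv, 𝒢.β_mul _ _ (c.composable_inv hq.1 hv.1), hφ,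
      𝒢.α_inv, mem_singleton_iff]
  have h1 := (𝒢.mdifferentiableWithinAt_mul_right (𝒢.α_inv k).symm).hasMFDerivAt_comp_of_eq
    (hasMFDerivAt_symm_comp (invMul_zero hW hq) hq.1 (hasFDerivAt_invMul hW hq)) hσ hs
  have h2 := hasMFDerivAt_inv_slice hW hq
  have h3 : (fun z => 𝒢.mul z (𝒢.inv k)) ∘ (fun v => c.φ.symm (c.invMul (c.φ k) v))
      =ᶠ[𝓝 (0 : 𝕍)] fun v => 𝒢.inv (c.φ.symm ((c.φ k).1, v)) := by
    filter_upwards [hev] with v hv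
    have hc := c.composable_inv hq.1 hv.1
    rw [hφ] at hc
    rw [Function.comp_apply, symm_invMul hW hq hv, hφ, 𝒢.mul_mul_inv_cancel hc]
  have h4 := DFunLike.congr_fun (hasMFDerivAt_unique h1 (h2.congr_of_eventuallyEq h3)) w
  rw [hφ, c.fst_eq k (hW.subset hk)] at h4
  exact h4

/-- In the right-invariant frame, `nablaRight` differentiates the coefficients: on the fibre of `α`
through `h` the right translate of `X` is a fixed linear map applied to `a`. -/
lemma nablaRight_eq_push {X Y : ∀ g : G, TangentSpace 𝓘(ℝ, 𝔼) g} {h : G} (hh : h ∈ W)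
    {a : 𝔼 → 𝕍} {w : 𝕍} (ha : DifferentiableAt ℝ a (c.φ h))
    (hX : ∀ᶠ k in 𝓝 h, (X k : 𝔼) = c.push (c.φ k) (c.dInvMul (c.φ k) (a (c.φ k))))
    (hY : (Y h : 𝔼) = c.push (c.φ h) (0, w)) :
    (𝒢.nablaRight Y X h : 𝔼) =
      c.push (c.φ h) (c.dInvMul (c.φ h) (fderiv ℝ a (c.φ h) (0, w))) := by
  have hq := φ_mem_dom hW hh
  have hφ := c.φ.left_inv (hW.subset hh)
  let J : 𝕍 →L[ℝ] 𝔼 :=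
    (mfderiv 𝓘(ℝ, 𝔼) 𝓘(ℝ, 𝔼) 𝒢.inv (𝒢.ε (𝒢.α h)) : 𝔼 →L[ℝ] 𝔼).comp
      ((c.push (c.ψ (𝒢.α h), 0)).comp (.inr ℝ 𝕏 𝕍))
  have hJa : HasFDerivAt (fun r => J (a r)) (J.comp (fderiv ℝ a (c.φ h))) (c.φ h) :=
    J.hasFDerivAt.comp _ ha.hasFDerivAt
  have hd : MDifferentiableAt 𝓘(ℝ, 𝔼) 𝓘(ℝ, 𝔼) (fun k => J (a (c.φ k))) h :=
    hJa.differentiableAt.mdifferentiableAt.comp h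
      (hasMFDerivAt_φ (hW.subset hh)).mdifferentiableAt
  -- The identity holds only within the fibre, where `α k = α h` makes `J` independent of `k`; a
  -- derivative within the fibre needs no more.
  have hev : 𝒢.rightTriv X =ᶠ[𝓝[𝒢.α ⁻¹' {𝒢.α h}] h] fun k => J (a (c.φ k)) := by
    filter_upwards [nhdsWithin_le_nhds hX, nhdsWithin_le_nhds (hW.isOpen.mem_nhds hh),
      self_mem_nhdsWithin] with k hk hkW hkα
    have hkα' : 𝒢.α k = 𝒢.α h := hkα
    have e := TRight_inv_push hW hkW (a (c.φ k))
    rw [← hk, hkα'] at e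
    exact e
  have hs : ∀ᶠ v in 𝓝 (c.φ h).2, c.φ.symm ((c.φ h).1, v) ∈ 𝒢.α ⁻¹' {𝒢.α h} := by
    filter_upwards [eventually_α_slice hq.1] with v hv
    rw [mem_preimage, hv, hφ, mem_singleton_iff]
  have h1 := (hd.mdifferentiableWithinAt (s := 𝒢.α ⁻¹' {𝒢.α h})).hasMFDerivAt_comp_of_eq
    (hasMFDerivAt_slice (x := (c.φ h).1) (u := (c.φ h).2) hq.1) hφ hs
  have h2 : HasFDerivAt (fun v => J (a ((c.φ h).1, v)))
      ((J.comp (fderiv ℝ a (c.φ h))).comp (.inr ℝ 𝕏 𝕍)) (c.φ h).2 :=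
    HasFDerivAt.comp (g := fun r => J (a r)) (c.φ h).2 hJa (hasFDerivAt_prodMk_right _ _)
  have h3 : (fun k => J (a (c.φ k))) ∘ (fun v => c.φ.symm ((c.φ h).1, v)) =ᶠ[𝓝 (c.φ h).2]
      fun v => J (a ((c.φ h).1, v)) := by
    filter_upwards [eventually_mem_dom hW hq] with v hv
    rw [Function.comp_apply, c.φ.right_inv hv.1]
  have h4 := DFunLike.congr_fun
    (hasMFDerivAt_unique h1 (h2.hasMFDerivAt.congr_of_eventuallyEq h3)) w
  have h5 := hev.mfderivWithin_eq (I := 𝓘(ℝ, 𝔼)) (I' := 𝓘(ℝ, 𝔼)) (hev.self_of_nhdsWithin rfl)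
  have h6 : (mfderivWithin 𝓘(ℝ, 𝔼) 𝓘(ℝ, 𝔼) (𝒢.rightTriv X) (𝒢.α ⁻¹' {𝒢.α h}) h (Y h) : 𝔼) =
      J (fderiv ℝ a (c.φ h) (0, w)) := by
    refine (congrArg (mfderivWithin 𝓘(ℝ, 𝔼) 𝓘(ℝ, 𝔼) (𝒢.rightTriv X) (𝒢.α ⁻¹' {𝒢.α h}) h :
      𝔼 →L[ℝ] 𝔼) hY).trans ?_
    exact (DFunLike.congr_fun h5 _).trans h4
  rw [← rightField_eq_push hW _ hh]
  exact congrArg (𝒢.TRight h (𝒢.ε (𝒢.α h)) : 𝔼 →L[ℝ] 𝔼) h6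

end AdaptedCoords

variable [IsManifold 𝓘(ℝ, CoordSpace n m) ∞ G]

namespace AdaptedCoords

variable {𝒢 : LieGroupoid n m M G} {c : 𝒢.AdaptedCoords} {x₀ : M} {W : Set G}

variable (c) in
/-- Near the point with coordinates `q`, the `β`-vertical part of `ξ` is `a`, in terms of the frame
of right-invariant fields, and at this point the `α`-vertical part of `ξ` is `w`. -/
structure IsCoordsAt (ξ : 𝒢.PSection) (q : 𝔼) (a : 𝔼 → 𝕍) (w : 𝕍) : Prop where
  differentiableAt : DifferentiableAt ℝ a q
  X_eq : ∀ᶠ k in 𝓝 (c.φ.symm q), (ξ.X k : 𝔼) = c.push (c.φ k) (c.dInvMul (c.φ k) (a (c.φ k)))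
  Y_eq : (ξ.Y (c.φ.symm q) : 𝔼) = c.push q (0, w)

lemma IsCoordsAt.coordField_eventuallyEq {ξ : 𝒢.PSection} {q : 𝔼} {a : 𝔼 → 𝕍} {w : 𝕍}
    (h : c.IsCoordsAt ξ q a w) (hq : q ∈ c.φ.target) :
    c.coordField ξ.X =ᶠ[𝓝 q] fun r => c.dInvMul r (a r) := by
  filter_upwards [(c.φ.continuousAt_symm hq).eventually h.X_eq,
    c.φ.open_target.mem_nhds hq] with r hr hrt
  rw [coordField_eq hrt, hr, c.φ.right_inv hrt, pull_push_symm hrt]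

variable (hW : 𝒢.IsSymmetricNhd c.φ.source x₀ W)
include hW

lemma dirDeriv_thetaMinus {L : G → ℝ} (hL : ContMDiff 𝓘(ℝ, 𝔼) 𝓘(ℝ, ℝ) ∞ L) (ξ : 𝒢.PSection)
    {q : 𝔼} (hq : q ∈ c.dom W) (z : 𝔼) :
    dirDeriv (fun g => thetaMinus L g (ξ.X g, ξ.Y g)) (c.φ.symm q) (c.push q z) =
      -fderiv ℝ (fun r => fderiv ℝ (c.lag L) r (c.coordField ξ.X r)) q z := by
  have hd : DifferentiableAt ℝ (fun r => fderiv ℝ (c.lag L) r (c.coordField ξ.X r)) q :=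
    (((contDiffAt_lag hW hL hq).fderiv_right (m := ∞) (by simp)).differentiableAt
      (by simp)).clm_apply ((contDiffAt_coordField hq.1 ξ.contMDiff_X).differentiableAt (by simp))
  have h := dirDeriv_push_of_eventuallyEq
    (f := fun g => thetaMinus L g (ξ.X g, ξ.Y g)) (c := c) hq.1 hd.neg (by
      filter_upwards [hW.isOpen.mem_nhds hq.2] with g hg
      have e := push_coordField (φ_mem_dom hW hg).1 ξ.X
      have e2 := dirDeriv_push_lag hW hL hg (c.coordField ξ.X (c.φ g))
      rw [e, c.φ.left_inv (hW.subset hg)] at e2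
      exact congrArg Neg.neg e2) z
  rw [h, fderiv_neg]
  rfl

/-- The coefficient function `a` comes from the smooth right-trivialization of
`exists_dInvMul_section`; `α`-vertical vectors have first component zero. -/
lemma exists_isCoordsAt (ξ : 𝒢.PSection) {q : 𝔼} (hq : q ∈ c.dom W) :
    ∃ a w, c.IsCoordsAt ξ q a w := by
  obtain ⟨B, hB, hB'⟩ := exists_dInvMul_section hW
  refine ⟨fun r => B r (c.coordField ξ.X r), (c.pull (c.φ.symm q) (ξ.Y (c.φ.symm q))).2,
    ?_, ?_, ?_⟩
  · exact ((hB q hq).differentiableAt (by simp)).clm_apply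
      ((contDiffAt_coordField hq.1 ξ.contMDiff_X).differentiableAt (by simp))
  · filter_upwards [hW.isOpen.mem_nhds hq.2] with k hk
    have hqk := φ_mem_dom hW hk
    have e := push_coordField hqk.1 ξ.X
    have hv := ξ.X_vertical (c.φ.symm (c.φ k))
    rw [← e, mfderiv_β_push_eq_zero_iff hW hqk] at hv
    rw [hB' _ hqk _ hv, e, c.φ.left_inv (hW.subset hk)]
  · have e := push_pull_symm hq.1 (ξ.Y (c.φ.symm q) : 𝔼)
    have hv := ξ.Y_vertical (c.φ.symm q)
    rw [← e, mfderiv_α_push_eq_zero_iff hq.1] at hv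
    refine e.symm.trans (congrArg (c.push q) ?_)
    exact Prod.ext (y := (0, (c.pull (c.φ.symm q) (ξ.Y (c.φ.symm q))).2)) hv rfl

/-- The Poincaré-Cartan 2-section in coordinates. -/
lemma poincareCartan_eq {L : G → ℝ} (hL : ContMDiff 𝓘(ℝ, 𝔼) 𝓘(ℝ, ℝ) ∞ L) {ξ η : 𝒢.PSection}
    {q : 𝔼} (hq : q ∈ c.dom W) {a a' : 𝔼 → 𝕍} {w w' : 𝕍} (hξ : c.IsCoordsAt ξ q a w)
    (hη : c.IsCoordsAt η q a' w') :
    poincareCartan L ξ η (c.φ.symm q) =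
      fderiv ℝ (c.legMinus L) q (0, w') (a q) - fderiv ℝ (c.legMinus L) q (0, w) (a' q) := by
  have hs := c.φ.right_inv hq.1
  have hleg := (contDiffAt_legMinus hW hL hq).differentiableAt (by simp)
  have hn {ξ η : 𝒢.PSection} {a a' : 𝔼 → 𝕍} {w w' : 𝕍} (hξ : c.IsCoordsAt ξ q a w)
      (hη : c.IsCoordsAt η q a' w') : (𝒢.nablaRight ξ.Y η.X (c.φ.symm q) : 𝔼) =
        c.push q (c.dInvMul q (fderiv ℝ a' q (0, w))) := by
    have e := nablaRight_eq_push hW hq.2 (X := η.X) (Y := ξ.Y) (a := a') (w := w)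
      (by rw [hs]; exact hη.differentiableAt) hη.X_eq (by rw [hs]; exact hξ.Y_eq)
    rwa [hs] at e
  -- The Leibniz rule applied to `Θ⁻(ξ) = legMinus(a)`.
  have ht {ξ : 𝒢.PSection} {a : 𝔼 → 𝕍} {w : 𝕍} (hξ : c.IsCoordsAt ξ q a w) (z : 𝔼) :
      -fderiv ℝ (fun r => fderiv ℝ (c.lag L) r (c.coordField ξ.X r)) q z =
        fderiv ℝ (c.legMinus L) q z (a q) + c.legMinus L q (fderiv ℝ a q z) := by
    have e : (fun r => fderiv ℝ (c.lag L) r (c.coordField ξ.X r)) =ᶠ[𝓝 q]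
        fun r => -c.legMinus L r (a r) := by
      filter_upwards [hξ.coordField_eventuallyEq hq.1] with r hr
      rw [hr]
      simp [legMinus]
    rw [e.fderiv_eq, fderiv_fun_neg, fderiv_clm_apply hleg hξ.differentiableAt]
    simp [add_comm]
  have hb : thetaMinus L (c.φ.symm q) (pBracket ξ η (c.φ.symm q)) =
      -fderiv ℝ (c.lag L) q (VectorField.lieBracket ℝ (c.coordField ξ.X) (c.coordField η.X) q
        + c.dInvMul q (fderiv ℝ a' q (0, w)) - c.dInvMul q (fderiv ℝ a q (0, w'))) := by
    have e : ((pBracket ξ η (c.φ.symm q)).1 : 𝔼) = c.push q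
        (VectorField.lieBracket ℝ (c.coordField ξ.X) (c.coordField η.X) q
        + c.dInvMul q (fderiv ℝ a' q (0, w)) - c.dInvMul q (fderiv ℝ a q (0, w'))) := by
      rw [map_sub, map_add, push_lieBracket hq.1 ξ.contMDiff_X η.contMDiff_X, ← hn hξ hη,
        ← hn hη hξ]
      rfl
    have e2 := dirDeriv_push_lag hW hL hq.2 (VectorField.lieBracket ℝ (c.coordField ξ.X)
        (c.coordField η.X) q
        + c.dInvMul q (fderiv ℝ a' q (0, w)) - c.dInvMul q (fderiv ℝ a q (0, w')))
    rw [hs] at e2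
    rw [← e2, ← e]
    rfl
  have hz {ξ : 𝒢.PSection} {a : 𝔼 → 𝕍} {w : 𝕍} (hξ : c.IsCoordsAt ξ q a w) :
      (ξ.X (c.φ.symm q) + ξ.Y (c.φ.symm q) : 𝔼) = c.push q (c.coordField ξ.X q + (0, w)) := by
    rw [map_add, push_coordField hq.1, ← hξ.Y_eq]
    rfl
  have h1 := dirDeriv_thetaMinus hW hL η hq (c.coordField ξ.X q + (0, w))
  have h2 := dirDeriv_thetaMinus hW hL ξ hq (c.coordField η.X q + (0, w'))
  rw [← hz hξ] at h1
  rw [← hz hη] at h2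
  -- As `Θ⁻` is `-dL` on the first component, `Θ⁻` of the commutator cancels the derivatives along
  -- `ξ.X` and `η.X`. The terms `legMinus(D_w a')` and `legMinus(D_{w'} a)` from `ht` cancel against
  -- the `nablaRight` terms of the bracket.
  have hl := fderiv_lieBracket (contDiffAt_lag hW hL hq)
    ((contDiffAt_coordField hq.1 ξ.contMDiff_X).differentiableAt (by simp))
    ((contDiffAt_coordField hq.1 η.contMDiff_X).differentiableAt (by simp))
  have hm (v : 𝕍) : c.legMinus L q v = -fderiv ℝ (c.lag L) q (c.dInvMul q v) := rfl
  have t1 := ht hη (0, w)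
  have t2 := ht hξ (0, w')
  have h3 := congrArg Neg.neg (congrArg₂ (fun x y : ℝ => x - y)
    (congrArg₂ (fun x y : ℝ => x - y) h1 h2) hb)
  refine Eq.trans h3 ?_
  beta_reduce
  rw [map_sub, map_add, map_add, map_add, hl]
  rw [hm] at t1 t2
  linarith

end AdaptedCoords

end LieGroupoid

/-! ### Test sections and nondegeneracy. -/

namespace LieGroupoid

variable {n m : ℕ} {M G : Type*}
  [TopologicalSpace M] [ChartedSpace (EuclideanSpace ℝ (Fin n)) M]
  [TopologicalSpace G] [ChartedSpace (CoordSpace n m) G]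
  [IsManifold 𝓘(ℝ, CoordSpace n m) ∞ G]

local notation "𝔼" => CoordSpace n m
local notation "𝕏" => EuclideanSpace ℝ (Fin n)
local notation "𝕍" => EuclideanSpace ℝ (Fin m)

namespace AdaptedCoords

variable {𝒢 : LieGroupoid n m M G} {c : 𝒢.AdaptedCoords} {x₀ : M} {W : Set G}
  (hW : 𝒢.IsSymmetricNhd c.φ.source x₀ W)
include hW

/-- On `W` this field is the pullback of `F` along the chart, since `push` inverts `pull`. -/
lemma contMDiffOn_push {F : 𝔼 → 𝔼} (hF : ∀ q ∈ c.dom W, ContDiffAt ℝ ∞ F q) :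
    ContMDiffOn 𝓘(ℝ, 𝔼) 𝓘(ℝ, 𝔼).tangent ∞
      (fun k => (⟨k, (c.push (c.φ k) (F (c.φ k)) : 𝔼)⟩ : TangentBundle 𝓘(ℝ, 𝔼) G)) W := by
  intro k hk
  have hs {k : G} (hk : k ∈ W) : (c.pull k).inverse = c.push (c.φ k) :=
    ContinuousLinearMap.inverse_equiv (ContinuousLinearEquiv.equivOfInverse (c.pull k)
      (c.push (c.φ k)) (push_pull (hW.subset hk)) (pull_push (hW.subset hk)))
  have hinv : (c.pull k).IsInvertible :=
    ⟨.equivOfInverse (c.pull k) (c.push (c.φ k)) (push_pull (hW.subset hk))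
      (pull_push (hW.subset hk)), rfl⟩
  have h := ContMDiffAt.mpullback_vectorField_preimage (m := ∞) (n := ∞) (x₀ := k) (f := c.φ)
    (I := 𝓘(ℝ, 𝔼)) (I' := 𝓘(ℝ, 𝔼)) (V := F)
    (contMDiffAt_vectorSpace_iff_contDiffAt.2 (hF _ (φ_mem_dom hW hk)))
    (c.contMDiffOn_φ.contMDiffAt (c.φ.open_source.mem_nhds (hW.subset hk))) hinv (by simp)
  refine h.contMDiffWithinAt.congr_of_mem (fun y hy => ?_) hk
  exact congrArg (TotalSpace.mk y) (DFunLike.congr_fun (hs hy) (F (c.φ y))).symm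

/-- The last clause records that the cut-off only rescales the field pointwise, so verticality is
preserved. -/
lemma exists_field_eventuallyEq [T2Space G] {F : 𝔼 → 𝔼} (hF : ∀ q ∈ c.dom W, ContDiffAt ℝ ∞ F q)
    {h : G} (hh : h ∈ W) :
    ∃ V : ∀ g : G, TangentSpace 𝓘(ℝ, 𝔼) g,
      ContMDiff 𝓘(ℝ, 𝔼) 𝓘(ℝ, 𝔼).tangent ∞
        (fun g => (⟨g, V g⟩ : TangentBundle 𝓘(ℝ, 𝔼) G)) ∧
      (∀ᶠ k in 𝓝 h, (V k : 𝔼) = c.push (c.φ k) (F (c.φ k))) ∧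
      ∀ k, V k = 0 ∨ k ∈ W ∧ ∃ t : ℝ, (V k : 𝔼) = c.push (c.φ k) (t • F (c.φ k)) := by
  obtain ⟨ψ, h1, h2, h3⟩ := exists_bump_smul_section (I := 𝓘(ℝ, 𝔼))
    (V := (TangentSpace 𝓘(ℝ, 𝔼) : G → Type _)) hW.isOpen hh (contMDiffOn_push hW hF)
  refine ⟨_, h3, ?_, fun k => ?_⟩
  · filter_upwards [h1] with k hk
    change ψ k • c.push (c.φ k) (F (c.φ k)) = _
    rw [hk, Pi.one_apply, one_smul]
  · by_cases hk : k ∈ W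
    · exact .inr ⟨hk, ψ k, (map_smul (c.push (c.φ k)) (ψ k) (F (c.φ k))).symm⟩
    · left
      change ψ k • c.push (c.φ k) (F (c.φ k)) = 0
      rw [h2 k hk, zero_smul]

/-- Sections of this kind and of the kind in `exists_pSection_Y` realize all pairs `(a, 0)` and `(0,
w)` at `q`; pairing with them isolates the two terms of `poincareCartan_eq`. -/
lemma exists_pSection_X [T2Space G] {q : 𝔼} (hq : q ∈ c.dom W) (a : 𝕍) :
    ∃ ξ : 𝒢.PSection, c.IsCoordsAt ξ q (fun _ => a) 0 := by
  obtain ⟨V, h1, h2, h3⟩ := exists_field_eventuallyEq hW (F := fun r => c.dInvMul r a)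
    (fun r hr => (contDiffAt_dInvMul hW hr).clm_apply contDiffAt_const) hq.2
  refine ⟨⟨V, fun _ => 0, h1, contMDiff_zeroSection _ _, fun k => ?_, fun k => map_zero _⟩,
    differentiableAt_const _, h2, (map_zero (c.push q)).symm⟩
  obtain hk | ⟨hk, t, ht⟩ := h3 k
  · rw [hk]; exact map_zero _
  · have hqk := φ_mem_dom hW hk
    have e := (mfderiv_β_push_eq_zero_iff hW hqk (t • c.dInvMul (c.φ k) a)).2
      (by rw [map_smul, fderiv_b_dInvMul hW hqk, smul_zero])
    rwa [← ht, c.φ.left_inv (hW.subset hk)] at e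

lemma exists_pSection_Y [T2Space G] {q : 𝔼} (hq : q ∈ c.dom W) (w : 𝕍) :
    ∃ ξ : 𝒢.PSection, c.IsCoordsAt ξ q (fun _ => 0) w := by
  obtain ⟨V, h1, h2, h3⟩ := exists_field_eventuallyEq hW (F := fun _ => (0, w))
    (fun r hr => contDiffAt_const) hq.2
  refine ⟨⟨fun _ => 0, V, contMDiff_zeroSection _ _, h1, fun k => map_zero _, fun k => ?_⟩,
    differentiableAt_const _, .of_forall fun k => ?_, ?_⟩
  · obtain hk | ⟨hk, t, ht⟩ := h3 k
    · rw [hk]; exact map_zero _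
    · have hqk := φ_mem_dom hW hk
      have e := (mfderiv_α_push_eq_zero_iff hqk.1 (t • ((0, w) : 𝔼))).2 (smul_zero t)
      rwa [← ht, c.φ.left_inv (hW.subset hk)] at e
  · rw [map_zero, map_zero]; rfl
  · have e := h2.self_of_nhds
    rwa [c.φ.right_inv hq.1] at e


/-- The Poincaré-Cartan 2-section is nondegenerate if and only if the matrix `FL` is regular. -/
theorem isUnit_FL_iff_poincareCartanNondegenerateAt [T2Space G] {L : G → ℝ}
    (hL : ContMDiff 𝓘(ℝ, 𝔼) 𝓘(ℝ, ℝ) ∞ L) {h : G} (hh : h ∈ W) :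
    IsUnit (c.FL L (c.φ h)) ↔ 𝒢.PoincareCartanNondegenerateAt L h := by
  have hq := φ_mem_dom hW hh
  have hφ := c.φ.left_inv (hW.subset hh)
  constructor
  · intro hu ξ hξ
    obtain ⟨a, w, hc⟩ := exists_isCoordsAt hW ξ hq
    -- Pairing with sections `(0, w')` leaves only the term in `a`. Once `a = 0`, pairing with
    -- sections `(a', 0)` leaves the term in `w`.
    have ha : a (c.φ h) = 0 := by
      refine eq_zero_of_isUnit_FL hW hL hq hu fun w' => ?_
      obtain ⟨η, hη⟩ := exists_pSection_Y hW hq w'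
      have e := poincareCartan_eq hW hL hq hc hη
      rw [hφ, hξ η, map_zero, sub_zero] at e
      exact e.symm
    have hw : w = 0 := by
      refine (isUnit_FL_iff hW hL hq).1 hu w (ContinuousLinearMap.ext fun a' => ?_)
      obtain ⟨η, hη⟩ := exists_pSection_X hW hq a'
      have e := poincareCartan_eq hW hL hq hc hη
      rw [hφ, hξ η, ha, map_zero, zero_sub, zero_eq_neg] at e
      exact e
    constructor
    · have e := hc.X_eq.self_of_nhds
      rw [hφ, ha, map_zero, map_zero] at e
      exact e
    · have e := hc.Y_eq
      rw [hφ, hw, Prod.mk_zero_zero, map_zero] at e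
      exact e
  · intro hn
    refine (isUnit_FL_iff hW hL hq).2 fun w hw => ?_
    -- For `w` in the left kernel, the section with `a = 0` and this `w` is orthogonal to every
    -- section.
    obtain ⟨ξ, hξ⟩ := exists_pSection_Y hW hq w
    have h0 := (hn ξ fun η => ?_).2
    · have e := hξ.Y_eq
      rw [hφ, h0] at e
      exact congrArg Prod.snd (push_injective hq.1 (e.symm.trans (map_zero (c.push (c.φ h))).symm))
    · obtain ⟨a', w', hη⟩ := exists_isCoordsAt hW η hq
      have e := poincareCartan_eq hW hL hq hξ hη
      rw [hφ, map_zero, hw] at e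
      simpa using e

end AdaptedCoords

end LieGroupoid

end

/-! ### The theorem. -/

theorem mainTheorem4 {n m : ℕ} {M G : Type*}
    [TopologicalSpace M] [T2Space M] [ChartedSpace (EuclideanSpace ℝ (Fin n)) M]
    [IsManifold 𝓘(ℝ, EuclideanSpace ℝ (Fin n)) ∞ M]
    [TopologicalSpace G] [T2Space G] [ChartedSpace (CoordSpace n m) G]
    [IsManifold 𝓘(ℝ, CoordSpace n m) ∞ G]
    (𝒢 : LieGroupoid n m M G)
    (L : G → ℝ) (hL : ContMDiff 𝓘(ℝ, CoordSpace n m) 𝓘(ℝ, ℝ) ∞ L)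
    (c : 𝒢.AdaptedCoords) (x₀ : M) (W : Set G) (hW : 𝒢.IsSymmetricNhd c.φ.source x₀ W)
    (g₀ h₀ : G) (hg₀ : g₀ ∈ W) (hh₀ : h₀ ∈ W) (hsol : 𝒢.IsSolution L g₀ h₀) :
    [IsUnit (c.FL L (c.φ h₀)),
      𝒢.PoincareCartanNondegenerateAt L h₀,
      𝒢.LegendreIsLocalDiffeoAt L h₀].TFAE ∧
    (IsUnit (c.FL L (c.φ h₀)) ∨ 𝒢.PoincareCartanNondegenerateAt L h₀ ∨
        𝒢.LegendreIsLocalDiffeoAt L h₀ →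
      ∃ (X₀ Y₀ : Set G) (Ψ : G → G),
        IsOpen X₀ ∧ X₀ ⊆ W ∧ g₀ ∈ X₀ ∧ IsOpen Y₀ ∧ Y₀ ⊆ W ∧ h₀ ∈ Y₀ ∧
        (∀ g ∈ X₀, ∀ h ∈ Y₀, 𝒢.IsSolution L g h ↔ h = Ψ g) ∧
        𝒢.IsLocalEvolutionOperator L X₀ Y₀ Ψ) := by
  have h1 := LieGroupoid.AdaptedCoords.isUnit_FL_iff_poincareCartanNondegenerateAt hW hL hh₀
  have h2 := LieGroupoid.AdaptedCoords.isUnit_FL_iff_legendreIsLocalDiffeoAt hW hL hh₀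
  refine ⟨?_, fun h => ?_⟩
  · tfae_have 1 ↔ 2 := h1
    tfae_have 1 ↔ 3 := h2
    tfae_finish
  · have hu : IsUnit (c.FL L (c.φ h₀)) := by
      rcases h with h | h | h
      exacts [h, h1.2 h, h2.2 h]
    exact LieGroupoid.AdaptedCoords.exists_evolutionOperator hW hL hg₀ hh₀ hsol hu
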